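/- **Definitions.** For rooted trees $t_1,\dots,t_n$ let $[t_1\cdots t_n]$ be the rooted tree obtained by joining their roots to a new vertex, the new root; $\bullet=[\,]$ is the one-vertex tree, $|t|$ is the number of vertices, $\bullet!=1$ and $[t_1\cdots t_n]!=|[t_1\cdots t_n]|\prod_m t_m!$. For an $s\times s$ real matrix $A$ let $\Phi(\bullet)=\mathbf 1\in\mathbb R^s$ and let $\Phi([t_1\cdots t_n])$ be the entrywise product of the vectors $A\Phi(t_m)$. A Runge–Kutta method $(A,b,c)$ with $s$ stages and $A\mathbf 1=c$ has order (at least) $10$ if $b\,\Phi(t)=1/t!$ for all rooted trees $t$ with $|t|\le10$; there are, up to isomorphism, exactly $1205$ such trees. It is explicit if $a_{ij}=0$ whenever $j\ge i$. Put $$d_{4,j}=\sum_i b_i c_i^4 a_{ij}-\tfrac15 b_j(1-c_j^5).$$ **Constants.** Let $\alpha=\sqrt{(7+2\sqrt7)/21}$, $\beta=\sqrt{(7-2\sqrt7)/21}$, $\theta_2=\frac{1-\alpha}2$, $\theta_3=\frac{1-\beta}2$, $\theta_4=\frac{1+\beta}2$, $\theta_5=\frac{1+\alpha}2$, $w_1=w_6=\frac1{30}$,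 $w_2=w_5=\frac{14-\sqrt7}{60}$, $w_3=w_4=\frac{14+\sqrt7}{60}$ (the interior nodes and the weights of the 6-point Lobatto quadrature on $[0,1]$, whose end nodes are $\theta_1=0$, $\theta_6=1$). Write $\langle n_1,\dots,n_8\mid n_9\rangle=(n_1+n_2\sqrt3+n_3\sqrt7+n_4\sqrt{21}+n_5\alpha+n_6\beta+n_7\sqrt7\,\alpha+n_8\sqrt7\,\beta)/n_9$, and let $\mathrm A_{15,14}$ = $\langle 1, 0, 0, 0, -1, 0, 0, 0\mid 2\rangle$; $\mathrm A_{15,13}$ = $\langle -107, 353, -341, 149, -821, 1503, -509, 843\mid 1416\rangle$; $\mathrm A_{14,13}$ = $\langle 815, -353, 341, -149, 821, -2211, 509, -843\mid 1416\rangle$; $\mathrm A_{15,12}$ = $\langle -1593179, -703001, 523855, 542527, 7003159, -2315751, -2257457, 672093\mid 1458168\rangle$; $\mathrm A_{14,12}$ = $\langle 325025, -242953, -352465, -38617, 389855, -1114275, -170833, -1028451\mid 1458168\rangle$; $\mathrm A_{13,12}$ = $\langle 332873, 157659, -28565, -83985, -1232169, 693185, 404715, 59393\mid 243028\rangle$;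 $\alpha_{63}$ = $\langle 6, -2, 0, 1, 12, 3, -6, 0\mid 72\rangle$; $\alpha_{53}$ = $\langle 30, -5, -6, 1, 30, 21, -6, -15\mid 144\rangle$; $\alpha_{43}$ = $\langle 9, 5, 3, -3, -39, 41, 15, 15\mid 96\rangle$; $\alpha_{33}$ = $\langle 11, 1, 1, 1, 3, -11, -3, -5\mid 96\rangle$; $\mathrm A_{15,10}$ = $\langle -30363, 37407, -20595, 13773, -88581, 226363, -12507, 81737\mid 55152\rangle$; $\mathrm A_{14,10}$ = $\langle 3384, -11215, 3141, -2166, 11751, -51027, 1596, -18702\mid 18384\rangle$; $\mathrm A_{13,10}$ = $\langle -2167, 7228, -1607, 2060, -6999, 35267, -1659, 12133\mid 27576\rangle$; $\mathrm A_{12,10}$ = $\langle 117149, -60598, 38062, -28367, 199746, -411836, 35073, -148213\mid 55152\rangle$; $\mathrm A_{11,10}$ = $\langle -16257, 10595, -5919, 4243, -26211, 67005, -6009, 24579\mid 13788\rangle$; $\alpha_{62}$ = $\langle 467, 244, -182, -88, 1457, -580, -560, 244\mid 72\rangle$; $\alpha_{52}$ = $\langle 551, 318, -197, -126, 2031, -734,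 -753, 242\mid 48\rangle$; $\alpha_{42}$ = $\langle 1749, 785, -525, -347, 4857, -2475, -1653, 639\mid 864\rangle$; $\alpha_{32}$ = $\langle -17439, -8189, 6135, 3359, -52563, 24135, 19263, -7539\mid 864\rangle$; $\alpha'_{32}$ = $\langle 637, 289, -221, -119, 1865, -879, -679, 273\mid 72\rangle$; $\alpha_{22}$ = $\langle -135, -97, 51, 37, -597, 179, 225, -65\mid 24\rangle$; $\alpha_{65}$ = $\langle -1865, 400, 194, -442, 5671, 3900, -1474, 294\mid 72\rangle$; $\alpha_{55}$ = $\langle 865, -520, -421, 142, -2535, -846, 1083, 648\mid 48\rangle$; $\alpha_{45}$ = $\langle 4251, 7555, 4641, 827, 5007, -24357, -10047, -13155\mid 864\rangle$; $\alpha_{35}$ = $\langle 24411, -39763, -23727, 6685, -149289, 10101, 75345, 46851\mid 864\rangle$; $a_{11,8}$ = $\langle -1397, 1219, 715, -359, 6259, 1329, -2609, -1119\mid 72\rangle$; $\alpha_{25}$ = $\langle -1002, 373, 249, -196, 2934, 1530, -939, -243\mid 24\rangle$; $a_{98}$ = $\langle 55, 28, 20, 11, -75, -175, -25, -65\mid 2\rangle$;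 $\alpha_{64}$ = $\langle -12120, 5558, 4524, -2131, 34092, 16017, -12816, -5850\mid 72\rangle$; $\alpha_{54}$ = $\langle 18054, -15493, -6840, 5831, -93786, -23529, 35508, 8961\mid 144\rangle$; $\alpha_{44}$ = $\langle -4381, 2147, 1741, -769, 12555, 5507, -4839, -2359\mid 96\rangle$; $\alpha_{34}$ = $\langle 48165, -22829, -18405, 8535, -137595, -62381, 52215, 24273\mid 96\rangle$; $\alpha'_{34}$ = $\langle -607, 293, 232, -110, 1771, 786, -671, -306\mid 4\rangle$; $\alpha_{24}$ = $\langle -19287, 12478, 7254, -4733, 75975, 25299, -28668, -9450\mid 72\rangle$; $\alpha'_{24}$ = $\langle 126, 13, 9, 26, -270, -318, 27, -69\mid 18\rangle$; $u_6$ = $\langle 17771, -8607, -4789, 4335, -64330, -28602, 21794, 4230\mid 54\rangle$; $u_5$ = $\langle -12118, 5967, 4931, -2052, 33964, 14784, -13307, -6807\mid 36\rangle$; $u_4$ = $\langle 1153, -2902, -1712, 323, -9149, 2499, 5122, 3750\mid 36\rangle$; $u_3$ = $\langle -26894, 22579, 13153, -6818, 118174, 26544, -48563, -20445\mid 36\rangle$;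 $u'_3$ = $\langle 2881, -2231, -1307, 727, -12243, -3213, 4911, 1917\mid 12\rangle$; $u_2$ = $\langle 67950, -32635, -22419, 13484, -212940, -92400, 76203, 27903\mid 108\rangle$; $u'_2$ = $\langle -420, -198, -150, -80, 574, 1260, 187, 465\mid 2\rangle$; $U$ = $\langle 153566, 36694, 943, 14484, 178724, 81235, 53158, -28714\mid 1\rangle$; $U'$ = $\langle -134733, -9751, -2187, -2447, -78969, -35907, -17925, 14493\mid 1\rangle$; $U''$ = $\langle 1267700, 0, 0, 0, 0, 0, 0, 0\mid 1\rangle$; $V$ = $\langle 1854455, -323009, 188367, -152875, -723177, 1849113, -397521, 765441\mid 1\rangle$; $V'$ = $\langle -173229, 32676, -14883, 11874, 142380, -149989, 45426, -89567\mid 1\rangle$; $V''$ = $\langle 131201, -21770, 7390, -4531, -154203, 82173, -32718, 73122\mid 1\rangle$. **Construction.** Let $c_2,c_4,c_5,b_{10},b_{12},b_{13},b_{14}$ be real parameters. Put $c_1=0$, $c_3=\frac23c_4$, $$c_6=\frac{U(c_4+c_5)+14U'c_4c_5+U''c_4c_5(c_4+c_5)}{3U+14U'(c_4+c_5)+2U''(c_4^2+c_5^2)+7c_4c_5\bigl(V+20V'(c_4+c_5)+60V''c_4c_5\bigr)},$$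 $c_7=c_{13}=\theta_4$, $c_8=c_{14}=\theta_5$, $c_9=c_{10}=\theta_2$, $c_{11}=c_{12}=\theta_3$, $c_{15}=1$; $b_1=w_1$, $b_2=\dots=b_6=0$, $b_7=w_4-b_{13}$, $b_8=w_5-b_{14}$, $b_9=w_2-b_{10}$, $b_{11}=w_3-b_{12}$, $b_{15}=w_6$. Let $a_{ij}=0$ for $j\ge i$, $a_{42}=a_{52}=a_{62}=0$, $$a_{32}=\frac{c_3^2}{2c_2},\quad a_{43}=\frac{c_4^2(c_4-c_3)}{c_3^2},\quad a_{53}=\frac{c_5^2(3c_4-2c_5)}{6c_3(c_4-c_3)},\quad a_{54}=\frac{c_5^2(2c_5-3c_3)}{6c_4(c_4-c_3)},$$ $$a_{63}=\frac{c_6^2(3c_4-2c_6)+6a_{65}c_5(c_5-c_4)}{6c_3(c_4-c_3)},\qquad a_{64}=\frac{c_6^2(2c_6-3c_3)-6a_{65}c_5(c_5-c_3)}{6c_4(c_4-c_3)}.$$ In columns $7$ to $14$: - column 7: $a_{97}=\alpha'_{24}+u'_2a_{87}$, $a_{10,7}=a_{97}+\frac{w_4}{b_{10}}(\alpha_{24}+u_2a_{87})$,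 $a_{11,7}=\alpha'_{34}+u'_3a_{87}$, $a_{12,7}=a_{11,7}+\frac{w_4}{b_{12}}(\alpha_{34}+u_3a_{87})$, $a_{13,7}=\frac{w_4}{b_{13}}(\alpha_{44}+u_4a_{87})$, $a_{14,7}=a_{87}+\frac{w_4}{b_{14}}(\alpha_{54}+u_5a_{87})-a_{14,13}$, $a_{15,7}=\frac{w_4}{w_6}(\alpha_{64}+u_6a_{87})-a_{15,13}$; - column 8: $a_{98}$ and $a_{11,8}$ as listed, $a_{10,8}=a_{98}+\frac{w_5}{b_{10}}\alpha_{25}$, $a_{12,8}=a_{11,8}+\frac{w_5}{b_{12}}\alpha_{35}$, $a_{13,8}=\frac{w_5}{b_{13}}\alpha_{45}$, $a_{14,8}=\frac{w_5}{b_{14}}\alpha_{55}$, $a_{15,8}=\frac{w_5}{w_6}\alpha_{65}-a_{15,14}$; - column 9: $a_{10,9}=\frac{w_2}{b_{10}}\alpha_{22}$, $a_{11,9}=\alpha'_{32}-a_{11,10}$, $a_{12,9}=\alpha'_{32}+\frac{w_2}{b_{12}}\alpha_{32}-a_{12,10}$, $a_{13,9}=\frac{w_2}{b_{13}}\alpha_{42}-a_{13,10}$,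 $a_{14,9}=\frac{w_2}{b_{14}}\alpha_{52}-a_{14,10}$, $a_{15,9}=\frac{w_2}{w_6}\alpha_{62}-a_{15,10}$; - column 10: $a_{11,10}=\frac{b_{10}}{w_3}\mathrm A_{11,10}$, $a_{12,10}=a_{11,10}+\frac{b_{10}}{b_{12}}\mathrm A_{12,10}$, and $a_{i,10}=\frac{b_{10}}{b_i}\mathrm A_{i,10}$ for $i=13,14,15$; - column 11: $a_{12,11}=\frac{w_3}{b_{12}}\alpha_{33}$, $a_{13,11}=\frac{w_3}{b_{13}}\alpha_{43}-a_{13,12}$, $a_{14,11}=\frac{w_3}{b_{14}}\alpha_{53}-a_{14,12}$, $a_{15,11}=\frac{w_3}{w_6}\alpha_{63}-a_{15,12}$; - columns $j=12,13,14$: $a_{ij}=\frac{b_j}{b_i}\mathrm A_{i,j}$ for $j<i\le15$. For $7\le i\le15$ put $a_{i2}=0$ and let $(a_{i3},a_{i4},a_{i5},a_{i6})$ be the solution of the linear system $$\sum_{k=3}^{6}a_{ik}a_{k2}=0,\qquad \sum_{k=3}^{6}a_{ik}c_k^m=\frac{c_i^{m+1}}{m+1}-\sum_{k=7}^{i-1}a_{ik}c_k^m\quad(m=1,2,3).$$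 Finally $a_{i1}=c_i-\sum_{j=2}^{i-1}a_{ij}$ for $2\le i\le 15$. The two remaining coefficients are the solutions of equations that are affine in them: $a_{87}$ (on which $d_4$ depends, while $d_4$ does not depend on $a_{65}$) is the solution of $\sum_j d_{4,j}c_j^4=0$, and then $a_{65}$ is the solution of $\sum_{i,j}d_{4,i}a_{ij}a_{j2}=0$. Call the parameters admissible if no denominator in this construction vanishes, i.e. $c_2,b_{10},b_{12},b_{13},b_{14}$ and the denominator of $c_6$ are non-zero, $c_4,c_5,c_6$ are non-zero and pairwise distinct, and the two affine equations for $a_{87}$ and for $a_{65}$ have non-zero leading coefficients (are uniquely solvable). **Theorem.** The set of admissible parameters is open in $\mathbb R^7$, and different admissible parameters give different methods. For all admissible parameters the method $(A,b,c)$ so constructed is an explicit $15$-stage Runge–Kutta method with $A\mathbf 1=c$, of order $10$; its nodes and weights are as above, and $a_{52}=a_{62}=0$. The choice $$c_2=\tfrac2{15},\quad c_4=\tfrac25,\quad c_5=\tfrac47,\quad b_{10}=\tfrac27w_2,\quad b_{12}=\tfrac29w_3,\quad b_{13}=w_4,\quad b_{14}=w_5$$ is admissible, so that it gives one concrete such method.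 -/

import Mathlib

/-! Rooted trees, elementary weights and order conditions. -/

/-- Plane (ordered) rooted trees: `node [t₁, …, tₙ]` is the tree `[t₁ … tₙ]`, and `node []` is the
one-vertex tree. -/
inductive PlaneTree : Type
  | node : List PlaneTree → PlaneTree

namespace PlaneTree

/-- Elementary moves that do not change the underlying (unordered) rooted tree: permuting the
branches at the root, or making such a move inside one branch. -/
inductive Move : PlaneTree → PlaneTree → Prop
  | perm {l l' : List PlaneTree} : l.Perm l' → Move (node l) (node l')
  | branch {l l' : List PlaneTree} {t t' : PlaneTree} :
      Move t t' → Move (node (l ++ t :: l')) (node (l ++ t' :: l'))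

mutual
/-- The number of vertices of a tree. -/
def order : PlaneTree → ℕ
  | node ts => 1 + orderList ts
/-- The total number of vertices of a list of trees. -/
def orderList : List PlaneTree → ℕ
  | [] => 0
  | t :: ts => order t + orderList ts
end

mutual
/-- The tree factorial `t! = |t| * t₁! * ⋯ * tₙ!` for `t = [t₁ … tₙ]`. -/
def factorial : PlaneTree → ℕ
  | node ts => (1 + orderList ts) * factorialList ts
/-- The product of the factorials of a list of trees. -/
def factorialList : List PlaneTree → ℕ
  | [] => 1
  | t :: ts => factorial t * factorialList ts
end

mutual
/-- The vector `Φ(t) = (A Φ(t₁)) . ⋯ . (A Φ(tₙ))` for `t = [t₁ … tₙ]`, with entrywise products. -/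
noncomputable def weight {s : ℕ} (A : Matrix (Fin s) (Fin s) ℝ) : PlaneTree → Fin s → ℝ
  | node ts => weightList A ts
/-- The entrywise product of the vectors `A Φ(t)` over a list of trees. -/
noncomputable def weightList {s : ℕ} (A : Matrix (Fin s) (Fin s) ℝ) :
    List PlaneTree → Fin s → ℝ
  | [] => 1
  | t :: ts => A.mulVec (weight A t) * weightList A ts
end

theorem orderList_append (l l' : List PlaneTree) :
    orderList (l ++ l') = orderList l + orderList l' := by
  induction l with
  | nil => simp [orderList]
  | cons t ts ih => simp [orderList, ih, add_assoc]

theorem factorialList_append (l l' : List PlaneTree) :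
    factorialList (l ++ l') = factorialList l * factorialList l' := by
  induction l with
  | nil => simp [factorialList]
  | cons t ts ih => simp [factorialList, ih, mul_assoc]

theorem weightList_append {s : ℕ} (A : Matrix (Fin s) (Fin s) ℝ) (l l' : List PlaneTree) :
    weightList A (l ++ l') = weightList A l * weightList A l' := by
  induction l with
  | nil => simp [weightList]
  | cons t ts ih => simp [weightList, ih, mul_assoc]

theorem orderList_perm {l l' : List PlaneTree} (h : l.Perm l') : orderList l = orderList l' := by
  induction h with
  | nil => rfl
  | cons t _ ih => simp [orderList, ih]
  | swap t u l => simp [orderList, add_left_comm]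
  | trans _ _ ih ih2 => exact ih.trans ih2

theorem factorialList_perm {l l' : List PlaneTree} (h : l.Perm l') :
    factorialList l = factorialList l' := by
  induction h with
  | nil => rfl
  | cons t _ ih => simp [factorialList, ih]
  | swap t u l => simp [factorialList, mul_left_comm]
  | trans _ _ ih ih2 => exact ih.trans ih2

theorem weightList_perm {s : ℕ} (A : Matrix (Fin s) (Fin s) ℝ) {l l' : List PlaneTree}
    (h : l.Perm l') : weightList A l = weightList A l' := by
  induction h with
  | nil => rfl
  | cons t _ ih => simp [weightList, ih]
  | swap t u l => simp [weightList, mul_left_comm]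
  | trans _ _ ih ih2 => exact ih.trans ih2

theorem Move.order_eq {t u : PlaneTree} (h : Move t u) : order t = order u := by
  induction h with
  | perm h => simp [order, orderList_perm h]
  | branch _ ih => simp [order, orderList_append, orderList, ih]

theorem Move.factorial_eq {t u : PlaneTree} (h : Move t u) : factorial t = factorial u := by
  induction h with
  | perm h => simp [factorial, orderList_perm h, factorialList_perm h]
  | branch h ih =>
      simp [factorial, orderList_append, orderList, factorialList_append, factorialList, ih,
        h.order_eq]

theorem Move.weight_eq {s : ℕ} (A : Matrix (Fin s) (Fin s) ℝ) {t u : PlaneTree} (h : Move t u) :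
    weight A t = weight A u := by
  induction h with
  | perm h => simp [weight, weightList_perm A h]
  | branch _ ih => simp [weight, weightList_append, weightList, ih]

end PlaneTree

/-- Rooted trees, up to isomorphism: plane trees up to the order of the branches at each vertex. -/
def ButcherTree : Type := Quot PlaneTree.Move

namespace ButcherTree

/-- The number of vertices `|t|`. -/
def order : ButcherTree → ℕ := Quot.lift PlaneTree.order fun _ _ h => h.order_eq

/-- The tree factorial `t!`. -/
def factorial : ButcherTree → ℕ := Quot.lift PlaneTree.factorial fun _ _ h => h.factorial_eq

/-- The vector `Φ(t)` of derivative weights for the coefficient matrix `A`. -/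
noncomputable def weight {s : ℕ} (A : Matrix (Fin s) (Fin s) ℝ) : ButcherTree → Fin s → ℝ :=
  Quot.lift (PlaneTree.weight A) fun _ _ h => h.weight_eq A

end ButcherTree

/-- The coefficients of an `s`-stage Runge–Kutta method. Stages are numbered from `0` here. -/
structure RKMethod (s : ℕ) where
  A : Matrix (Fin s) (Fin s) ℝ
  b : Fin s → ℝ
  c : Fin s → ℝ

namespace RKMethod

variable {s : ℕ}

def IsExplicit (M : RKMethod s) : Prop := ∀ i j : Fin s, i ≤ j → M.A i j = 0

/-- The row-sum condition `A 1 = c`. -/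
def RowSum (M : RKMethod s) : Prop := ∀ i : Fin s, ∑ j, M.A i j = M.c i

/-- Order (at least) `p`: `b Φ(t) = 1 / t!` for every rooted tree `t` with at most `p` vertices. -/
def HasOrder (M : RKMethod s) (p : ℕ) : Prop :=
  ∀ t : ButcherTree, t.order ≤ p → ∑ i, M.b i * t.weight M.A i = 1 / (t.factorial : ℝ)

/-- The row vector `dₙ = (b . cⁿ) A - (b . (1 - cⁿ⁺¹)) / (n + 1)`. -/
noncomputable def d (M : RKMethod s) (n : ℕ) (j : Fin s) : ℝ :=
  ∑ i, M.b i * M.c i ^ n * M.A i j - M.b j * (1 - M.c j ^ (n + 1)) / ((n : ℝ) + 1)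

end RKMethod

/-! The family of methods. -/

namespace RK10

/-! Nodes and weights of the 6-point Lobatto quadrature on `[0, 1]`; the end points are `0` and `1`,
with weights `w1 = w6`. -/

noncomputable def alpha : ℝ := √((7 + 2 * √7) / 21)
noncomputable def beta : ℝ := √((7 - 2 * √7) / 21)
noncomputable def theta2 : ℝ := (1 - alpha) / 2
noncomputable def theta3 : ℝ := (1 - beta) / 2
noncomputable def theta4 : ℝ := (1 + beta) / 2
noncomputable def theta5 : ℝ := (1 + alpha) / 2
noncomputable def w1 : ℝ := 1 / 30
noncomputable def w2 : ℝ := (14 - √7) / 60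
noncomputable def w3 : ℝ := (14 + √7) / 60
noncomputable def w4 : ℝ := (14 + √7) / 60
noncomputable def w5 : ℝ := (14 - √7) / 60
noncomputable def w6 : ℝ := 1 / 30

/-- An element of the field generated by `alpha` and `beta` over the rationals, given by its
integer coordinates `n1, …, n8` in a basis and a common denominator `n9`. -/
noncomputable def lobattoNumber (n1 n2 n3 n4 n5 n6 n7 n8 n9 : ℤ) : ℝ :=
  (n1 + n2 * √3 + n3 * √7 + n4 * √21 + n5 * alpha + n6 * beta + n7 * (√7 * alpha)
    + n8 * (√7 * beta)) / n9

/-! Numerical constants of the construction. A final `P` marks the constants of the first stage of a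
pair with the same node (stages 9 and 11); `a98` and `a11_8` are the coefficients in row 9, column 8
and in row 11, column 8, which are the same for all members of the family. -/

noncomputable def A15_14 : ℝ := lobattoNumber 1 0 0 0 (-1) 0 0 0 2
noncomputable def A15_13 : ℝ := lobattoNumber (-107) 353 (-341) 149 (-821) 1503 (-509) 843 1416
noncomputable def A14_13 : ℝ := lobattoNumber 815 (-353) 341 (-149) 821 (-2211) 509 (-843) 1416
noncomputable def A15_12 : ℝ := lobattoNumber (-1593179) (-703001) 523855 542527 7003159 (-2315751) (-2257457) 672093 1458168
noncomputable def A14_12 : ℝ := lobattoNumber 325025 (-242953) (-352465) (-38617) 389855 (-1114275) (-170833) (-1028451) 1458168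
noncomputable def A13_12 : ℝ := lobattoNumber 332873 157659 (-28565) (-83985) (-1232169) 693185 404715 59393 243028
noncomputable def al63 : ℝ := lobattoNumber 6 (-2) 0 1 12 3 (-6) 0 72
noncomputable def al53 : ℝ := lobattoNumber 30 (-5) (-6) 1 30 21 (-6) (-15) 144
noncomputable def al43 : ℝ := lobattoNumber 9 5 3 (-3) (-39) 41 15 15 96
noncomputable def al33 : ℝ := lobattoNumber 11 1 1 1 3 (-11) (-3) (-5) 96
noncomputable def A15_10 : ℝ := lobattoNumber (-30363) 37407 (-20595) 13773 (-88581) 226363 (-12507) 81737 55152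
noncomputable def A14_10 : ℝ := lobattoNumber 3384 (-11215) 3141 (-2166) 11751 (-51027) 1596 (-18702) 18384
noncomputable def A13_10 : ℝ := lobattoNumber (-2167) 7228 (-1607) 2060 (-6999) 35267 (-1659) 12133 27576
noncomputable def A12_10 : ℝ := lobattoNumber 117149 (-60598) 38062 (-28367) 199746 (-411836) 35073 (-148213) 55152
noncomputable def A11_10 : ℝ := lobattoNumber (-16257) 10595 (-5919) 4243 (-26211) 67005 (-6009) 24579 13788
noncomputable def al62 : ℝ := lobattoNumber 467 244 (-182) (-88) 1457 (-580) (-560) 244 72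
noncomputable def al52 : ℝ := lobattoNumber 551 318 (-197) (-126) 2031 (-734) (-753) 242 48
noncomputable def al42 : ℝ := lobattoNumber 1749 785 (-525) (-347) 4857 (-2475) (-1653) 639 864
noncomputable def al32 : ℝ := lobattoNumber (-17439) (-8189) 6135 3359 (-52563) 24135 19263 (-7539) 864
noncomputable def al32P : ℝ := lobattoNumber 637 289 (-221) (-119) 1865 (-879) (-679) 273 72
noncomputable def al22 : ℝ := lobattoNumber (-135) (-97) 51 37 (-597) 179 225 (-65) 24
noncomputable def al65 : ℝ := lobattoNumber (-1865) 400 194 (-442) 5671 3900 (-1474) 294 72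
noncomputable def al55 : ℝ := lobattoNumber 865 (-520) (-421) 142 (-2535) (-846) 1083 648 48
noncomputable def al45 : ℝ := lobattoNumber 4251 7555 4641 827 5007 (-24357) (-10047) (-13155) 864
noncomputable def al35 : ℝ := lobattoNumber 24411 (-39763) (-23727) 6685 (-149289) 10101 75345 46851 864
noncomputable def a11_8 : ℝ := lobattoNumber (-1397) 1219 715 (-359) 6259 1329 (-2609) (-1119) 72
noncomputable def al25 : ℝ := lobattoNumber (-1002) 373 249 (-196) 2934 1530 (-939) (-243) 24
noncomputable def a98 : ℝ := lobattoNumber 55 28 20 11 (-75) (-175) (-25) (-65) 2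
noncomputable def al64 : ℝ := lobattoNumber (-12120) 5558 4524 (-2131) 34092 16017 (-12816) (-5850) 72
noncomputable def al54 : ℝ := lobattoNumber 18054 (-15493) (-6840) 5831 (-93786) (-23529) 35508 8961 144
noncomputable def al44 : ℝ := lobattoNumber (-4381) 2147 1741 (-769) 12555 5507 (-4839) (-2359) 96
noncomputable def al34 : ℝ := lobattoNumber 48165 (-22829) (-18405) 8535 (-137595) (-62381) 52215 24273 96
noncomputable def al34P : ℝ := lobattoNumber (-607) 293 232 (-110) 1771 786 (-671) (-306) 4
noncomputable def al24 : ℝ := lobattoNumber (-19287) 12478 7254 (-4733) 75975 25299 (-28668) (-9450) 72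
noncomputable def al24P : ℝ := lobattoNumber 126 13 9 26 (-270) (-318) 27 (-69) 18
noncomputable def u6 : ℝ := lobattoNumber 17771 (-8607) (-4789) 4335 (-64330) (-28602) 21794 4230 54
noncomputable def u5 : ℝ := lobattoNumber (-12118) 5967 4931 (-2052) 33964 14784 (-13307) (-6807) 36
noncomputable def u4 : ℝ := lobattoNumber 1153 (-2902) (-1712) 323 (-9149) 2499 5122 3750 36
noncomputable def u3 : ℝ := lobattoNumber (-26894) 22579 13153 (-6818) 118174 26544 (-48563) (-20445) 36
noncomputable def u3P : ℝ := lobattoNumber 2881 (-2231) (-1307) 727 (-12243) (-3213) 4911 1917 12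
noncomputable def u2 : ℝ := lobattoNumber 67950 (-32635) (-22419) 13484 (-212940) (-92400) 76203 27903 108
noncomputable def u2P : ℝ := lobattoNumber (-420) (-198) (-150) (-80) 574 1260 187 465 2
noncomputable def U0 : ℝ := lobattoNumber 153566 36694 943 14484 178724 81235 53158 (-28714) 1
noncomputable def U1 : ℝ := lobattoNumber (-134733) (-9751) (-2187) (-2447) (-78969) (-35907) (-17925) 14493 1
noncomputable def U2 : ℝ := lobattoNumber 1267700 0 0 0 0 0 0 0 1
noncomputable def V0 : ℝ := lobattoNumber 1854455 (-323009) 188367 (-152875) (-723177) 1849113 (-397521) 765441 1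
noncomputable def V1 : ℝ := lobattoNumber (-173229) 32676 (-14883) 11874 142380 (-149989) 45426 (-89567) 1
noncomputable def V2 : ℝ := lobattoNumber 131201 (-21770) 7390 (-4531) (-154203) 82173 (-32718) 73122 1

/-- The seven free parameters. -/
structure Params where
  c2 : ℝ
  c4 : ℝ
  c5 : ℝ
  b10 : ℝ
  b12 : ℝ
  b13 : ℝ
  b14 : ℝ

namespace Params

/-- The parameters as a point of seven-dimensional space. -/
def ofVec (x : Fin 7 → ℝ) : Params := ⟨x 0, x 1, x 2, x 3, x 4, x 5, x 6⟩

variable (p : Params)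

noncomputable def c3 : ℝ := 2 / 3 * p.c4

/-- The denominator of the node `c6`. -/
noncomputable def c6den : ℝ :=
  3 * U0 + 14 * U1 * (p.c4 + p.c5) + 2 * U2 * (p.c4 ^ 2 + p.c5 ^ 2)
    + 7 * p.c4 * p.c5 * (V0 + 20 * V1 * (p.c4 + p.c5) + 60 * V2 * p.c4 * p.c5)

noncomputable def c6 : ℝ :=
  (U0 * (p.c4 + p.c5) + 14 * U1 * p.c4 * p.c5 + U2 * p.c4 * p.c5 * (p.c4 + p.c5)) / p.c6den

/-- The nodes `c1, …, c15`. -/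
noncomputable def nodes : Fin 15 → ℝ :=
  ![0, p.c2, p.c3, p.c4, p.c5, p.c6, theta4, theta5, theta2, theta2, theta3, theta3, theta4,
    theta5, 1]

/-- The weights `b1, …, b15`. -/
noncomputable def weights : Fin 15 → ℝ :=
  ![w1, 0, 0, 0, 0, 0, w4 - p.b13, w5 - p.b14, w2 - p.b10, p.b10, w3 - p.b12, p.b12, p.b13, p.b14,
    w6]

/-! Coefficients of the stages 3 to 6, in columns 2 to 5. The coefficients in column 2 of the
stages 4, 5 and 6 are zero. The argument `y` stands for the coefficient in row 6, column 5. -/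

noncomputable def a32 : ℝ := p.c3 ^ 2 / (2 * p.c2)
noncomputable def a43 : ℝ := p.c4 ^ 2 * (p.c4 - p.c3) / p.c3 ^ 2
noncomputable def a53 : ℝ := p.c5 ^ 2 * (3 * p.c4 - 2 * p.c5) / (6 * p.c3 * (p.c4 - p.c3))
noncomputable def a54 : ℝ := p.c5 ^ 2 * (2 * p.c5 - 3 * p.c3) / (6 * p.c4 * (p.c4 - p.c3))
noncomputable def a63 (y : ℝ) : ℝ :=
  (p.c6 ^ 2 * (3 * p.c4 - 2 * p.c6) + 6 * y * p.c5 * (p.c5 - p.c4)) / (6 * p.c3 * (p.c4 - p.c3))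
noncomputable def a64 (y : ℝ) : ℝ :=
  (p.c6 ^ 2 * (2 * p.c6 - 3 * p.c3) - 6 * y * p.c5 * (p.c5 - p.c3)) / (6 * p.c4 * (p.c4 - p.c3))

/-- The coefficients in rows 7 to 15 and columns 7 to 14. The argument `x` stands for the
coefficient in row 8, column 7. -/
noncomputable def corner (x : ℝ) : Matrix (Fin 9) (Fin 8) ℝ :=
  !![0, 0, 0, 0, 0, 0, 0, 0;
    x, 0, 0, 0, 0, 0, 0, 0;
    al24P + u2P * x, a98, 0, 0, 0, 0, 0, 0;
    al24P + u2P * x + w4 / p.b10 * (al24 + u2 * x), a98 + w5 / p.b10 * al25,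
      w2 / p.b10 * al22, 0, 0, 0, 0, 0;
    al34P + u3P * x, a11_8, al32P - p.b10 / w3 * A11_10, p.b10 / w3 * A11_10, 0, 0, 0, 0;
    al34P + u3P * x + w4 / p.b12 * (al34 + u3 * x), a11_8 + w5 / p.b12 * al35,
      al32P + w2 / p.b12 * al32 - (p.b10 / w3 * A11_10 + p.b10 / p.b12 * A12_10),
      p.b10 / w3 * A11_10 + p.b10 / p.b12 * A12_10, w3 / p.b12 * al33, 0, 0, 0;
    w4 / p.b13 * (al44 + u4 * x), w5 / p.b13 * al45,
      w2 / p.b13 * al42 - p.b10 / p.b13 * A13_10, p.b10 / p.b13 * A13_10,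
      w3 / p.b13 * al43 - p.b12 / p.b13 * A13_12, p.b12 / p.b13 * A13_12, 0, 0;
    x + w4 / p.b14 * (al54 + u5 * x) - p.b13 / p.b14 * A14_13, w5 / p.b14 * al55,
      w2 / p.b14 * al52 - p.b10 / p.b14 * A14_10, p.b10 / p.b14 * A14_10,
      w3 / p.b14 * al53 - p.b12 / p.b14 * A14_12, p.b12 / p.b14 * A14_12,
      p.b13 / p.b14 * A14_13, 0;
    w4 / w6 * (al64 + u6 * x) - p.b13 / w6 * A15_13, w5 / w6 * al65 - p.b14 / w6 * A15_14,
      w2 / w6 * al62 - p.b10 / w6 * A15_10, p.b10 / w6 * A15_10,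
      w3 / w6 * al63 - p.b12 / w6 * A15_12, p.b12 / w6 * A15_12, p.b13 / w6 * A15_13,
      p.b14 / w6 * A15_14]

/-- The nodes `c7, …, c15` of the rows of `corner`. -/
noncomputable def rowNode : Fin 9 → ℝ :=
  ![theta4, theta5, theta2, theta2, theta3, theta3, theta4, theta5, 1]

/-- The nodes `c7, …, c14` of the columns of `corner`. -/
noncomputable def colNode : Fin 8 → ℝ :=
  ![theta4, theta5, theta2, theta2, theta3, theta3, theta4, theta5]

/-- The right-hand side `cᵢᵐ⁺¹ / (m + 1) - ∑_{j ≥ 7} aᵢⱼ cⱼᵐ` in row `i`. -/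
noncomputable def moment (x : ℝ) (m : ℕ) (i : Fin 9) : ℝ :=
  rowNode i ^ (m + 1) / ((m : ℝ) + 1) - ∑ j, p.corner x i j * colNode j ^ m

/-- The coefficients in rows 7 to 15 and columns 3 to 6, which solve
`∑_{3 ≤ j ≤ 6} aᵢⱼ aⱼ₂ = 0` and `∑_j aᵢⱼ cⱼᵐ = cᵢᵐ⁺¹ / (m + 1)` for `m = 1, 2, 3`. -/
noncomputable def middle (x : ℝ) (i : Fin 9) : Fin 4 → ℝ :=
  (!![p.a32, 0, 0, 0;
    p.c3, p.c4, p.c5, p.c6;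
    p.c3 ^ 2, p.c4 ^ 2, p.c5 ^ 2, p.c6 ^ 2;
    p.c3 ^ 3, p.c4 ^ 3, p.c5 ^ 3, p.c6 ^ 3] : Matrix (Fin 4) (Fin 4) ℝ)⁻¹.mulVec
    ![0, p.moment x 1 i, p.moment x 2 i, p.moment x 3 i]

/-- The coefficient matrix without its first column. -/
noncomputable def core (y x : ℝ) : Matrix (Fin 15) (Fin 15) ℝ :=
  let B := p.middle x
  let C := p.corner x
  !![0, 0, 0, 0, 0, 0, 0, 0, 0, 0, 0, 0, 0, 0, 0;
    0, 0, 0, 0, 0, 0, 0, 0, 0, 0, 0, 0, 0, 0, 0;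
    0, p.a32, 0, 0, 0, 0, 0, 0, 0, 0, 0, 0, 0, 0, 0;
    0, 0, p.a43, 0, 0, 0, 0, 0, 0, 0, 0, 0, 0, 0, 0;
    0, 0, p.a53, p.a54, 0, 0, 0, 0, 0, 0, 0, 0, 0, 0, 0;
    0, 0, p.a63 y, p.a64 y, y, 0, 0, 0, 0, 0, 0, 0, 0, 0, 0;
    0, 0, B 0 0, B 0 1, B 0 2, B 0 3, 0, 0, 0, 0, 0, 0, 0, 0, 0;
    0, 0, B 1 0, B 1 1, B 1 2, B 1 3, C 1 0, 0, 0, 0, 0, 0, 0, 0, 0;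
    0, 0, B 2 0, B 2 1, B 2 2, B 2 3, C 2 0, C 2 1, 0, 0, 0, 0, 0, 0, 0;
    0, 0, B 3 0, B 3 1, B 3 2, B 3 3, C 3 0, C 3 1, C 3 2, 0, 0, 0, 0, 0, 0;
    0, 0, B 4 0, B 4 1, B 4 2, B 4 3, C 4 0, C 4 1, C 4 2, C 4 3, 0, 0, 0, 0, 0;
    0, 0, B 5 0, B 5 1, B 5 2, B 5 3, C 5 0, C 5 1, C 5 2, C 5 3, C 5 4, 0, 0, 0, 0;
    0, 0, B 6 0, B 6 1, B 6 2, B 6 3, C 6 0, C 6 1, C 6 2, C 6 3, C 6 4, C 6 5, 0, 0, 0;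
    0, 0, B 7 0, B 7 1, B 7 2, B 7 3, C 7 0, C 7 1, C 7 2, C 7 3, C 7 4, C 7 5, C 7 6, 0, 0;
    0, 0, B 8 0, B 8 1, B 8 2, B 8 3, C 8 0, C 8 1, C 8 2, C 8 3, C 8 4, C 8 5, C 8 6, C 8 7, 0]

/-- The coefficient matrix; the first column makes every row `i` sum to the node `cᵢ`. -/
noncomputable def matrix (y x : ℝ) : Matrix (Fin 15) (Fin 15) ℝ := fun i j =>
  if j = 0 then p.nodes i - ∑ k, p.core y x i k else p.core y x i j

/-- The method with the two coefficients `y` (row 6, column 5) and `x` (row 8, column 7) still to be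
determined. -/
noncomputable def preMethod (y x : ℝ) : RKMethod 15 := ⟨p.matrix y x, p.weights, p.nodes⟩

/-- The quantity `d₄ c⁴`, an affine function of `x`. As the sixth weight is zero, `d₄` does not
depend on `y`, which is set to zero here. -/
noncomputable def eqX (x : ℝ) : ℝ :=
  ∑ j, (p.preMethod 0 x).d 4 j * p.nodes j ^ 4

/-- The coefficient in row 8, column 7: the root of the affine function `eqX`. -/
noncomputable def a87 : ℝ := p.eqX 0 / (p.eqX 0 - p.eqX 1)

/-- The quantity `d₄ A a`, an affine function of `y`, where `a` is the second column of `A`. -/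
noncomputable def eqY (y : ℝ) : ℝ :=
  ∑ i, ∑ j, (p.preMethod y p.a87).d 4 i * p.matrix y p.a87 i j * p.matrix y p.a87 j 1

/-- The coefficient in row 6, column 5: the root of the affine function `eqY`. -/
noncomputable def a65 : ℝ := p.eqY 0 / (p.eqY 0 - p.eqY 1)

/-- The member of the family with parameters `p`. -/
noncomputable def method : RKMethod 15 := p.preMethod p.a65 p.a87

/-- No denominator in the construction vanishes: the nodes `c4`, `c5`, `c6` are non-zero and
distinct, and the affine equations for the last two coefficients are uniquely solvable. -/
def Admissible : Prop :=
  p.c2 ≠ 0 ∧ p.b10 ≠ 0 ∧ p.b12 ≠ 0 ∧ p.b13 ≠ 0 ∧ p.b14 ≠ 0 ∧ p.c6den ≠ 0 ∧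
    p.c4 ≠ 0 ∧ p.c5 ≠ 0 ∧ p.c6 ≠ 0 ∧ p.c4 ≠ p.c5 ∧ p.c4 ≠ p.c6 ∧ p.c5 ≠ p.c6 ∧
    p.eqX 0 ≠ p.eqX 1 ∧ p.eqY 0 ≠ p.eqY 1

end Params

/-- A particular choice of the parameters. -/
noncomputable def particular : Params where
  c2 := 2 / 15
  c4 := 2 / 5
  c5 := 4 / 7
  b10 := 2 / 7 * w2
  b12 := 2 / 9 * w3
  b13 := w4
  b14 := w5

end RK10

-- The proof replaces the usual column simplifying assumptions by weaker ones. Put `dₙ = (b cⁿ)A -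
-- b(1 - cⁿ⁺¹)/(n + 1)`. In a tree with at most ten vertices at most one branch at the root has more
-- than four vertices. All stages with non-zero weight are exact on trees with up to four vertices,
-- so the small branches become powers of `c`, and a large branch `u` leaves `b c^k A Φ(u)`. This
-- equals `d_k Φ(u)` plus terms of the same kind for the smaller tree `u`. By induction, order ten
-- follows from the quadrature formula once `d_k Φ(u) = 0` whenever `k + |u| ≤ 9` and `k ≤ 4`
-- (`TenCriterion.sum_b_weight`).
--
-- These equations hold because of the repeated nodes. A row vector supported on the pairs of stages
-- with a common node, with zero sum over each pair, annihilates every power of `c`. The vector `d₀`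
-- vanishes, and `d₁`, `d₂`, `d₃` are of this kind. They lie in the span of `d₁`, `d₁A`, `d₁A²`, and
-- the spans of the first one, two and three of these vectors form a flag: multiplication by `A` or
-- entrywise by `c` leads from each member into the next larger one. One more multiplication leads
-- into the multiples of `d₄` plus vectors of zero pair sums. A large branch costs one
-- multiplication by `A`, its siblings cost multiplications by `c`, and each costs one step of the
-- flag, so everything reduces to trees with at most five vertices
-- (`TenCriterion.sum_weight_eq_zero`).
--
-- At the bottom three equations for `d₄` remain: its fourth moment, the entry of `d₄A` at the third
-- stage, and the third moment of `d₄A`. The first determines `a₈₇` and the second `a₆₅`. Given the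
-- second, the third is another affine equation in `a₈₇`; its compatibility with the first is a
-- determinant condition linear in `c₆`, and the formula for `c₆` is its solution
-- (`Regular.lateMoment_a87`).
--
-- After division by the weights, the pair-vector calculation is independent of the free parameters;
-- `a₈₇` enters only linearly, through a separate coordinate. The identities therefore concern fixed
-- elements of the field of degree eight generated by `α` and `β`, and are checked by integer
-- arithmetic on coordinates. The count of trees is independent of all this: a rooted tree is a root
-- with a forest of smaller trees.

-- Exact arithmetic in the field generated by the Lobatto nodes.

/-- Elements of the field generated by `√((7 + 2√7)/21)` and `√((7 - 2√7)/21)` over the rationals: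
integer coordinates in the basis `1, √3, √7, √21, α, β, √7 α, √7 β`, and a common denominator. -/
structure LobattoField where
  n1 : ℤ
  n2 : ℤ
  n3 : ℤ
  n4 : ℤ
  n5 : ℤ
  n6 : ℤ
  n7 : ℤ
  n8 : ℤ
  den : ℤ
  den_ne : den ≠ 0 := by decide

namespace LobattoField

open RK10 (lobattoNumber alpha beta)

/-- The real number with the given coordinates. -/
@[coe] noncomputable def toReal (x : LobattoField) : ℝ :=
  lobattoNumber x.n1 x.n2 x.n3 x.n4 x.n5 x.n6 x.n7 x.n8 x.den

noncomputable instance : Coe LobattoField ℝ := ⟨toReal⟩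

instance : Add LobattoField := ⟨fun x y =>
  ⟨x.n1 * y.den + y.n1 * x.den, x.n2 * y.den + y.n2 * x.den, x.n3 * y.den + y.n3 * x.den,
    x.n4 * y.den + y.n4 * x.den, x.n5 * y.den + y.n5 * x.den, x.n6 * y.den + y.n6 * x.den,
    x.n7 * y.den + y.n7 * x.den, x.n8 * y.den + y.n8 * x.den, x.den * y.den,
    mul_ne_zero x.den_ne y.den_ne⟩⟩

instance : Neg LobattoField := ⟨fun x =>
  ⟨-x.n1, -x.n2, -x.n3, -x.n4, -x.n5, -x.n6, -x.n7, -x.n8, x.den, x.den_ne⟩⟩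

instance : Sub LobattoField := ⟨fun x y => x + -y⟩

instance : IntCast LobattoField := ⟨fun n => ⟨n, 0, 0, 0, 0, 0, 0, 0, 1, one_ne_zero⟩⟩

/-- Multiplication. -/
def mul (x y : LobattoField) : LobattoField :=
  ⟨21 * (x.n1 * y.n1 + 3 * (x.n2 * y.n2) + 7 * (x.n3 * y.n3) + 21 * (x.n4 * y.n4))
      + 7 * (x.n5 * y.n5 + x.n6 * y.n6) + 14 * (x.n5 * y.n7 + x.n7 * y.n5)
      - 14 * (x.n6 * y.n8 + x.n8 * y.n6) + 49 * (x.n7 * y.n7 + x.n8 * y.n8),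
    21 * (x.n1 * y.n2 + x.n2 * y.n1 + 7 * (x.n3 * y.n4 + x.n4 * y.n3))
      + 7 * (x.n5 * y.n8 + x.n8 * y.n5 + x.n6 * y.n7 + x.n7 * y.n6),
    21 * (x.n1 * y.n3 + x.n3 * y.n1 + 3 * (x.n2 * y.n4 + x.n4 * y.n2))
      + 2 * (x.n5 * y.n5) - 2 * (x.n6 * y.n6)
      + 7 * (x.n5 * y.n7 + x.n7 * y.n5 + x.n6 * y.n8 + x.n8 * y.n6)
      + 14 * (x.n7 * y.n7) - 14 * (x.n8 * y.n8),
    21 * (x.n1 * y.n4 + x.n4 * y.n1 + x.n2 * y.n3 + x.n3 * y.n2)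
      + (x.n5 * y.n6 + x.n6 * y.n5) + 7 * (x.n7 * y.n8 + x.n8 * y.n7),
    21 * (x.n1 * y.n5 + x.n5 * y.n1 - 2 * (x.n2 * y.n6 + x.n6 * y.n2)
      + 7 * (x.n2 * y.n8 + x.n8 * y.n2 + x.n3 * y.n7 + x.n7 * y.n3 + x.n4 * y.n6 + x.n6 * y.n4)
      - 14 * (x.n4 * y.n8 + x.n8 * y.n4)),
    21 * (x.n1 * y.n6 + x.n6 * y.n1 + 2 * (x.n2 * y.n5 + x.n5 * y.n2)
      + 7 * (x.n2 * y.n7 + x.n7 * y.n2 + x.n3 * y.n8 + x.n8 * y.n3 + x.n4 * y.n5 + x.n5 * y.n4)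
      + 14 * (x.n4 * y.n7 + x.n7 * y.n4)),
    21 * (x.n1 * y.n7 + x.n7 * y.n1 + x.n2 * y.n6 + x.n6 * y.n2 + x.n3 * y.n5 + x.n5 * y.n3
      - 2 * (x.n2 * y.n8 + x.n8 * y.n2 + x.n4 * y.n6 + x.n6 * y.n4)
      + 7 * (x.n4 * y.n8 + x.n8 * y.n4)),
    21 * (x.n1 * y.n8 + x.n8 * y.n1 + x.n2 * y.n5 + x.n5 * y.n2 + x.n3 * y.n6 + x.n6 * y.n3
      + 2 * (x.n2 * y.n7 + x.n7 * y.n2 + x.n4 * y.n5 + x.n5 * y.n4)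
      + 7 * (x.n4 * y.n7 + x.n7 * y.n4)),
    21 * (x.den * y.den), mul_ne_zero (by decide) (mul_ne_zero x.den_ne y.den_ne)⟩

instance : Mul LobattoField := ⟨mul⟩

/-- Natural powers. -/
def npow (x : LobattoField) : ℕ → LobattoField
  | 0 => ((1 : ℤ) : LobattoField)
  | n + 1 => npow x n * x

instance : Pow LobattoField ℕ := ⟨npow⟩

/-- Equality of the numbers represented, which need not be in lowest terms. -/
def SameValue (x y : LobattoField) : Prop :=
  x.n1 * y.den = y.n1 * x.den ∧ x.n2 * y.den = y.n2 * x.den ∧ x.n3 * y.den = y.n3 * x.den ∧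
    x.n4 * y.den = y.n4 * x.den ∧ x.n5 * y.den = y.n5 * x.den ∧ x.n6 * y.den = y.n6 * x.den ∧
    x.n7 * y.den = y.n7 * x.den ∧ x.n8 * y.den = y.n8 * x.den

instance (x y : LobattoField) : Decidable (SameValue x y) := by
  unfold SameValue; infer_instance

theorem den_cast_ne (x : LobattoField) : (x.den : ℝ) ≠ 0 := Int.cast_ne_zero.mpr x.den_ne

/-- Only this direction is needed: equal coordinates give equal real numbers. Linear independence of
the basis over the rationals is never used. -/
theorem SameValue.coe_eq {x y : LobattoField} (h : SameValue x y) : (x : ℝ) = y := by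
  obtain ⟨h1, h2, h3, h4, h5, h6, h7, h8⟩ := h
  have hx := x.den_cast_ne
  have hy := y.den_cast_ne
  simp only [toReal, lobattoNumber]
  rw [div_eq_div_iff hx hy]
  have c : ∀ {u v : ℤ}, u * y.den = v * x.den → (u : ℝ) * y.den = v * x.den :=
    fun h => by exact_mod_cast h
  linear_combination c h1 + √3 * c h2 + √7 * c h3 + √21 * c h4 + alpha * c h5 + beta * c h6
    + √7 * alpha * c h7 + √7 * beta * c h8

theorem sqrt_seven_lt : √7 < 7 / 2 := by
  rw [Real.sqrt_lt' (by norm_num)]; norm_num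

theorem alpha_sq : alpha ^ 2 = (7 + 2 * √7) / 21 := Real.sq_sqrt (by positivity)

theorem beta_sq : beta ^ 2 = (7 - 2 * √7) / 21 :=
  Real.sq_sqrt (by have := sqrt_seven_lt; linarith)

theorem alpha_pos : 0 < alpha := Real.sqrt_pos.mpr (by positivity)

theorem beta_pos : 0 < beta :=
  Real.sqrt_pos.mpr (by have := sqrt_seven_lt; linarith)

theorem sqrt_seven_sq : √7 ^ 2 = 7 := Real.sq_sqrt (by norm_num)

theorem sqrt_three_sq : √3 ^ 2 = 3 := Real.sq_sqrt (by norm_num)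

theorem sqrt_twentyOne : √21 = √3 * √7 := by
  rw [← Real.sqrt_mul (by norm_num)]; norm_num

/-- The squares agree because `(7 + 2√7)(7 - 2√7) = 21`, and positivity fixes the sign. This product
is what brings `√3` into the field, and the products of `√3` with `α` and `β` follow from it. -/
theorem alpha_mul_beta : alpha * beta = √3 * √7 / 21 := by
  have h : (alpha * beta) ^ 2 = (√3 * √7 / 21) ^ 2 := by
    rw [mul_pow, alpha_sq, beta_sq, div_pow, mul_pow, sqrt_three_sq]
    linear_combination (-4 / 441 - 3 / 441 : ℝ) * sqrt_seven_sq
  exact (pow_left_inj₀ (mul_pos alpha_pos beta_pos).le (by positivity) two_ne_zero).mp h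

theorem sqrt_three_mul_alpha : √3 * alpha = √7 * beta + 2 * beta := by
  refine mul_right_cancel₀ beta_pos.ne' ?_
  linear_combination √3 * alpha_mul_beta + √7 / 21 * sqrt_three_sq - (√7 + 2) * beta_sq
    + 2 / 21 * sqrt_seven_sq

theorem sqrt_three_mul_beta : √3 * beta = √7 * alpha - 2 * alpha := by
  refine mul_right_cancel₀ alpha_pos.ne' ?_
  linear_combination √3 * alpha_mul_beta + √7 / 21 * sqrt_three_sq - (√7 - 2) * alpha_sq
    - 2 / 21 * sqrt_seven_sq

@[norm_cast] theorem coe_add (x y : LobattoField) : ((x + y : LobattoField) : ℝ) = x + y := by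
  change lobattoNumber (_ + _) (_ + _) (_ + _) (_ + _) (_ + _) (_ + _) (_ + _) (_ + _) (_ * _) = _
  have hx := x.den_cast_ne
  have hy := y.den_cast_ne
  simp only [toReal, lobattoNumber]
  push_cast
  field_simp
  ring

@[norm_cast] theorem coe_neg (x : LobattoField) : ((-x : LobattoField) : ℝ) = -x := by
  change lobattoNumber (-_) (-_) (-_) (-_) (-_) (-_) (-_) (-_) x.den = _
  simp only [toReal, lobattoNumber]
  push_cast
  ring

@[norm_cast] theorem coe_sub (x y : LobattoField) : ((x - y : LobattoField) : ℝ) = x - y := by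
  change ((x + -y : LobattoField) : ℝ) = _
  rw [coe_add, coe_neg, sub_eq_add_neg]

@[norm_cast] theorem coe_intCast (n : ℤ) : ((n : LobattoField) : ℝ) = n := by
  change lobattoNumber n 0 0 0 0 0 0 0 1 = n
  simp [lobattoNumber]

-- The factor 21 in the product clears the denominators of `α²`, `β²` and `αβ`. In the final
-- combination each term reduces one product of two basis elements by the relations above it.
@[norm_cast] theorem coe_mul (x y : LobattoField) : ((x * y : LobattoField) : ℝ) = x * y := by
  have hx := x.den_cast_ne
  have hy := y.den_cast_ne
  change toReal (mul x y) = _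
  simp only [toReal, lobattoNumber, mul, sqrt_twentyOne]
  rw [div_mul_div_comm, ← mul_div_mul_left _ (x.den * y.den : ℝ) (by norm_num : (21 : ℝ) ≠ 0)]
  push_cast
  congr 1
  have r2 := sqrt_seven_sq
  have s2 := sqrt_three_sq
  have a2 := alpha_sq
  have b2 := beta_sq
  have ab := alpha_mul_beta
  have sa := sqrt_three_mul_alpha
  have sb := sqrt_three_mul_beta
  generalize √7 = r at *
  generalize √3 = s at *
  generalize alpha = a at *
  generalize beta = b at *
  linear_combination -21 * ((x.n2 * y.n2) * s2
      + (x.n2 * y.n4 + x.n4 * y.n2) * r * s2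
      + (x.n3 * y.n3) * r2
      + (x.n3 * y.n4 + x.n4 * y.n3) * s * r2
      + (x.n4 * y.n4) * (r ^ 2 * s2 + 3 * r2)
      + (x.n2 * y.n5 + x.n5 * y.n2) * sa
      + (x.n2 * y.n6 + x.n6 * y.n2) * sb
      + (x.n2 * y.n7 + x.n7 * y.n2 + x.n4 * y.n5 + x.n5 * y.n4) * (r * sa + b * r2)
      + (x.n2 * y.n8 + x.n8 * y.n2 + x.n4 * y.n6 + x.n6 * y.n4) * (r * sb + a * r2)
      + (x.n3 * y.n7 + x.n7 * y.n3) * a * r2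
      + (x.n3 * y.n8 + x.n8 * y.n3) * b * r2
      + (x.n4 * y.n7 + x.n7 * y.n4) * (s * a * r2 + 7 * sa)
      + (x.n4 * y.n8 + x.n8 * y.n4) * (s * b * r2 + 7 * sb)
      + (x.n5 * y.n5) * a2
      + (x.n5 * y.n6 + x.n6 * y.n5) * ab
      + (x.n5 * y.n7 + x.n7 * y.n5) * (r * a2 + 2 / 21 * r2)
      + (x.n5 * y.n8 + x.n8 * y.n5 + x.n6 * y.n7 + x.n7 * y.n6) * (r * ab + s / 21 * r2)
      + (x.n6 * y.n6) * b2
      + (x.n6 * y.n8 + x.n8 * y.n6) * (r * b2 - 2 / 21 * r2)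
      + (x.n7 * y.n7) * (r ^ 2 * a2 + (7 + 2 * r) / 21 * r2)
      + (x.n7 * y.n8 + x.n8 * y.n7) * (r ^ 2 * ab + s * r / 21 * r2)
      + (x.n8 * y.n8) * (r ^ 2 * b2 + (7 - 2 * r) / 21 * r2))

theorem npow_succ (x : LobattoField) (n : ℕ) : x ^ (n + 1) = x ^ n * x := rfl

@[norm_cast] theorem coe_pow (x : LobattoField) (n : ℕ) : ((x ^ n : LobattoField) : ℝ) = x ^ n := by
  induction n with
  | zero => exact (coe_intCast 1).trans (by simp)
  | succ n ih => rw [npow_succ, coe_mul, ih, pow_succ]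

def theta2 : LobattoField := ⟨1, 0, 0, 0, -1, 0, 0, 0, 2, by decide⟩
def theta3 : LobattoField := ⟨1, 0, 0, 0, 0, -1, 0, 0, 2, by decide⟩
def theta4 : LobattoField := ⟨1, 0, 0, 0, 0, 1, 0, 0, 2, by decide⟩
def theta5 : LobattoField := ⟨1, 0, 0, 0, 1, 0, 0, 0, 2, by decide⟩
def w1 : LobattoField := ⟨1, 0, 0, 0, 0, 0, 0, 0, 30, by decide⟩
def w2 : LobattoField := ⟨14, 0, -1, 0, 0, 0, 0, 0, 60, by decide⟩
def w3 : LobattoField := ⟨14, 0, 1, 0, 0, 0, 0, 0, 60, by decide⟩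
def w4 : LobattoField := ⟨14, 0, 1, 0, 0, 0, 0, 0, 60, by decide⟩
def w5 : LobattoField := ⟨14, 0, -1, 0, 0, 0, 0, 0, 60, by decide⟩
def w6 : LobattoField := ⟨1, 0, 0, 0, 0, 0, 0, 0, 30, by decide⟩
def A15_14 : LobattoField := ⟨1, 0, 0, 0, -1, 0, 0, 0, 2, by decide⟩
def A15_13 : LobattoField := ⟨-107, 353, -341, 149, -821, 1503, -509, 843, 1416, by decide⟩
def A14_13 : LobattoField := ⟨815, -353, 341, -149, 821, -2211, 509, -843, 1416, by decide⟩
def A15_12 : LobattoField :=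
  ⟨-1593179, -703001, 523855, 542527, 7003159, -2315751, -2257457, 672093, 1458168, by decide⟩
def A14_12 : LobattoField :=
  ⟨325025, -242953, -352465, -38617, 389855, -1114275, -170833, -1028451, 1458168, by decide⟩
def A13_12 : LobattoField :=
  ⟨332873, 157659, -28565, -83985, -1232169, 693185, 404715, 59393, 243028, by decide⟩
def al63 : LobattoField := ⟨6, -2, 0, 1, 12, 3, -6, 0, 72, by decide⟩
def al53 : LobattoField := ⟨30, -5, -6, 1, 30, 21, -6, -15, 144, by decide⟩
def al43 : LobattoField := ⟨9, 5, 3, -3, -39, 41, 15, 15, 96, by decide⟩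
def al33 : LobattoField := ⟨11, 1, 1, 1, 3, -11, -3, -5, 96, by decide⟩
def A15_10 : LobattoField :=
  ⟨-30363, 37407, -20595, 13773, -88581, 226363, -12507, 81737, 55152, by decide⟩
def A14_10 : LobattoField :=
  ⟨3384, -11215, 3141, -2166, 11751, -51027, 1596, -18702, 18384, by decide⟩
def A13_10 : LobattoField :=
  ⟨-2167, 7228, -1607, 2060, -6999, 35267, -1659, 12133, 27576, by decide⟩
def A12_10 : LobattoField :=
  ⟨117149, -60598, 38062, -28367, 199746, -411836, 35073, -148213, 55152, by decide⟩
def A11_10 : LobattoField :=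
  ⟨-16257, 10595, -5919, 4243, -26211, 67005, -6009, 24579, 13788, by decide⟩
def al62 : LobattoField := ⟨467, 244, -182, -88, 1457, -580, -560, 244, 72, by decide⟩
def al52 : LobattoField := ⟨551, 318, -197, -126, 2031, -734, -753, 242, 48, by decide⟩
def al42 : LobattoField := ⟨1749, 785, -525, -347, 4857, -2475, -1653, 639, 864, by decide⟩
def al32 : LobattoField := ⟨-17439, -8189, 6135, 3359, -52563, 24135, 19263, -7539, 864, by decide⟩
def al32P : LobattoField := ⟨637, 289, -221, -119, 1865, -879, -679, 273, 72, by decide⟩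
def al22 : LobattoField := ⟨-135, -97, 51, 37, -597, 179, 225, -65, 24, by decide⟩
def al65 : LobattoField := ⟨-1865, 400, 194, -442, 5671, 3900, -1474, 294, 72, by decide⟩
def al55 : LobattoField := ⟨865, -520, -421, 142, -2535, -846, 1083, 648, 48, by decide⟩
def al45 : LobattoField := ⟨4251, 7555, 4641, 827, 5007, -24357, -10047, -13155, 864, by decide⟩
def al35 : LobattoField :=
  ⟨24411, -39763, -23727, 6685, -149289, 10101, 75345, 46851, 864, by decide⟩
def a11_8 : LobattoField := ⟨-1397, 1219, 715, -359, 6259, 1329, -2609, -1119, 72, by decide⟩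
def al25 : LobattoField := ⟨-1002, 373, 249, -196, 2934, 1530, -939, -243, 24, by decide⟩
def a98 : LobattoField := ⟨55, 28, 20, 11, -75, -175, -25, -65, 2, by decide⟩
def al64 : LobattoField := ⟨-12120, 5558, 4524, -2131, 34092, 16017, -12816, -5850, 72, by decide⟩
def al54 : LobattoField := ⟨18054, -15493, -6840, 5831, -93786, -23529, 35508, 8961, 144, by decide⟩
def al44 : LobattoField := ⟨-4381, 2147, 1741, -769, 12555, 5507, -4839, -2359, 96, by decide⟩
def al34 : LobattoField :=
  ⟨48165, -22829, -18405, 8535, -137595, -62381, 52215, 24273, 96, by decide⟩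
def al34P : LobattoField := ⟨-607, 293, 232, -110, 1771, 786, -671, -306, 4, by decide⟩
def al24 : LobattoField := ⟨-19287, 12478, 7254, -4733, 75975, 25299, -28668, -9450, 72, by decide⟩
def al24P : LobattoField := ⟨126, 13, 9, 26, -270, -318, 27, -69, 18, by decide⟩
def u6 : LobattoField := ⟨17771, -8607, -4789, 4335, -64330, -28602, 21794, 4230, 54, by decide⟩
def u5 : LobattoField := ⟨-12118, 5967, 4931, -2052, 33964, 14784, -13307, -6807, 36, by decide⟩
def u4 : LobattoField := ⟨1153, -2902, -1712, 323, -9149, 2499, 5122, 3750, 36, by decide⟩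
def u3 : LobattoField := ⟨-26894, 22579, 13153, -6818, 118174, 26544, -48563, -20445, 36, by decide⟩
def u3P : LobattoField := ⟨2881, -2231, -1307, 727, -12243, -3213, 4911, 1917, 12, by decide⟩
def u2 : LobattoField :=
  ⟨67950, -32635, -22419, 13484, -212940, -92400, 76203, 27903, 108, by decide⟩
def u2P : LobattoField := ⟨-420, -198, -150, -80, 574, 1260, 187, 465, 2, by decide⟩
def U0 : LobattoField := ⟨153566, 36694, 943, 14484, 178724, 81235, 53158, -28714, 1, by decide⟩
def U1 : LobattoField := ⟨-134733, -9751, -2187, -2447, -78969, -35907, -17925, 14493, 1, by decide⟩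
def U2 : LobattoField := ⟨1267700, 0, 0, 0, 0, 0, 0, 0, 1, by decide⟩
def V0 : LobattoField :=
  ⟨1854455, -323009, 188367, -152875, -723177, 1849113, -397521, 765441, 1, by decide⟩
def V1 : LobattoField :=
  ⟨-173229, 32676, -14883, 11874, 142380, -149989, 45426, -89567, 1, by decide⟩
def V2 : LobattoField := ⟨131201, -21770, 7390, -4531, -154203, 82173, -32718, 73122, 1, by decide⟩

@[norm_cast] theorem coe_theta2 : (theta2 : ℝ) = RK10.theta2 := by
  simp only [toReal, lobattoNumber, theta2, RK10.theta2]; push_cast; ring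
@[norm_cast] theorem coe_theta3 : (theta3 : ℝ) = RK10.theta3 := by
  simp only [toReal, lobattoNumber, theta3, RK10.theta3]; push_cast; ring
@[norm_cast] theorem coe_theta4 : (theta4 : ℝ) = RK10.theta4 := by
  simp only [toReal, lobattoNumber, theta4, RK10.theta4]; push_cast; ring
@[norm_cast] theorem coe_theta5 : (theta5 : ℝ) = RK10.theta5 := by
  simp only [toReal, lobattoNumber, theta5, RK10.theta5]; push_cast; ring
@[norm_cast] theorem coe_w1 : (w1 : ℝ) = RK10.w1 := by
  simp only [toReal, lobattoNumber, w1, RK10.w1]; push_cast; ring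
@[norm_cast] theorem coe_w2 : (w2 : ℝ) = RK10.w2 := by
  simp only [toReal, lobattoNumber, w2, RK10.w2]; push_cast; ring
@[norm_cast] theorem coe_w3 : (w3 : ℝ) = RK10.w3 := by
  simp only [toReal, lobattoNumber, w3, RK10.w3]; push_cast; ring
@[norm_cast] theorem coe_w4 : (w4 : ℝ) = RK10.w4 := by
  simp only [toReal, lobattoNumber, w4, RK10.w4]; push_cast; ring
@[norm_cast] theorem coe_w5 : (w5 : ℝ) = RK10.w5 := by
  simp only [toReal, lobattoNumber, w5, RK10.w5]; push_cast; ring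
@[norm_cast] theorem coe_w6 : (w6 : ℝ) = RK10.w6 := by
  simp only [toReal, lobattoNumber, w6, RK10.w6]; push_cast; ring
@[norm_cast] theorem coe_U0 : (U0 : ℝ) = RK10.U0 := rfl
@[norm_cast] theorem coe_U1 : (U1 : ℝ) = RK10.U1 := rfl
@[norm_cast] theorem coe_U2 : (U2 : ℝ) = RK10.U2 := rfl
@[norm_cast] theorem coe_V0 : (V0 : ℝ) = RK10.V0 := rfl
@[norm_cast] theorem coe_V1 : (V1 : ℝ) = RK10.V1 := rfl
@[norm_cast] theorem coe_V2 : (V2 : ℝ) = RK10.V2 := rfl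

end LobattoField

-- The numerical identities behind the order conditions.

namespace LobattoField

/-- The number `1 / (n + 1)`. -/
def unitFrac (n : ℕ) : LobattoField := ⟨1, 0, 0, 0, 0, 0, 0, 0, n + 1, by lia⟩

@[norm_cast] theorem coe_unitFrac (n : ℕ) : (unitFrac n : ℝ) = 1 / ((n : ℝ) + 1) := by
  simp only [toReal, RK10.lobattoNumber, unitFrac]
  push_cast
  ring

/-- The number `(1 - tⁿ⁺¹) / (n + 1)`. -/
def tailMoment (t : LobattoField) (n : ℕ) : LobattoField :=
  (((1 : ℤ) : LobattoField) - t ^ (n + 1)) * unitFrac n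

/-- The nodes `θ₂, …, θ₅`. -/
def nodes : Fin 4 → LobattoField := ![theta2, theta3, theta4, theta5]

/-- The row vector `dₙ` of the method, summed over the stages with the same node. The last
coordinate is the coefficient of `a₈₇` in the sum for the node `θ₄`. -/
def nodeSum (n : ℕ) : Fin 5 → LobattoField :=
  ![w3 * theta3 ^ n * al32P + w2 * (theta2 ^ n * al22 + theta3 ^ n * al32 + theta4 ^ n * al42
      + theta5 ^ n * al52 + al62 - tailMoment theta2 n),
    w3 * (theta3 ^ n * al33 + theta4 ^ n * al43 + theta5 ^ n * al53 + al63 - tailMoment theta3 n),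
    w2 * theta2 ^ n * al24P + w3 * theta3 ^ n * al34P + w4 * (theta2 ^ n * al24 + theta3 ^ n * al34
      + theta4 ^ n * al44 + theta5 ^ n * al54 + al64 - tailMoment theta4 n),
    w2 * theta2 ^ n * a98 + w3 * theta3 ^ n * a11_8 + w5 * (theta2 ^ n * al25 + theta3 ^ n * al35
      + theta4 ^ n * al45 + theta5 ^ n * al55 + al65 - tailMoment theta5 n),
    w5 * theta5 ^ n + w2 * theta2 ^ n * u2P + w3 * theta3 ^ n * u3P + w4 * (theta2 ^ n * u2
      + theta3 ^ n * u3 + theta4 ^ n * u4 + theta5 ^ n * u5 + u6)]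

/-- The entries of `dₙ`, divided by the weights, at the second stage with each interior node. -/
def second (n : ℕ) : Fin 4 → LobattoField :=
  ![theta3 ^ n * (A11_10 + A12_10) + theta4 ^ n * A13_10 + theta5 ^ n * A14_10 + A15_10
      - tailMoment theta2 n,
    theta4 ^ n * A13_12 + theta5 ^ n * A14_12 + A15_12 - tailMoment theta3 n,
    theta5 ^ n * A14_13 + A15_13 - tailMoment theta4 n,
    A15_14 - tailMoment theta5 n]

/-- The effect of multiplication by the coefficient matrix on a row vector that is supported on the
pairs of stages with the same node and has zero sum over each pair. -/
def shift (k : Fin 4 → LobattoField) : Fin 4 → LobattoField :=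
  ![k 1 * A12_10 + k 2 * A13_10 + k 3 * A14_10, k 2 * A13_12 + k 3 * A14_12, k 3 * A14_13,
    ((0 : ℤ) : LobattoField)]

/-- The sums over the stages with the same node after such a multiplication. -/
def shiftSum (k : Fin 4 → LobattoField) : Fin 5 → LobattoField :=
  ![w2 * (k 0 * al22 + k 1 * al32 + k 2 * al42 + k 3 * al52),
    w3 * (k 1 * al33 + k 2 * al43 + k 3 * al53),
    w4 * (k 0 * al24 + k 1 * al34 + k 2 * al44 + k 3 * al54),
    w5 * (k 0 * al25 + k 1 * al35 + k 2 * al45 + k 3 * al55),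
    w4 * (k 0 * u2 + k 1 * u3 + k 2 * u4 + k 3 * u5)]

/-- The vector `d₁` at the second stages of the pairs, divided by the weights. -/
def chain1 : Fin 4 → LobattoField :=
  ![⟨-1519, 8120, -5846, 757, -20517, 33327, -840, 10206, 64344, by decide⟩,
    ⟨-783237, -275786, 224002, 160321, 2227057, -1253861, -765506, 210602, 3402392, by decide⟩,
    ⟨315, 84, -148, 51, -7, -287, -196, 224, 3304, by decide⟩,
    ⟨14, 0, 1, 0, -21, 0, 0, 0, 84, by decide⟩]

/-- The vector `d₁ A` at the second stages of the pairs, divided by the weights. -/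
def chain2 : Fin 4 → LobattoField :=
  ![⟨2331, -8260, 4428, -671, 27111, -35427, -3900, -8916, 386064, by decide⟩,
    ⟨-1394456, 35924, 21718, 251772, 2694293, -3375015, -427741, -557955, 20414352, by decide⟩,
    ⟨154, -14, 64, -38, -343, -21, 131, -57, 19824, by decide⟩,
    ⟨0, 0, 0, 0, 0, 0, 0, 0, 1, by decide⟩]

/-- The vector `d₁ A²` at the second stages of the pairs, divided by the weights. -/
def chain3 : Fin 4 → LobattoField :=
  ![⟨-286, 2136, -842, 198, -7077, 9443, 1245, 2587, 386064, by decide⟩,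
    ⟨2259105, 427741, -406335, -384899, -5071668, 4183368, 1402860, -65154, 61243056, by decide⟩,
    ⟨0, 0, 0, 0, 0, 0, 0, 0, 1, by decide⟩,
    ⟨0, 0, 0, 0, 0, 0, 0, 0, 1, by decide⟩]

/-- The factor between `d₁ A³` and `d₄`, up to vectors of zero sum over each pair. -/
def ratio : LobattoField := ⟨395, -3470, 2515, 870, 14805, 9380, -7665, 6760, 12136, by decide⟩

/-- The node sums of `d₄`. -/
def sum4 : Fin 5 → LobattoField :=
  ![⟨12964, 6720, -5021, -2460, 40502, -16380, -15475, 6660, 302400, by decide⟩,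
    ⟨84, -35, 6, 20, 210, 42, -120, -15, 302400, by decide⟩,
    ⟨-230076, 104825, 85356, -40460, 645960, 305508, -242220, -109785, 302400, by decide⟩,
    ⟨-45836, 14490, 7639, -10980, 149548, 87570, -43865, 360, 302400, by decide⟩,
    ⟨7973, -3339, -1825, 1929, -27706, -13734, 8918, 1134, 5040, by decide⟩]

/-- The vectors `d₀`, …, `d₃` have zero sum over each pair. As the coefficient of `a₈₇` is a
separate coordinate that also vanishes, this holds for every value of `a₈₇`. -/
theorem nodeSum_eq_zero : ∀ n < 4, ∀ i, SameValue (nodeSum n i) ((0 : ℤ) : LobattoField) := by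
  decide +kernel

theorem nodeSum_four : ∀ i, SameValue (nodeSum 4 i) (sum4 i) := by decide +kernel

theorem second_zero : ∀ i, SameValue (second 0 i) ((0 : ℤ) : LobattoField) := by decide +kernel

theorem second_one : ∀ i, SameValue (second 1 i) (chain1 i) := by decide +kernel

/-- Together with the next identity this places `d₂` and `d₃` in the flag spanned by `d₁`, `d₁A`,
`d₁A²`. -/
theorem second_two : ∀ i, SameValue (second 2 i)
    ((⟨5, 0, 0, 0, 1, 0, 0, 0, 3, by decide⟩ : LobattoField) * chain1 i
      + (⟨45, 1, -15, 1, -21, -63, -3, 15, 9, by decide⟩ : LobattoField) * chain2 i) := by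
  decide +kernel

theorem second_three : ∀ i, SameValue (second 3 i)
    ((⟨182, 0, 1, 0, 63, 0, 0, 0, 84, by decide⟩ : LobattoField) * chain1 i
      + (⟨115, 5, -41, 1, -35, -165, -17, 39, 12, by decide⟩ : LobattoField) * chain2 i
      + (⟨99, 4, -33, 4, -21, -126, -3, 42, 6, by decide⟩ : LobattoField) * chain3 i) := by
  decide +kernel

theorem shift_chain1 : ∀ i, SameValue (shift chain1 i) (chain2 i) := by decide +kernel

theorem shift_chain2 : ∀ i, SameValue (shift chain2 i) (chain3 i) := by decide +kernel

theorem shiftSum_chain1 : ∀ i, SameValue (shiftSum chain1 i) ((0 : ℤ) : LobattoField) := by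
  decide +kernel

theorem shiftSum_chain2 : ∀ i, SameValue (shiftSum chain2 i) ((0 : ℤ) : LobattoField) := by
  decide +kernel

/-- Here the chain leaves the vectors of zero pair sums, but only in the direction of `d₄`. -/
theorem shiftSum_chain3 : ∀ i, SameValue (shiftSum chain3 i) (ratio * sum4 i) := by decide +kernel

/-- Entrywise multiplication by `c` moves each member of the flag no further than multiplication by
`A` does. -/
theorem nodes_mul_chain1 : ∀ i, SameValue (nodes i * chain1 i)
    (theta5 * chain1 i + (⟨8, 0, -2, 0, 0, -14, 0, 2, 1, by decide⟩ :
      LobattoField) * chain2 i) := by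
  decide +kernel

theorem nodes_mul_chain2 : ∀ i, SameValue (nodes i * chain2 i)
    (theta4 * chain2 i + chain3 i) := by
  decide +kernel

theorem lobatto_quadrature : ∀ m < 9, SameValue (w2 * theta2 ^ (m + 1) + w3 * theta3 ^ (m + 1)
    + w4 * theta4 ^ (m + 1) + w5 * theta5 ^ (m + 1) + w6) (unitFrac (m + 1)) := by
  decide +kernel

theorem lobatto_sum : SameValue (w1 + w2 + w3 + w4 + w5 + w6) ((1 : ℤ) : LobattoField) := by
  decide +kernel

/-- The part of `∑ⱼ d₄ⱼ cⱼᵐ`, summed over the stages from the seventh on, that does not depend on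
`a₈₇`. -/
def moment4 : Fin 4 → LobattoField :=
  ![⟨-1174, 720, 387, -303, 4739, 1708, -1720, -445, 10080, by decide⟩,
    ⟨-260, 255, 82, -105, 1665, 396, -609, -90, 15120, by decide⟩,
    ⟨-945, 2240, 246, -902, 14595, 1722, -5376, -210, 423360, by decide⟩,
    ⟨357, 2100, -210, -825, 13755, 35, -5100, 340, 1058400, by decide⟩]

theorem moment4_eq : ∀ m : Fin 4, SameValue (sum4 0 * theta2 ^ (m.val + 1)
    + sum4 1 * theta3 ^ (m.val + 1) + sum4 2 * theta4 ^ (m.val + 1) + sum4 3 * theta5 ^ (m.val + 1))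
    (moment4 m) := by
  decide +kernel

/-- The determinants formed from the two parts of the moments of `d₄`. -/
def minor (i j : Fin 4) : LobattoField :=
  moment4 i * theta4 ^ (j.val + 1) - moment4 j * theta4 ^ (i.val + 1)

/-- The common factor of the determinants. -/
def minorFactor : LobattoField :=
  ⟨-18, 206, 45, -55, 336, -245, -177, -32, 3220160832000, by decide⟩

/-- The six determinants share the factor `minorFactor`. Dividing it out leaves the constants `U`
and `V` in the formula for `c₆`, up to rational factors and one combination of `V0` with `U2`. -/
theorem minor_three_two : SameValue (minor 3 2)
    (minorFactor * (((2 : ℤ) : LobattoField) * U0)) := by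
  decide +kernel

theorem minor_three_one :
    SameValue (((3 : ℤ) : LobattoField) * minor 3 1)
      (minorFactor * (((-28 : ℤ) : LobattoField) * U1)) := by
  decide +kernel

theorem minor_two_one : SameValue (minor 2 1) (minorFactor * U2) := by
  decide +kernel

theorem minor_three_zero :
    SameValue (((3 : ℤ) : LobattoField) * minor 3 0)
      (minorFactor * (((14 : ℤ) : LobattoField) * V0 - ((2 : ℤ) : LobattoField) * U2)) := by
  decide +kernel

theorem minor_two_zero :
    SameValue (minor 2 0) (minorFactor * (((-70 : ℤ) : LobattoField) * V1)) := by
  decide +kernel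

theorem minor_one_zero :
    SameValue (minor 1 0) (minorFactor * (((140 : ℤ) : LobattoField) * V2)) := by
  decide +kernel

end LobattoField

-- Simplifying assumptions that imply order ten.

namespace PlaneTree

theorem order_pos (t : PlaneTree) : 0 < order t := by
  cases t; rw [order]; lia

theorem factorial_cast_ne (t : PlaneTree) : (factorial t : ℝ) ≠ 0 := by
  suffices h : factorial t ≠ 0 ∧ ∀ ts : List PlaneTree, t = node ts → factorialList ts ≠ 0 from
    Nat.cast_ne_zero.mpr h.1
  induction t using PlaneTree.rec (motive_2 := fun ts => factorialList ts ≠ 0) with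
  | node ts ih =>
    refine ⟨?_, fun ts' h => ?_⟩
    · rw [factorial]; exact mul_ne_zero (by lia) ih
    · cases h; exact ih
  | nil => simp [factorialList]
  | cons t ts ih ih2 => rw [factorialList]; exact mul_ne_zero ih.1 ih2

theorem factorialList_cast_ne (ts : List PlaneTree) : (factorialList ts : ℝ) ≠ 0 := by
  have h := factorial_cast_ne (node ts)
  rw [factorial, Nat.cast_mul] at h
  exact right_ne_zero_of_mul h

theorem order_le_orderList {t : PlaneTree} {ts : List PlaneTree} (h : t ∈ ts) :
    order t ≤ orderList ts := by
  induction ts with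
  | nil => simp at h
  | cons u us ih =>
    rw [orderList]
    rcases List.mem_cons.mp h with rfl | h
    · lia
    · have := ih h; lia

end PlaneTree

namespace RKMethod

open PlaneTree Matrix

variable {s : ℕ}

/-- Stage `i` evaluates all trees with at most `n` vertices as the exact solution does. -/
def StageExact (M : RKMethod s) (n : ℕ) (i : Fin s) : Prop :=
  ∀ t : PlaneTree, order t ≤ n → (M.A *ᵥ weight M.A t) i = M.c i ^ order t / factorial t

theorem weightList_eq {M : RKMethod s} {i : Fin s} {ts : List PlaneTree}
    (h : ∀ u ∈ ts, (M.A *ᵥ weight M.A u) i = M.c i ^ order u / factorial u) :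
    weightList M.A ts i = M.c i ^ orderList ts / factorialList ts := by
  induction ts with
  | nil => simp [weightList, orderList, factorialList]
  | cons u us ih =>
    rw [weightList, Pi.mul_apply, h u (by simp), ih fun v hv => h v (by simp [hv]), orderList,
      factorialList, pow_add, Nat.cast_mul, div_mul_div_comm]

theorem StageExact.weightList_eq {M : RKMethod s} {n : ℕ} {i : Fin s} (h : M.StageExact n i)
    {ts : List PlaneTree} (hts : ∀ u ∈ ts, order u ≤ n) :
    weightList M.A ts i = M.c i ^ orderList ts / factorialList ts :=
  RKMethod.weightList_eq fun u hu => h u (hts u hu)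

theorem stageExact_zero (M : RKMethod s) (i : Fin s) : M.StageExact 0 i :=
  fun t ht => absurd (order_pos t) (by lia)

/-- If the stages used by row `i` are exact on the branches, the weight of `[t₁ … tₙ]` at such a
stage is a multiple of a power of its node, so only a quadrature condition on the row is left.
Stages that the row does not use may be inexact, which lets the order rise past the first stages. -/
theorem StageExact.succ {M : RKMethod s} {n : ℕ} {i : Fin s}
    (h : ∀ j, M.A i j ≠ 0 → M.StageExact n j)
    (hrow : ∀ m ≤ n, ∑ j, M.A i j * M.c j ^ m = M.c i ^ (m + 1) / ((m : ℝ) + 1)) :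
    M.StageExact (n + 1) i := by
  rintro ⟨ts⟩ ht
  rw [order] at ht
  have hn : orderList ts ≤ n := by lia
  have e : (M.A *ᵥ weight M.A (node ts)) i
      = (∑ j, M.A i j * M.c j ^ orderList ts) / factorialList ts := by
    rw [Finset.sum_div, mulVec, dotProduct]
    refine Finset.sum_congr rfl fun j _ => ?_
    by_cases hj : M.A i j = 0
    · simp [hj]
    · rw [weight, (h j hj).weightList_eq fun u hu => (order_le_orderList hu).trans hn,
      mul_div_assoc]
  rw [e, hrow _ hn, order, factorial, div_div, add_comm 1]
  push_cast
  rfl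

theorem sum_mul_mulVec (A : Matrix (Fin s) (Fin s) ℝ) (f v : Fin s → ℝ) :
    ∑ i, f i * (A *ᵥ v) i = ∑ j, (f ᵥ* A) j * v j :=
  dotProduct_mulVec f A v

/-- Simplifying assumptions for order ten. The stages that are not `good` have low stage order and
zero weight; the sets `G j` consist of row vectors that annihilate the weights of all trees with at
most `j + 5` vertices. -/
structure TenCriterion (M : RKMethod s) (p q : Fin s) (good : Fin s → Prop)
    (G : ℕ → Set (Fin s → ℝ)) : Prop where
  rowSum : M.RowSum
  row_one : ∀ i, i ≠ p → ∑ j, M.A i j * M.c j = M.c i ^ 2 / 2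
  row_two : ∀ i, i ≠ p → i ≠ q → ∑ j, M.A i j * M.c j ^ 2 = M.c i ^ 3 / 3
  row_three : ∀ i, good i → ∑ j, M.A i j * M.c j ^ 3 = M.c i ^ 4 / 4
  col_p : ∀ i, i ≠ q → M.A i p = 0
  col_q : ∀ i, good i → M.A i q = 0
  not_good_p : ¬ good p
  not_good_q : ¬ good q
  b_eq_zero : ∀ i, ¬ good i → M.b i = 0
  quadrature : ∀ m : ℕ, m ≤ 9 → ∑ i, M.b i * M.c i ^ m = 1 / ((m : ℝ) + 1)
  d_zero : M.d 0 = 0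
  d_mem : ∀ j k, j + (k + 1) = 4 → M.d (k + 1) ∈ G j
  zero_p : ∀ f ∈ G 0, f p = 0
  zero_q : ∀ f ∈ G 0, f q = 0
  zero_pow : ∀ f ∈ G 0, ∀ m : ℕ, m ≤ 4 → ∑ i, f i * M.c i ^ m = 0
  zero_col : ∀ f ∈ G 0, (f ᵥ* M.A) q = 0
  zero_cube : ∀ f ∈ G 0, ∑ i, (f ᵥ* M.A) i * M.c i ^ 3 = 0
  succ_eq_zero : ∀ j, ∀ f ∈ G (j + 1), ∀ i, ¬ good i → f i = 0
  succ_pow : ∀ j, ∀ f ∈ G (j + 1), ∀ m : ℕ, ∑ i, f i * M.c i ^ m = 0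
  succ_vecMul : ∀ j, ∀ f ∈ G (j + 1), f ᵥ* M.A ∈ G j
  succ_mul : ∀ j, ∀ f ∈ G (j + 1), f * M.c ∈ G j

namespace TenCriterion

variable {M : RKMethod s} {p q : Fin s} {good : Fin s → Prop} {G : ℕ → Set (Fin s → ℝ)}

/-- The guaranteed exactness rises from one at `p` to two at `q`, three at the other stages and four
at good ones. Each rise is possible because only row `q` uses `p`, and no good row uses `q`. -/
theorem stageExact_one (h : M.TenCriterion p q good G) (i : Fin s) : M.StageExact 1 i :=
  StageExact.succ (fun j _ => stageExact_zero M j) fun m hm => by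
    obtain rfl : m = 0 := by lia
    simpa using h.rowSum i

theorem stageExact_two (h : M.TenCriterion p q good G) {i : Fin s} (hi : i ≠ p) :
    M.StageExact 2 i :=
  StageExact.succ (fun j _ => h.stageExact_one j) fun m hm => by
    interval_cases m
    · simpa using h.rowSum i
    · simpa [one_add_one_eq_two] using h.row_one i hi

theorem stageExact_three (h : M.TenCriterion p q good G) {i : Fin s} (hp : i ≠ p) (hq : i ≠ q) :
    M.StageExact 3 i :=
  StageExact.succ (fun j hj => h.stageExact_two (by rintro rfl; exact hj (h.col_p i hq)))
    fun m hm => by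
      interval_cases m
      · simpa using h.rowSum i
      · simpa [one_add_one_eq_two] using h.row_one i hp
      · rw [h.row_two i hp hq]; norm_num

theorem stageExact_four (h : M.TenCriterion p q good G) {i : Fin s} (hi : good i) :
    M.StageExact 4 i := by
  have hp : i ≠ p := by rintro rfl; exact h.not_good_p hi
  have hq : i ≠ q := by rintro rfl; exact h.not_good_q hi
  refine StageExact.succ (fun j hj => h.stageExact_three (by rintro rfl; exact hj (h.col_p i hq))
    (by rintro rfl; exact hj (h.col_q i hi))) fun m hm => ?_
  interval_cases m
  · simpa using h.rowSum i
  · simpa [one_add_one_eq_two] using h.row_one i hp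
  · rw [h.row_two i hp hq]; norm_num
  · rw [h.row_three i hi]; norm_num

/-- Stages other than `p` and `q` are exact up to three vertices, so small branches give power
moments of `f`. The only other trees are `[u]` with `|u| = 4`; these involve `f A`, whose entry at
`q` and third moment are assumed to vanish. -/
theorem sum_weight_eq_zero_of_mem_zero (h : M.TenCriterion p q good G) {f : Fin s → ℝ}
    (hf : f ∈ G 0) {t : PlaneTree} (ht : order t ≤ 5) : ∑ i, f i * weight M.A t i = 0 := by
  obtain ⟨ts⟩ := t
  rw [order] at ht
  by_cases hts : ∀ u ∈ ts, order u ≤ 3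
  · have e : ∀ i, f i * weight M.A (node ts) i
        = f i * M.c i ^ orderList ts / factorialList ts := fun i => by
      by_cases hp : i = p
      · simp [hp, h.zero_p f hf]
      by_cases hq : i = q
      · simp [hq, h.zero_q f hf]
      rw [weight, (h.stageExact_three hp hq).weightList_eq hts, mul_div_assoc]
    rw [Finset.sum_congr rfl fun i _ => e i, ← Finset.sum_div, h.zero_pow f hf _ (by lia), zero_div]
  · push Not at hts
    obtain ⟨u, hu, hu4⟩ := hts
    obtain ⟨l, l', rfl⟩ := List.append_of_mem hu
    -- A branch with four vertices exhausts the five vertices of the tree, so it has no siblings.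
    have hl : ∀ k : List PlaneTree, orderList k = 0 → k = [] := fun k hk => by
      cases k with
      | nil => rfl
      | cons v vs => rw [orderList] at hk; have := order_pos v; lia
    rw [orderList_append, orderList] at ht
    obtain rfl := hl l (by lia)
    obtain rfl := hl l' (by lia)
    obtain ⟨us⟩ := u
    rw [order] at hu4 ht
    have hus : orderList us = 3 := by lia
    have e : ∀ i, (f ᵥ* M.A) i * weight M.A (node us) i
        = (f ᵥ* M.A) i * M.c i ^ 3 / factorialList us := fun i => by
      by_cases hp : i = p
      -- Column `p` is non-zero at most in row `q`, and `f` vanishes there.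
      · have : ∑ k, f k * M.A k i = 0 := Finset.sum_eq_zero fun k _ => by
          by_cases hk : k = q
          · rw [hk, h.zero_q f hf, zero_mul]
          · rw [hp]; exact mul_eq_zero_of_right _ (h.col_p k hk)
        rw [show (f ᵥ* M.A) i = 0 from this, zero_mul, zero_mul, zero_div]
      by_cases hq : i = q
      · simp [hq, h.zero_col f hf]
      rw [weight, (h.stageExact_three hp hq).weightList_eq fun v hv =>
        (order_le_orderList hv).trans hus.le, hus, mul_div_assoc]
    have e2 : weight M.A (node ([] ++ node us :: [])) = M.A *ᵥ weight M.A (node us) := by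
      simp [weight, weightList]
    rw [e2, sum_mul_mulVec, Finset.sum_congr rfl fun i _ => e i, ← Finset.sum_div,
      h.zero_cube f hf, zero_div]

theorem mul_pow_mem (h : M.TenCriterion p q good G) {j m : ℕ} {f : Fin s → ℝ}
    (hf : f ∈ G (j + m)) : f * M.c ^ m ∈ G j := by
  induction m generalizing f with
  | zero => simpa using hf
  | succ m ih =>
    rw [pow_succ', ← mul_assoc]
    exact ih (h.succ_mul (j + m) f hf)

/-- The weight of a tree with one branch that has more than four vertices. -/
theorem weight_eq_of_branch (h : M.TenCriterion p q good G) {u : PlaneTree} {ts : List PlaneTree}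
    (hu : u ∈ ts) (hts : orderList ts ≤ order u + 4) :
    ∃ m n : ℕ, orderList ts = order u + m ∧ factorialList ts = factorial u * n ∧ (n : ℝ) ≠ 0 ∧
      ∀ i, good i → weightList M.A ts i = M.c i ^ m * (M.A *ᵥ weight M.A u) i / n := by
  obtain ⟨l, l', rfl⟩ := List.append_of_mem hu
  have hl : (l ++ u :: l').Perm (u :: (l ++ l')) := List.perm_middle
  rw [orderList_perm hl, orderList] at hts
  refine ⟨orderList (l ++ l'), factorialList (l ++ l'), ?_, ?_, factorialList_cast_ne _, ?_⟩
  · rw [orderList_perm hl, orderList]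
  · rw [factorialList_perm hl, factorialList]
  · intro i hi
    rw [weightList_perm M.A hl, weightList, Pi.mul_apply,
      (h.stageExact_four hi).weightList_eq fun v hv => (order_le_orderList hv).trans (by lia),
      mul_comm, div_mul_eq_mul_div]

/-- If all branches have at most four vertices, a power moment of `f` remains. Otherwise `f Φ(t)` is
a multiple of `((f c^m) A) Φ(u)`, where `m` counts the vertices of the siblings of the large branch
`u`. The multiplications use up `m + 1` levels of `G`, as many as the vertices removed. -/
theorem sum_weight_eq_zero (h : M.TenCriterion p q good G) (j : ℕ) :
    ∀ f ∈ G j, ∀ t : PlaneTree, order t ≤ j + 5 → j ≤ 3 → ∑ i, f i * weight M.A t i = 0 := by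
  induction j using Nat.strong_induction_on with
  | _ j ih =>
  intro f hf t ht hj3
  obtain _ | j := j
  · exact h.sum_weight_eq_zero_of_mem_zero hf (by lia)
  obtain ⟨ts⟩ := t
  rw [order] at ht
  by_cases hts : ∀ u ∈ ts, order u ≤ 4
  · have e : ∀ i, f i * weight M.A (node ts) i
        = f i * M.c i ^ orderList ts / factorialList ts := fun i => by
      by_cases hi : good i
      · rw [weight, (h.stageExact_four hi).weightList_eq hts, mul_div_assoc]
      · simp [h.succ_eq_zero j f hf i hi]
    rw [Finset.sum_congr rfl fun i _ => e i, ← Finset.sum_div, h.succ_pow j f hf, zero_div]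
  · push Not at hts
    obtain ⟨u, hu, hu5⟩ := hts
    obtain ⟨m, n, hm, -, -, hw⟩ := h.weight_eq_of_branch hu (by lia)
    obtain ⟨k, rfl⟩ : ∃ k, j = k + m := ⟨j - m, by lia⟩
    have e : ∀ i, f i * weight M.A (node ts) i
        = (f * M.c ^ m) i * (M.A *ᵥ weight M.A u) i / n := fun i => by
      by_cases hi : good i
      · rw [weight, hw i hi, Pi.mul_apply, Pi.pow_apply]; ring
      · simp [h.succ_eq_zero _ f hf i hi]
    have hmem : f * M.c ^ m ∈ G (k + 1) := h.mul_pow_mem (by rwa [Nat.add_right_comm] at hf)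
    rw [Finset.sum_congr rfl fun i _ => e i, ← Finset.sum_div, sum_mul_mulVec,
      ih k (by lia) _ (h.succ_vecMul k _ hmem) u (by lia) (by lia), zero_div]

theorem sum_d_weight_eq_zero (h : M.TenCriterion p q good G) {k : ℕ} (hk : k ≤ 4) {t : PlaneTree}
    (ht : k + order t ≤ 9) : ∑ i, M.d k i * weight M.A t i = 0 := by
  obtain _ | k := k
  · simp [h.d_zero]
  · exact h.sum_weight_eq_zero (3 - k) _ (h.d_mem (3 - k) k (by lia)) t (by lia) (by lia)

/-- The factor `c^k` is carried along because removing a large branch creates such factors. The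
value on the right is that of the exact solution: `Φ(t)` behaves like `|t| τ^(|t|-1) / t!`,
integrated against `τ^k`. -/
theorem sum_b_weight (h : M.TenCriterion p q good G) (N : ℕ) :
    ∀ t : PlaneTree, order t ≤ N → ∀ k, k + order t ≤ 10 →
      ∑ i, M.b i * M.c i ^ k * weight M.A t i
        = order t / (factorial t * ((k : ℝ) + order t)) := by
  induction N with
  | zero => exact fun t ht => absurd (order_pos t) (by lia)
  | succ N ih =>
  rintro ⟨ts⟩ ht k hk
  have ho : order (node ts) = 1 + orderList ts := rfl
  have hfac : factorial (node ts) = (1 + orderList ts) * factorialList ts := rfl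
  rw [ho] at hk ht
  by_cases hts : ∀ u ∈ ts, order u ≤ 4
  · have e : ∀ i, M.b i * M.c i ^ k * weight M.A (node ts) i
        = M.b i * M.c i ^ (k + orderList ts) / factorialList ts := fun i => by
      by_cases hi : good i
      · rw [weight, (h.stageExact_four hi).weightList_eq hts, pow_add]; ring
      · simp [h.b_eq_zero i hi]
    rw [Finset.sum_congr rfl fun i _ => e i, ← Finset.sum_div, h.quadrature _ (by lia), ho, hfac]
    have := factorialList_cast_ne ts
    push_cast
    field_simp
    ring
  · push Not at hts
    obtain ⟨u, hu, hu5⟩ := hts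
    obtain ⟨m, n, hm, hn, hn0, hw⟩ := h.weight_eq_of_branch hu (by lia)
    have e : ∀ i, M.b i * M.c i ^ k * weight M.A (node ts) i
        = (M.b i * M.c i ^ (k + m)) * (M.A *ᵥ weight M.A u) i / n := fun i => by
      by_cases hi : good i
      · rw [weight, hw i hi, pow_add]; ring
      · simp [h.b_eq_zero i hi]
    -- This is the definition of `d` solved for `(b c^(k+m)) A`. The two other terms are instances
    -- of the induction hypothesis for `u`, with exponents `0` and `k + m + 1`.
    have hd : ∀ j, ((fun i => M.b i * M.c i ^ (k + m)) ᵥ* M.A) j * weight M.A u j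
        = M.d (k + m) j * weight M.A u j + (M.b j * M.c j ^ 0 * weight M.A u j
          - M.b j * M.c j ^ (k + m + 1) * weight M.A u j) / ((k + m : ℕ) + 1 : ℝ) := fun j => by
      rw [d, vecMul, dotProduct]
      ring
    rw [Finset.sum_congr rfl fun i _ => e i, ← Finset.sum_div, sum_mul_mulVec,
      Finset.sum_congr rfl fun j _ => hd j, Finset.sum_add_distrib, ← Finset.sum_div,
      Finset.sum_sub_distrib, h.sum_d_weight_eq_zero (by lia) (by lia),
      ih u (by lia) 0 (by lia), ih u (by lia) (k + m + 1) (by lia), ho, hfac, hm, hn]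
    have h1 := factorial_cast_ne u
    have h2 : (order u : ℝ) ≠ 0 := Nat.cast_ne_zero.mpr (order_pos u).ne'
    have h3 : (k : ℝ) + m + 1 + order u ≠ 0 := by positivity
    push_cast
    field_simp
    ring

theorem hasOrder (h : M.TenCriterion p q good G) : M.HasOrder 10 := by
  intro t
  induction t using Quot.ind with
  | _ t =>
  intro ht
  replace ht : order t ≤ 10 := ht
  change ∑ i, M.b i * weight M.A t i = 1 / (factorial t : ℝ)
  have e := h.sum_b_weight (order t) t le_rfl 0 (by simpa using ht)
  simp only [pow_zero, mul_one] at e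
  have h1 := factorial_cast_ne t
  have h2 : (order t : ℝ) ≠ 0 := Nat.cast_ne_zero.mpr (order_pos t).ne'
  rw [e]
  push_cast
  field_simp
  ring

end TenCriterion

end RKMethod

-- The number of rooted trees with at most ten vertices.

namespace ButcherTree

open PlaneTree

/-- The rooted tree underlying a plane tree. -/
def mk : PlaneTree → ButcherTree := Quot.mk _

theorem mk_surjective (t : ButcherTree) : ∃ u, mk u = t := Quot.exists_rep t

/-- A plane tree that represents a rooted tree. -/
noncomputable def out (t : ButcherTree) : PlaneTree := Quot.out t

theorem mk_out (t : ButcherTree) : mk (out t) = t := Quot.out_eq t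

theorem map_mk_map_out (l : List ButcherTree) : (l.map out).map mk = l := by
  rw [List.map_map]
  exact List.map_id'' mk_out l

theorem mk_node_perm {l l' : List PlaneTree} (h : l.Perm l') : mk (node l) = mk (node l') :=
  Quot.sound (Move.perm h)

theorem mk_node_append_cons {t u : PlaneTree} (h : mk t = mk u) (l l' : List PlaneTree) :
    mk (node (l ++ t :: l')) = mk (node (l ++ u :: l')) := by
  -- Equality in the quotient is the equivalence relation generated by the moves, so the induction
  -- must also cover symmetry and transitivity.
  have h' := Quot.eqvGen_exact h
  clear h
  induction h' with
  | rel t u h => exact Quot.sound (Move.branch h)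
  | refl t => rfl
  | symm t u _ ih => exact ih.symm
  | trans t u v _ _ ih ih' => exact ih.trans ih'

theorem mk_node_congr {l l' : List PlaneTree} (h : l.map mk = l'.map mk) :
    mk (node l) = mk (node l') := by
  -- The prefix `k` collects the branches that have already been exchanged.
  suffices H : ∀ k : List PlaneTree, mk (node (k ++ l)) = mk (node (k ++ l')) from H []
  induction l generalizing l' with
  | nil => rw [List.map_nil, eq_comm, List.map_eq_nil_iff] at h; simp [h]
  | cons t l ih =>
    obtain _ | ⟨u, l'⟩ := l'
    · simp at h
    · rw [List.map_cons, List.map_cons, List.cons.injEq] at h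
      intro k
      rw [mk_node_append_cons h.1 k l]
      simpa using ih h.2 (k ++ [u])

/-- The branches at the root. -/
def children : ButcherTree → Multiset ButcherTree :=
  Quot.lift (fun t => match t with | node ts => (ts.map mk : Multiset ButcherTree)) fun _ _ h => by
    cases h with
    | perm h => exact Multiset.coe_eq_coe.mpr (h.map mk)
    | branch h => simp [show mk _ = mk _ from Quot.sound h]

theorem children_mk (ts : List PlaneTree) : children (mk (node ts)) = (ts.map mk : List _) := rfl

/-- After every branch is replaced by the chosen representative of its class, equal multisets of
branches are permutations of one another as lists of plane trees. -/
theorem children_injective : Function.Injective children := by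
  intro t u h
  obtain ⟨⟨l⟩, rfl⟩ := mk_surjective t
  obtain ⟨⟨l'⟩, rfl⟩ := mk_surjective u
  have e : ∀ k : List PlaneTree, mk (node k) = mk (node ((k.map mk).map out)) := fun k =>
    mk_node_congr (map_mk_map_out _).symm
  rw [children_mk, children_mk, Multiset.coe_eq_coe] at h
  rw [e l, e l']
  exact mk_node_perm (h.map _)

theorem children_surjective : Function.Surjective children := by
  intro m
  induction m using Quot.ind with
  | _ l =>
  exact ⟨mk (node (l.map out)), congrArg _ (map_mk_map_out l)⟩

theorem order_eq (t : ButcherTree) : t.order = 1 + (t.children.map order).sum := by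
  obtain ⟨⟨l⟩, rfl⟩ := mk_surjective t
  change 1 + orderList l = _
  rw [children_mk]
  congr 1
  induction l with
  | nil => rfl
  | cons t l ih =>
    rw [orderList, ih]
    rfl

theorem order_pos (t : ButcherTree) : 0 < t.order := by
  rw [order_eq]; lia

/-- The forests with `n` vertices whose trees are taken from the list `l`. -/
def forests (l : List ButcherTree) (n : ℕ) : Set (Multiset ButcherTree) :=
  {m | (∀ t ∈ m, t ∈ l) ∧ (m.map order).sum = n}

theorem forests_nil_zero : forests [] 0 = {0} := by
  ext m
  constructor
  · exact fun h => Multiset.eq_zero_of_forall_notMem fun t ht => by simpa using h.1 t ht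
  · rintro rfl; simp [forests]

theorem forests_nil_succ (n : ℕ) : forests [] (n + 1) = ∅ := by
  ext m
  simp only [forests, Set.mem_ofPred_eq, Set.mem_empty_iff_false, iff_false, not_and]
  intro h
  have : m = 0 := Multiset.eq_zero_of_forall_notMem fun t ht => by simpa using h t ht
  simp [this]

/-- A forest either avoids `t` or becomes a smaller forest when one copy of `t` is removed.
Numerically this is multiplication of the generating function by `1 / (1 - x^|t|)`. -/
theorem forests_cons (t : ButcherTree) (l : List ButcherTree) (n : ℕ) :
    forests (t :: l) n = forests l n ∪
      if t.order ≤ n then Multiset.cons t '' forests (t :: l) (n - t.order) else ∅ := by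
  ext m
  rw [Set.mem_union]
  constructor
  · rintro ⟨hm, hn⟩
    by_cases ht : t ∈ m
    · obtain ⟨m, rfl⟩ := Multiset.exists_cons_of_mem ht
      rw [Multiset.map_cons, Multiset.sum_cons] at hn
      right
      rw [if_pos (by lia)]
      exact ⟨m, ⟨fun u hu => hm u (Multiset.mem_cons_of_mem hu), by lia⟩, rfl⟩
    · exact Or.inl ⟨fun u hu => (List.mem_cons.mp (hm u hu)).resolve_left
        (by rintro rfl; exact ht hu), hn⟩
  · rintro (⟨hm, hn⟩ | h)
    · exact ⟨fun u hu => List.mem_cons_of_mem _ (hm u hu), hn⟩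
    · split_ifs at h with hn
      · obtain ⟨m, ⟨hm, hn'⟩, rfl⟩ := h
        refine ⟨fun u hu => ?_, ?_⟩
        · rcases Multiset.mem_cons.mp hu with rfl | hu
          · simp
          · exact hm u hu
        · rw [Multiset.map_cons, Multiset.sum_cons]; lia
      · exact h.elim

theorem finite_forests (l : List ButcherTree) (n : ℕ) : (forests l n).Finite := by
  induction l generalizing n with
  | nil => cases n <;> simp [forests_nil_zero, forests_nil_succ]
  | cons t l ih =>
    induction n using Nat.strong_induction_on with
    | _ n ihn =>
    rw [forests_cons]
    refine (ih n).union ?_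
    split_ifs with h
    · exact (ihn _ (by have := t.order_pos; lia)).image _
    · exact Set.finite_empty

theorem ncard_forests_cons {t : ButcherTree} {l : List ButcherTree} (ht : t ∉ l) (n : ℕ) :
    (forests (t :: l) n).ncard = (forests l n).ncard +
      if t.order ≤ n then (forests (t :: l) (n - t.order)).ncard else 0 := by
  rw [forests_cons]
  split_ifs with h
  · rw [Set.ncard_union_eq _ (finite_forests _ _) ((finite_forests _ _).image _),
      Set.ncard_image_of_injective _ fun a b hab => (Multiset.cons_inj_right t).mp hab]
    rw [Set.disjoint_left]
    rintro m ⟨hm, -⟩ ⟨m', -, rfl⟩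
    exact ht (hm t (Multiset.mem_cons_self t m'))
  · simp

/-- The table `[f n, …, f 0]`. -/
def tabulate (f : ℕ → ℕ) : ℕ → List ℕ
  | 0 => [f 0]
  | n + 1 => f (n + 1) :: tabulate f n

/-- The effect on a table of forest numbers of one more tree with `w` vertices. -/
def addTree (w : ℕ) : List ℕ → List ℕ
  | [] => []
  -- Tables run downwards, so for `w > 0` the entry `w` places below `x` is at position `w - 1` of
  -- the tail; the default `0` covers sizes below `w`.
  | x :: xs => (x + (addTree w xs).getD (w - 1) 0) :: addTree w xs

theorem getD_tabulate (f : ℕ → ℕ) (n k : ℕ) :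
    (tabulate f n).getD k 0 = if k ≤ n then f (n - k) else 0 := by
  induction n generalizing k with
  | zero => cases k <;> simp [tabulate]
  | succ n ih =>
    cases k with
    | zero => rfl
    | succ k => simpa [tabulate] using ih k

theorem addTree_tabulate {f g : ℕ → ℕ} {w : ℕ} (hw : 0 < w)
    (h : ∀ n, g n = f n + if w ≤ n then g (n - w) else 0) (n : ℕ) :
    addTree w (tabulate f n) = tabulate g n := by
  induction n with
  | zero => simp [tabulate, addTree, h 0, hw.ne']
  | succ n ih =>
    rw [tabulate, addTree, ih, getD_tabulate, tabulate, h (n + 1)]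
    congr 2
    by_cases hn : w ≤ n + 1
    · rw [if_pos hn, if_pos (by lia)]; congr 1; lia
    · rw [if_neg hn, if_neg (by lia)]

/-- The numbers of forests with `n, …, 0` vertices, if `ws` lists the orders of the trees. -/
def forestTable (ws : List ℕ) (n : ℕ) : List ℕ :=
  ws.foldr addTree (tabulate (fun k => if k = 0 then 1 else 0) n)

theorem forestTable_eq {l : List ButcherTree} (hl : l.Nodup) (n : ℕ) :
    forestTable (l.map order) n = tabulate (fun k => (forests l k).ncard) n := by
  induction l with
  | nil =>
    rw [forestTable, List.map_nil, List.foldr_nil]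
    congr 1
    ext k
    cases k <;> simp [forests_nil_zero, forests_nil_succ]
  | cons t l ih =>
    rw [List.nodup_cons] at hl
    rw [List.map_cons, forestTable, List.foldr_cons, ← forestTable, ih hl.2]
    exact addTree_tabulate t.order_pos (ncard_forests_cons hl.1) n

/-- The orders of the trees with at most `n` vertices. -/
def treeOrders : ℕ → List ℕ
  | 0 => []
  | n + 1 => List.replicate ((forestTable (treeOrders n) n).headD 0) (n + 1) ++ treeOrders n

/-- The branches at the root of a tree with `n + 1` vertices form an arbitrary forest with `n`
vertices, and the trees of that forest are already listed. The new trees are thus counted by the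
head of the forest table. -/
theorem exists_list_trees (n : ℕ) :
    ∃ l : List ButcherTree, l.Nodup ∧ (∀ t, t ∈ l ↔ t.order ≤ n) ∧ l.map order = treeOrders n := by
  induction n with
  | zero => exact ⟨[], List.nodup_nil, fun t => by simp [t.order_pos.ne'], rfl⟩
  | succ n ih =>
    obtain ⟨l, hl, hmem, hord⟩ := ih
    have e : children '' {t | t.order = n + 1} = forests l n := by
      ext m
      constructor
      · rintro ⟨t, ht, rfl⟩
        rw [Set.mem_ofPred_eq, order_eq] at ht
        refine ⟨fun u hu => (hmem u).mpr ?_, by lia⟩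
        have := Multiset.le_sum_of_mem (Multiset.mem_map_of_mem order hu)
        lia
      · rintro ⟨-, hm⟩
        obtain ⟨t, rfl⟩ := children_surjective m
        exact ⟨t, by rw [Set.mem_ofPred_eq, order_eq]; lia, rfl⟩
    have hfin : {t : ButcherTree | t.order = n + 1}.Finite :=
      Set.Finite.of_finite_image (e ▸ finite_forests l n) children_injective.injOn
    have hcard : hfin.toFinset.card = (forestTable (treeOrders n) n).headD 0 := by
      rw [← Set.ncard_eq_toFinset_card _ hfin,
        ← Set.ncard_image_of_injective _ children_injective, e, ← hord, forestTable_eq hl]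
      cases n <;> rfl
    refine ⟨hfin.toFinset.toList ++ l, ?_, ?_, ?_⟩
    · refine List.Nodup.append (Finset.nodup_toList _) hl fun t ht ht' => ?_
      have h1 : t.order = n + 1 := by simpa using ht
      have h2 := (hmem t).mp ht'
      lia
    · intro t
      simp only [List.mem_append, Finset.mem_toList, Set.Finite.mem_toFinset, Set.mem_ofPred_eq,
        hmem]
      lia
    · rw [List.map_append, hord, treeOrders, ← hcard, ← Finset.length_toList]
      congr 1
      rw [List.eq_replicate_iff]
      simp

theorem card_order_le_ten : Nat.card {t : ButcherTree // t.order ≤ 10} = 1205 := by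
  obtain ⟨l, hl, hmem, hord⟩ := exists_list_trees 10
  have h : Nat.card {t : ButcherTree // t.order ≤ 10} = l.length := by
    classical
    rw [← List.toFinset_card_of_nodup hl, Nat.subtype_card]
    simpa using hmem
  have h2 : (treeOrders 10).length = 1205 := by decide +kernel
  rw [h, ← h2, ← hord, List.length_map]

end ButcherTree

-- Row conditions of the constructed matrix.

namespace RK10

theorem sqrt_seven_pos_lt : 0 < √7 ∧ √7 < 7 / 2 :=
  ⟨Real.sqrt_pos.mpr (by norm_num), LobattoField.sqrt_seven_lt⟩

theorem w2_pos : 0 < w2 := by have := sqrt_seven_pos_lt; rw [w2]; linarith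
theorem w3_pos : 0 < w3 := by have := sqrt_seven_pos_lt; rw [w3]; linarith
theorem w4_pos : 0 < w4 := w3_pos
theorem w5_pos : 0 < w5 := w2_pos
theorem w6_pos : 0 < w6 := by rw [w6]; norm_num

theorem sum_fin_nine (f : Fin 9 → ℝ) :
    ∑ r, f r = f 0 + f 1 + f 2 + f 3 + f 4 + f 5 + f 6 + f 7 + f 8 := by
  rw [Fin.sum_univ_castSucc, Fin.sum_univ_eight]; rfl

theorem sum_fin_fifteen (f : Fin 15 → ℝ) :
    ∑ i, f i = f 0 + f 1 + f 2 + f 3 + f 4 + f 5 + ∑ r : Fin 9, f (Fin.natAdd 6 r) := by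
  have h := Fin.sum_univ_add (a := 6) (b := 9) f
  rw [Fin.sum_univ_six] at h
  exact h

namespace Params

variable (p : Params)

/-- The conditions of admissibility apart from the solvability of the two affine equations. -/
structure Regular : Prop where
  c2 : p.c2 ≠ 0
  b10 : p.b10 ≠ 0
  b12 : p.b12 ≠ 0
  b13 : p.b13 ≠ 0
  b14 : p.b14 ≠ 0
  c6den : p.c6den ≠ 0
  c4 : p.c4 ≠ 0
  c5 : p.c5 ≠ 0
  c6 : p.c6 ≠ 0
  c45 : p.c4 ≠ p.c5
  c46 : p.c4 ≠ p.c6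
  c56 : p.c5 ≠ p.c6

/-! The entries of the coefficient matrix. -/

theorem matrix_corner (y x : ℝ) (r : Fin 9) (k : Fin 8) :
    p.matrix y x (Fin.natAdd 6 r) (Fin.natAdd 6 k.castSucc) = p.corner x r k := by
  fin_cases r <;> fin_cases k <;> rfl

theorem matrix_middle (y x : ℝ) (r : Fin 9) :
    p.matrix y x (Fin.natAdd 6 r) 1 = 0 ∧ p.matrix y x (Fin.natAdd 6 r) 2 = p.middle x r 0 ∧
    p.matrix y x (Fin.natAdd 6 r) 3 = p.middle x r 1 ∧
    p.matrix y x (Fin.natAdd 6 r) 4 = p.middle x r 2 ∧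
    p.matrix y x (Fin.natAdd 6 r) 5 = p.middle x r 3 := by
  fin_cases r <;> exact ⟨rfl, rfl, rfl, rfl, rfl⟩

theorem core_col_zero (y x : ℝ) (i : Fin 15) : p.core y x i 0 = 0 := by
  fin_cases i <;> rfl

theorem matrix_eq_zero (y x : ℝ) {i j : Fin 15} (h : i ≤ j) : p.matrix y x i j = 0 := by
  by_cases hj : j = 0
  · subst hj
    obtain rfl : i = 0 := Fin.le_zero_iff.mp h
    rw [matrix, if_pos rfl, Finset.sum_eq_zero fun k _ => ?_]
    · exact sub_zero _
    · fin_cases k <;> rfl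
  · rw [matrix, if_neg hj]
    revert h hj
    fin_cases i <;> fin_cases j <;>
      first
      | exact fun _ _ => rfl
      | exact fun h => absurd h (by decide)

theorem rowSum (y x : ℝ) : (p.preMethod y x).RowSum := by
  intro i
  change ∑ j, p.matrix y x i j = p.nodes i
  rw [Fin.sum_univ_succ]
  have h : ∀ j : Fin 14, p.matrix y x i j.succ = p.core y x i j.succ := fun j =>
    if_neg (Fin.succ_ne_zero j)
  rw [Finset.sum_congr rfl fun j _ => h j, matrix, if_pos rfl, Fin.sum_univ_succ (p.core y x i),
    core_col_zero]
  ring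

theorem nodes_natAdd (r : Fin 9) : p.nodes (Fin.natAdd 6 r) = rowNode r := by
  fin_cases r <;> rfl

theorem rowNode_castSucc (k : Fin 8) : rowNode k.castSucc = colNode k := by
  fin_cases k <;> rfl

theorem matrix_zero (y x : ℝ) (j : Fin 15) : p.matrix y x 0 j = 0 :=
  p.matrix_eq_zero y x (Fin.zero_le j)

theorem sum_matrix_natAdd (y x : ℝ) (r : Fin 9) (v : Fin 15 → ℝ) :
    ∑ j, p.matrix y x (Fin.natAdd 6 r) j * v j = p.matrix y x (Fin.natAdd 6 r) 0 * v 0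
      + (p.middle x r 0 * v 2 + p.middle x r 1 * v 3 + p.middle x r 2 * v 4 + p.middle x r 3 * v 5)
      + ∑ k : Fin 8, p.corner x r k * v (Fin.natAdd 6 k.castSucc) := by
  obtain ⟨h1, h2, h3, h4, h5⟩ := p.matrix_middle y x r
  have hlast : p.matrix y x (Fin.natAdd 6 r) (Fin.natAdd 6 (Fin.last 8)) = 0 :=
    p.matrix_eq_zero y x (Fin.le_last _)
  rw [sum_fin_fifteen, h1, h2, h3, h4, h5, Fin.sum_univ_castSucc, hlast]
  simp only [matrix_corner]
  ring

theorem sum_early (y x : ℝ) (v : Fin 15 → ℝ) :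
    (∑ j, p.matrix y x 2 j * v j = p.matrix y x 2 0 * v 0 + p.a32 * v 1) ∧
    (∑ j, p.matrix y x 3 j * v j = p.matrix y x 3 0 * v 0 + p.a43 * v 2) ∧
    (∑ j, p.matrix y x 4 j * v j = p.matrix y x 4 0 * v 0 + p.a53 * v 2 + p.a54 * v 3) ∧
    (∑ j, p.matrix y x 5 j * v j
      = p.matrix y x 5 0 * v 0 + p.a63 y * v 2 + p.a64 y * v 3 + y * v 4) := by
  have h : ∀ i : Fin 15, i ≤ 5 → ∑ j, p.matrix y x i j * v j
      = p.matrix y x i 0 * v 0 + p.matrix y x i 1 * v 1 + p.matrix y x i 2 * v 2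
        + p.matrix y x i 3 * v 3 + p.matrix y x i 4 * v 4 := fun i hi => by
    rw [sum_fin_fifteen, Finset.sum_eq_zero fun r _ => ?_, p.matrix_eq_zero y x (j := 5) hi]
    · ring
    · rw [p.matrix_eq_zero, zero_mul]
      exact hi.trans (Fin.le_def.mpr (by simp; lia))
  have e21 : p.matrix y x 2 1 = p.a32 := rfl
  have e31 : p.matrix y x 3 1 = 0 := rfl
  have e32 : p.matrix y x 3 2 = p.a43 := rfl
  have e41 : p.matrix y x 4 1 = 0 := rfl
  have e42 : p.matrix y x 4 2 = p.a53 := rfl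
  have e43 : p.matrix y x 4 3 = p.a54 := rfl
  have e51 : p.matrix y x 5 1 = 0 := rfl
  have e52 : p.matrix y x 5 2 = p.a63 y := rfl
  have e53 : p.matrix y x 5 3 = p.a64 y := rfl
  have e54 : p.matrix y x 5 4 = y := rfl
  have z : ∀ i j : Fin 15, i ≤ j → p.matrix y x i j = 0 := fun i j => p.matrix_eq_zero y x
  refine ⟨?_, ?_, ?_, ?_⟩
  · rw [h 2 (by decide), e21, z 2 2 (by decide), z 2 3 (by decide), z 2 4 (by decide)]; ring
  · rw [h 3 (by decide), e31, e32, z 3 3 (by decide), z 3 4 (by decide)]; ring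
  · rw [h 4 (by decide), e41, e42, e43, z 4 4 (by decide)]; ring
  · rw [h 5 (by decide), e51, e52, e53, e54]; ring

/-- The stages that have full stage order. -/
def Good (i : Fin 15) : Prop := i = 0 ∨ ∃ r : Fin 9, i = Fin.natAdd 6 r

theorem not_good_cases {i : Fin 15} (h : ¬ Good i) : i = 1 ∨ i = 2 ∨ i = 3 ∨ i = 4 ∨ i = 5 := by
  by_contra! hi
  refine h ?_
  by_cases h0 : i = 0
  · exact Or.inl h0
  · refine Or.inr ⟨⟨i.val - 6, by lia⟩, Fin.ext ?_⟩
    rw [Fin.val_natAdd]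
    simp only [ne_eq, Fin.ext_iff] at hi h0
    simp at hi h0
    lia

theorem not_good (i : Fin 15) (h0 : i ≠ 0) (h : i ≤ 5) : ¬ Good i := by
  rintro (rfl | ⟨r, rfl⟩)
  · exact h0 rfl
  · rw [Fin.le_def, Fin.val_natAdd] at h
    simp at h
    lia

variable {p}

theorem Regular.c3 (hp : p.Regular) : p.c3 ≠ 0 := by
  rw [Params.c3]; exact mul_ne_zero (by norm_num) hp.c4

theorem Regular.a32 (hp : p.Regular) : p.a32 ≠ 0 := by
  rw [Params.a32]
  exact div_ne_zero (pow_ne_zero 2 hp.c3) (mul_ne_zero two_ne_zero hp.c2)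

/-- As `a₃₂` is the only non-zero entry of column 2, the first equation of the system forces `aᵢ₃ =
0`; the other three form a Vandermonde system in `c₄`, `c₅`, `c₆`. -/
theorem Regular.middle (hp : p.Regular) (x : ℝ) (r : Fin 9) :
    p.middle x r 0 = 0 ∧ ∀ m : ℕ, 1 ≤ m → m ≤ 3 →
      p.middle x r 1 * p.c4 ^ m + p.middle x r 2 * p.c5 ^ m + p.middle x r 3 * p.c6 ^ m
        = p.moment x m r := by
  have key := Matrix.mulVec_mulVec ![0, p.moment x 1 r, p.moment x 2 r, p.moment x 3 r]
    (!![p.a32, 0, 0, 0;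
      p.c3, p.c4, p.c5, p.c6;
      p.c3 ^ 2, p.c4 ^ 2, p.c5 ^ 2, p.c6 ^ 2;
      p.c3 ^ 3, p.c4 ^ 3, p.c5 ^ 3, p.c6 ^ 3] : Matrix (Fin 4) (Fin 4) ℝ)
    (!![p.a32, 0, 0, 0;
      p.c3, p.c4, p.c5, p.c6;
      p.c3 ^ 2, p.c4 ^ 2, p.c5 ^ 2, p.c6 ^ 2;
      p.c3 ^ 3, p.c4 ^ 3, p.c5 ^ 3, p.c6 ^ 3] : Matrix (Fin 4) (Fin 4) ℝ)⁻¹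
  rw [Matrix.mul_nonsing_inv, Matrix.one_mulVec] at key
  · change Matrix.mulVec _ (p.middle x r) = _ at key
    have e0 := congrFun key 0
    have e1 := congrFun key 1
    have e2 := congrFun key 2
    have e3 := congrFun key 3
    simp [Matrix.mulVec, dotProduct, Fin.sum_univ_four] at e0 e1 e2 e3
    have h0 : p.middle x r 0 = 0 := e0.resolve_left hp.a32
    rw [h0] at e1 e2 e3
    refine ⟨h0, fun m h1 h3 => ?_⟩
    interval_cases m
    · rw [← e1]; ring
    · rw [← e2]; ring
    · rw [← e3]; ring
  · rw [isUnit_iff_ne_zero, Matrix.det_succ_row_zero]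
    -- The determinant is `a₃₂` times the Vandermonde determinant of `c₄`, `c₅`, `c₆` with its
    -- columns scaled by the nodes.
    have hv : p.a32 * (p.c4 * p.c5 * p.c6 * (p.c5 - p.c4) * (p.c6 - p.c4) * (p.c6 - p.c5)) ≠ 0 := by
      have h1 := sub_ne_zero.mpr hp.c45.symm
      have h2 := sub_ne_zero.mpr hp.c46.symm
      have h3 := sub_ne_zero.mpr hp.c56.symm
      exact mul_ne_zero hp.a32 (mul_ne_zero (mul_ne_zero (mul_ne_zero (mul_ne_zero (mul_ne_zero
        hp.c4 hp.c5) hp.c6) h1) h2) h3)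
    convert hv using 1
    simp [Fin.sum_univ_four, Matrix.det_fin_three, Fin.succAbove]
    exact Or.inl (by ring)

theorem Regular.row_natAdd (hp : p.Regular) (y x : ℝ) (r : Fin 9) {m : ℕ} (h1 : 1 ≤ m)
    (h3 : m ≤ 3) : ∑ j, p.matrix y x (Fin.natAdd 6 r) j * p.nodes j ^ m
      = p.nodes (Fin.natAdd 6 r) ^ (m + 1) / ((m : ℝ) + 1) := by
  obtain ⟨h0, hm⟩ := hp.middle x r
  have n0 : p.nodes 0 = 0 := rfl
  have n3 : p.nodes 3 = p.c4 := rfl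
  have n4 : p.nodes 4 = p.c5 := rfl
  have n5 : p.nodes 5 = p.c6 := rfl
  rw [p.sum_matrix_natAdd y x r fun j => p.nodes j ^ m, h0, n0, n3, n4, n5, zero_pow (by lia),
    zero_mul, zero_add, hm m h1 h3, moment]
  simp only [nodes_natAdd, rowNode_castSucc]
  ring

theorem Regular.row_one (hp : p.Regular) (y x : ℝ) {i : Fin 15} (hi : i ≠ 1) :
    ∑ j, p.matrix y x i j * p.nodes j = p.nodes i ^ 2 / 2 := by
  have hc2 := hp.c2
  have hc4 := hp.c4
  have n0 : p.nodes 0 = 0 := rfl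
  have n1 : p.nodes 1 = p.c2 := rfl
  have n2 : p.nodes 2 = p.c3 := rfl
  have n3 : p.nodes 3 = p.c4 := rfl
  have n4 : p.nodes 4 = p.c5 := rfl
  have n5 : p.nodes 5 = p.c6 := rfl
  by_cases hg : Good i
  · obtain rfl | ⟨r, rfl⟩ := hg
    · simp [matrix_zero, n0]
    · have := hp.row_natAdd y x r le_rfl (by norm_num)
      simpa [one_add_one_eq_two] using this
  · obtain ⟨e2, e3, e4, e5⟩ := p.sum_early y x p.nodes
    obtain rfl | rfl | rfl | rfl | rfl := not_good_cases hg
    · exact absurd rfl hi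
    · rw [e2, n0, n1, n2, Params.a32]; field_simp; ring
    · rw [e3, n0, n2, n3, Params.a43, Params.c3]; field_simp; ring
    · rw [e4, n0, n2, n3, n4, Params.a53, Params.a54, Params.c3]; field_simp; ring
    · rw [e5, n0, n2, n3, n4, n5, Params.a63, Params.a64, Params.c3]; field_simp; ring

theorem Regular.row_two (hp : p.Regular) (y x : ℝ) {i : Fin 15} (h1 : i ≠ 1) (h2 : i ≠ 2) :
    ∑ j, p.matrix y x i j * p.nodes j ^ 2 = p.nodes i ^ 3 / 3 := by
  have hc2 := hp.c2
  have hc4 := hp.c4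
  have n0 : p.nodes 0 = 0 := rfl
  have n2 : p.nodes 2 = p.c3 := rfl
  have n3 : p.nodes 3 = p.c4 := rfl
  have n4 : p.nodes 4 = p.c5 := rfl
  have n5 : p.nodes 5 = p.c6 := rfl
  by_cases hg : Good i
  · obtain rfl | ⟨r, rfl⟩ := hg
    · simp [matrix_zero, n0]
    · rw [hp.row_natAdd y x r (by norm_num) (by norm_num)]; norm_num
  · obtain ⟨-, e3, e4, e5⟩ := p.sum_early y x fun j => p.nodes j ^ 2
    obtain rfl | rfl | rfl | rfl | rfl := not_good_cases hg
    · exact absurd rfl h1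
    · exact absurd rfl h2
    · rw [e3, n0, n2, n3, Params.a43, Params.c3]; field_simp; ring
    · rw [e4, n0, n2, n3, n4, Params.a53, Params.a54, Params.c3]; field_simp; ring
    · rw [e5, n0, n2, n3, n4, n5, Params.a63, Params.a64, Params.c3]; field_simp; ring

theorem Regular.row_three (hp : p.Regular) (y x : ℝ) {i : Fin 15} (hi : Good i) :
    ∑ j, p.matrix y x i j * p.nodes j ^ 3 = p.nodes i ^ 4 / 4 := by
  obtain rfl | ⟨r, rfl⟩ := hi
  · simp [matrix_zero, show p.nodes 0 = 0 from rfl]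
  · rw [hp.row_natAdd y x r (by norm_num) le_rfl]; norm_num

theorem col_one (y x : ℝ) {i : Fin 15} (hi : i ≠ 2) : p.matrix y x i 1 = 0 := by
  fin_cases i <;> first | rfl | exact absurd rfl hi

theorem Regular.col_two (hp : p.Regular) (y x : ℝ) {i : Fin 15} (hi : Good i) :
    p.matrix y x i 2 = 0 := by
  obtain rfl | ⟨r, rfl⟩ := hi
  · exact matrix_zero p y x 2
  · rw [(p.matrix_middle y x r).2.1, (hp.middle x r).1]

/-- A row vector with vanishing moments is determined by its entries from the seventh stage on. -/
theorem Regular.eq_zero_of_moments (hp : p.Regular) {g : Fin 15 → ℝ} (h1 : g 1 = 0) (h2 : g 2 = 0)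
    (hm : ∀ m : ℕ, m ≤ 3 → ∑ i, g i * p.nodes i ^ m = 0)
    (hg : ∀ r : Fin 9, g (Fin.natAdd 6 r) = 0) :
    g = 0 := by
  have n0 : p.nodes 0 = 0 := rfl
  have n3 : p.nodes 3 = p.c4 := rfl
  have n4 : p.nodes 4 = p.c5 := rfl
  have n5 : p.nodes 5 = p.c6 := rfl
  have e : ∀ m : ℕ, m ≤ 3 →
      g 0 * 0 ^ m + g 3 * p.c4 ^ m + g 4 * p.c5 ^ m + g 5 * p.c6 ^ m = 0 := fun m h => by
    have := hm m h
    rw [sum_fin_fifteen, Finset.sum_eq_zero (fun r _ => by rw [hg r, zero_mul]), h1, h2, n0, n3, n4,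
      n5] at this
    linarith
  have e0 := e 0 (by norm_num)
  have e1 := e 1 (by norm_num)
  have e2 := e 2 (by norm_num)
  have e3 := e 3 (by norm_num)
  have h45 := sub_ne_zero.mpr hp.c45
  have h46 := sub_ne_zero.mpr hp.c46
  have h56 := sub_ne_zero.mpr hp.c56
  have g3 : g 3 = 0 := by
    refine (mul_eq_zero.mp (?_ : g 3 * (p.c4 * (p.c4 - p.c5) * (p.c4 - p.c6)) = 0)).resolve_right
      (mul_ne_zero (mul_ne_zero hp.c4 h45) h46)
    -- The coefficients are those of `t(t - c₅)(t - c₆)`, which vanishes at the other three nodes;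
    -- the next two entries are treated likewise.
    linear_combination e3 - (p.c5 + p.c6) * e2 + p.c5 * p.c6 * e1
  have g4 : g 4 = 0 := by
    refine (mul_eq_zero.mp (?_ : g 4 * (p.c5 * (p.c4 - p.c5) * (p.c5 - p.c6)) = 0)).resolve_right
      (mul_ne_zero (mul_ne_zero hp.c5 h45) h56)
    linear_combination -e3 + (p.c4 + p.c6) * e2 - p.c4 * p.c6 * e1
  have g5 : g 5 = 0 := by
    refine (mul_eq_zero.mp (?_ : g 5 * (p.c6 * (p.c4 - p.c6) * (p.c5 - p.c6)) = 0)).resolve_right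
      (mul_ne_zero (mul_ne_zero hp.c6 h46) h56)
    linear_combination e3 - (p.c4 + p.c5) * e2 + p.c4 * p.c5 * e1
  have g0 : g 0 = 0 := by
    rw [g3, g4, g5] at e0
    linarith
  ext i
  by_cases hi : Good i
  · obtain rfl | ⟨r, rfl⟩ := hi
    · exact g0
    · exact hg r
  · obtain rfl | rfl | rfl | rfl | rfl := not_good_cases hi <;> assumption

end Params

end RK10

-- Row vectors on the pairs of stages, in a form free of the weights.

namespace RK10

namespace Params

open Matrix

variable (p : Params)

/-- The row vector that is supported on the pairs of stages with the same interior node, has zero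
sum over each pair, and has the entries `k`, times the weights, at the second stages. -/
noncomputable def pairVec (k : Fin 4 → ℝ) : Fin 15 → ℝ :=
  ![0, 0, 0, 0, 0, 0, -(p.b13 * k 2), -(p.b14 * k 3), -(p.b10 * k 0), p.b10 * k 0, -(p.b12 * k 1),
    p.b12 * k 1, p.b13 * k 2, p.b14 * k 3, 0]

/-- The row vector with given sums over the stages with the same interior node, supported on the
first of these stages. -/
noncomputable def sumVec (x : ℝ) (v : Fin 5 → ℝ) : Fin 15 → ℝ :=
  ![0, 0, 0, 0, 0, 0, v 2 + v 4 * x, v 3, v 0, 0, v 1, 0, 0, 0, 0]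

/-- The effect of multiplication by the coefficient matrix on `pairVec`. -/
noncomputable def shift (k : Fin 4 → ℝ) : Fin 4 → ℝ :=
  ![k 1 * A12_10 + k 2 * A13_10 + k 3 * A14_10, k 2 * A13_12 + k 3 * A14_12, k 3 * A14_13, 0]

/-- The sums over the stages with the same node after such a multiplication. -/
noncomputable def shiftSum (k : Fin 4 → ℝ) : Fin 5 → ℝ :=
  ![w2 * (k 0 * al22 + k 1 * al32 + k 2 * al42 + k 3 * al52),
    w3 * (k 1 * al33 + k 2 * al43 + k 3 * al53),
    w4 * (k 0 * al24 + k 1 * al34 + k 2 * al44 + k 3 * al54),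
    w5 * (k 0 * al25 + k 1 * al35 + k 2 * al45 + k 3 * al55),
    w4 * (k 0 * u2 + k 1 * u3 + k 2 * u4 + k 3 * u5)]

/-- Coordinatewise real values. -/
noncomputable def value {n : ℕ} (k : Fin n → LobattoField) : Fin n → ℝ := fun i => k i

theorem value_shift (k : Fin 4 → LobattoField) :
    value (LobattoField.shift k) = shift (value k) := by
  ext i
  fin_cases i <;> simp [value, shift, LobattoField.shift] <;> push_cast <;> rfl

theorem value_shiftSum (k : Fin 4 → LobattoField) :
    value (LobattoField.shiftSum k) = shiftSum (value k) := by
  ext i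
  fin_cases i <;> simp [value, shiftSum, LobattoField.shiftSum] <;> push_cast <;> rfl

theorem vecMul_natAdd (y x : ℝ) {u : Fin 15 → ℝ} (hu : ∀ i, ¬ Good i → u i = 0) (k : Fin 8) :
    (u ᵥ* p.matrix y x) (Fin.natAdd 6 k.castSucc)
      = ∑ r : Fin 9, u (Fin.natAdd 6 r) * p.corner x r k := by
  change ∑ i, u i * p.matrix y x i _ = _
  rw [sum_fin_fifteen, matrix_zero, hu 1 (not_good 1 (by decide) (by decide)),
    hu 2 (not_good 2 (by decide) (by decide)), hu 3 (not_good 3 (by decide) (by decide)),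
    hu 4 (not_good 4 (by decide) (by decide)), hu 5 (not_good 5 (by decide) (by decide))]
  simp only [matrix_corner]
  ring

theorem vecMul_last (y x : ℝ) (u : Fin 15 → ℝ) : (u ᵥ* p.matrix y x) 14 = 0 := by
  change ∑ i, u i * p.matrix y x i 14 = 0
  exact Finset.sum_eq_zero fun i _ => by
    rw [p.matrix_eq_zero y x (j := 14) (Fin.le_last i), mul_zero]

variable {p}

/-- A pair vector sees only the differences of the two rows of each pair. Their entries at second
stages, and their sums over column pairs, are fixed constants (linear in `a₈₇`) divided by the
weight of the second row and, at a second stage, multiplied by the weight of that column. The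
weights in `pairVec` cancel these factors. -/
theorem Regular.vecMul_pairVec (hp : p.Regular) (y x : ℝ) (k : Fin 4 → ℝ) (r : Fin 9) :
    (p.pairVec k ᵥ* p.matrix y x) (Fin.natAdd 6 r)
      = (p.pairVec (shift k) + sumVec x (shiftSum k)) (Fin.natAdd 6 r) := by
  have h1 := hp.b10
  have h2 := hp.b12
  have h3 := hp.b13
  have h4 := hp.b14
  have h5 := w3_pos.ne'
  induction r using Fin.lastCases with
  | last => exact (p.vecMul_last y x _).trans (by simp [pairVec, sumVec])
  | cast r =>
    rw [vecMul_natAdd]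
    · rw [sum_fin_nine]
      fin_cases r <;> simp [pairVec, sumVec, shift, shiftSum, corner] <;> field_simp <;> ring
    · intro i hi
      obtain rfl | rfl | rfl | rfl | rfl := not_good_cases hi <;> rfl

theorem weights_eq_zero {i : Fin 15} (hi : ¬ Good i) : p.weights i = 0 := by
  obtain rfl | rfl | rfl | rfl | rfl := not_good_cases hi <;> rfl

theorem coe_tailMoment (t : LobattoField) (n : ℕ) :
    (LobattoField.tailMoment t n : ℝ) = (1 - (t : ℝ) ^ (n + 1)) / ((n : ℝ) + 1) := by
  rw [LobattoField.tailMoment]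
  push_cast
  ring

theorem value_second (n : ℕ) : value (LobattoField.second n) =
    ![theta3 ^ n * (A11_10 + A12_10) + theta4 ^ n * A13_10 + theta5 ^ n * A14_10 + A15_10
        - (1 - theta2 ^ (n + 1)) / ((n : ℝ) + 1),
      theta4 ^ n * A13_12 + theta5 ^ n * A14_12 + A15_12 - (1 - theta3 ^ (n + 1)) / ((n : ℝ) + 1),
      theta5 ^ n * A14_13 + A15_13 - (1 - theta4 ^ (n + 1)) / ((n : ℝ) + 1),
      A15_14 - (1 - theta5 ^ (n + 1)) / ((n : ℝ) + 1)] := by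
  ext i
  fin_cases i <;> simp [value, LobattoField.second] <;> push_cast [coe_tailMoment] <;> rfl

theorem value_nodeSum (n : ℕ) : value (LobattoField.nodeSum n) =
    ![w3 * theta3 ^ n * al32P + w2 * (theta2 ^ n * al22 + theta3 ^ n * al32 + theta4 ^ n * al42
        + theta5 ^ n * al52 + al62 - (1 - theta2 ^ (n + 1)) / ((n : ℝ) + 1)),
      w3 * (theta3 ^ n * al33 + theta4 ^ n * al43 + theta5 ^ n * al53 + al63
        - (1 - theta3 ^ (n + 1)) / ((n : ℝ) + 1)),
      w2 * theta2 ^ n * al24P + w3 * theta3 ^ n * al34P + w4 * (theta2 ^ n * al24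
        + theta3 ^ n * al34 + theta4 ^ n * al44 + theta5 ^ n * al54 + al64
        - (1 - theta4 ^ (n + 1)) / ((n : ℝ) + 1)),
      w2 * theta2 ^ n * a98 + w3 * theta3 ^ n * a11_8 + w5 * (theta2 ^ n * al25 + theta3 ^ n * al35
        + theta4 ^ n * al45 + theta5 ^ n * al55 + al65 - (1 - theta5 ^ (n + 1)) / ((n : ℝ) + 1)),
      w5 * theta5 ^ n + w2 * theta2 ^ n * u2P + w3 * theta3 ^ n * u3P + w4 * (theta2 ^ n * u2
        + theta3 ^ n * u3 + theta4 ^ n * u4 + theta5 ^ n * u5 + u6)] := by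
  ext i
  fin_cases i <;> simp [value, LobattoField.nodeSum] <;> push_cast [coe_tailMoment] <;> rfl

/-- Each vector on the late stages splits into a pair vector, given by its entries at the second
stages, and the sums over the pairs, placed at the first stages. For `dₙ` both parts are independent
of the parameters, apart from the normalising weights and `a₈₇`. -/
theorem Regular.d_natAdd (hp : p.Regular) (y x : ℝ) (n : ℕ) (r : Fin 9) :
    (p.preMethod y x).d n (Fin.natAdd 6 r) = (p.pairVec (value (LobattoField.second n))
      + sumVec x (value (LobattoField.nodeSum n))) (Fin.natAdd 6 r) := by
  have h1 := hp.b10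
  have h2 := hp.b12
  have h3 := hp.b13
  have h4 := hp.b14
  have h5 := w3_pos.ne'
  have h6 := w6_pos.ne'
  have h7 : (n : ℝ) + 1 ≠ 0 := by positivity
  change ((fun i => p.weights i * p.nodes i ^ n) ᵥ* p.matrix y x) (Fin.natAdd 6 r)
    - p.weights (Fin.natAdd 6 r) * (1 - p.nodes (Fin.natAdd 6 r) ^ (n + 1)) / ((n : ℝ) + 1) = _
  rw [value_second, value_nodeSum]
  induction r using Fin.lastCases with
  | last =>
    rw [show Fin.natAdd 6 (Fin.last 8) = (14 : Fin 15) from rfl, vecMul_last]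
    simp [pairVec, sumVec, nodes]
  | cast r =>
    rw [vecMul_natAdd _ _ _ fun i hi => by rw [weights_eq_zero hi, zero_mul], sum_fin_nine]
    fin_cases r <;> simp [pairVec, sumVec, corner, weights, nodes] <;> field_simp <;> ring

end Params

end RK10

-- The flag of row vectors and the verification of the criterion.

namespace RK10

namespace Params

open Matrix

variable {p : Params}

theorem pairVec_eq_zero (k : Fin 4 → ℝ) {i : Fin 15} (hi : ¬ Good i) : p.pairVec k i = 0 := by
  obtain rfl | rfl | rfl | rfl | rfl := not_good_cases hi <;> rfl

theorem sum_pairVec_pow (k : Fin 4 → ℝ) (m : ℕ) : ∑ i, p.pairVec k i * p.nodes i ^ m = 0 := by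
  rw [sum_fin_fifteen, sum_fin_nine]
  simp [pairVec, nodes]

theorem pairVec_add (k l : Fin 4 → ℝ) : p.pairVec (k + l) = p.pairVec k + p.pairVec l := by
  ext i
  fin_cases i <;> simp [pairVec] <;> ring

theorem pairVec_smul (a : ℝ) (k : Fin 4 → ℝ) : p.pairVec (a • k) = a • p.pairVec k := by
  ext i
  fin_cases i <;> simp [pairVec] <;> ring

theorem pairVec_zero : p.pairVec 0 = 0 := by
  ext i
  fin_cases i <;> simp [pairVec]

theorem pairVec_mul_nodes (k : Fin 4 → ℝ) :
    p.pairVec k * p.nodes = p.pairVec (value LobattoField.nodes * k) := by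
  ext i
  fin_cases i <;> simp [pairVec, nodes, value, LobattoField.nodes] <;> push_cast <;> ring

theorem sumVec_zero (x : ℝ) : sumVec x 0 = 0 := by
  ext i
  fin_cases i <;> simp [sumVec]

theorem sumVec_smul (a x : ℝ) (v : Fin 5 → ℝ) : sumVec x (a • v) = a • sumVec x v := by
  ext i
  fin_cases i <;> simp [sumVec]
  ring

theorem weights_quadrature {m : ℕ} (hm : m ≤ 9) :
    ∑ i, p.weights i * p.nodes i ^ m = 1 / ((m : ℝ) + 1) := by
  rw [sum_fin_fifteen, sum_fin_nine]
  obtain _ | m := m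
  · have h := LobattoField.lobatto_sum.coe_eq
    push_cast at h
    simp [weights, nodes]
    linear_combination h
  · have h := (LobattoField.lobatto_quadrature m (by lia)).coe_eq
    push_cast at h
    simp [weights, nodes]
    linear_combination h

/-- The row vectors that are determined by their entries from the seventh stage on. -/
structure MomentFree (p : Params) (g : Fin 15 → ℝ) : Prop where
  one : g 1 = 0
  two : g 2 = 0
  moment : ∀ m : ℕ, m ≤ 3 → ∑ i, g i * p.nodes i ^ m = 0

theorem MomentFree.add {f g : Fin 15 → ℝ} (hf : p.MomentFree f) (hg : p.MomentFree g) :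
    p.MomentFree (f + g) where
  one := by simp [hf.one, hg.one]
  two := by simp [hf.two, hg.two]
  moment m hm := by simp [add_mul, Finset.sum_add_distrib, hf.moment m hm, hg.moment m hm]

theorem MomentFree.smul {f : Fin 15 → ℝ} (a : ℝ) (hf : p.MomentFree f) :
    p.MomentFree (a • f) where
  one := by simp [hf.one]
  two := by simp [hf.two]
  moment m hm := by simp [mul_assoc, ← Finset.mul_sum, hf.moment m hm]

/-- This reduces identities between the full row vectors to their late entries, where all constants
are explicit. -/
theorem Regular.eq_of_momentFree (hp : p.Regular) {f g : Fin 15 → ℝ} (hf : p.MomentFree f)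
    (hg : p.MomentFree g) (h : ∀ r : Fin 9, f (Fin.natAdd 6 r) = g (Fin.natAdd 6 r)) : f = g := by
  have H := hf.add (hg.smul (-1))
  have := hp.eq_zero_of_moments H.one H.two H.moment fun r => by simp [h r]
  rw [neg_one_smul, ← sub_eq_add_neg] at this
  exact sub_eq_zero.mp this

theorem momentFree_pairVec (k : Fin 4 → ℝ) : p.MomentFree (p.pairVec k) :=
  ⟨rfl, rfl, fun m _ => sum_pairVec_pow k m⟩

theorem Regular.sum_vecMul_pow (hp : p.Regular) (y x : ℝ) {f : Fin 15 → ℝ}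
    (hf : ∀ i, ¬ Good i → f i = 0) {m : ℕ} (hm : m ≤ 3) :
    ∑ j, (f ᵥ* p.matrix y x) j * p.nodes j ^ m
      = (∑ i, f i * p.nodes i ^ (m + 1)) / ((m : ℝ) + 1) := by
  have e : ∑ j, (f ᵥ* p.matrix y x) j * p.nodes j ^ m
      = ∑ i, f i * (p.matrix y x *ᵥ fun j => p.nodes j ^ m) i :=
    (dotProduct_mulVec f (p.matrix y x) fun j => p.nodes j ^ m).symm
  rw [e, Finset.sum_div]
  refine Finset.sum_congr rfl fun i _ => ?_
  by_cases hi : Good i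
  · have h : ∑ j, p.matrix y x i j * p.nodes j ^ m = p.nodes i ^ (m + 1) / ((m : ℝ) + 1) := by
      obtain _ | m := m
      · have := p.rowSum y x i
        change ∑ j, p.matrix y x i j = p.nodes i at this
        simpa using this
      · obtain rfl | ⟨r, rfl⟩ := hi
        · simp [matrix_zero, show p.nodes 0 = 0 from rfl]
        · exact hp.row_natAdd y x r (by lia) hm
    rw [mul_div_assoc, ← h]
    rfl
  · rw [hf i hi, zero_mul, zero_mul, zero_div]

theorem Regular.momentFree_vecMul (hp : p.Regular) (y x : ℝ) {f : Fin 15 → ℝ}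
    (hf : ∀ i, ¬ Good i → f i = 0) (hm : ∀ m : ℕ, m ≤ 4 → ∑ i, f i * p.nodes i ^ m = 0) :
    p.MomentFree (f ᵥ* p.matrix y x) where
  one := by
    refine Finset.sum_eq_zero (s := Finset.univ) (f := fun i => f i * p.matrix y x i 1)
      fun i _ => ?_
    by_cases hi : i = 2
    · rw [hf i (hi ▸ not_good 2 (by decide) (by decide)), zero_mul]
    · rw [col_one y x hi, mul_zero]
  two := by
    refine Finset.sum_eq_zero (s := Finset.univ) (f := fun i => f i * p.matrix y x i 2)
      fun i _ => ?_
    by_cases hi : Good i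
    · rw [hp.col_two y x hi, mul_zero]
    · rw [hf i hi, zero_mul]
  moment m h := by rw [hp.sum_vecMul_pow y x hf h, hm _ (by lia), zero_div]

/-- The row conditions turn the moments of `dₙ` into quadrature sums of degree at most `n + m + 1 ≤
8`. These are exact, and `1/((m+1)(n+m+2))` cancels `(1/(m+1) - 1/(n+m+2))/(n+1)`. -/
theorem Regular.momentFree_d (hp : p.Regular) (y x : ℝ) {n : ℕ} (hn : n ≤ 4) :
    p.MomentFree ((p.preMethod y x).d n) := by
  have hf : ∀ i, ¬ Good i → p.weights i * p.nodes i ^ n = 0 := fun i hi => by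
    rw [weights_eq_zero hi, zero_mul]
  have hd : ∀ j, (p.preMethod y x).d n j
      = ((fun i => p.weights i * p.nodes i ^ n) ᵥ* p.matrix y x) j
        - p.weights j * (1 - p.nodes j ^ (n + 1)) / ((n : ℝ) + 1) := fun j => rfl
  refine ⟨?_, ?_, fun m hm => ?_⟩
  · rw [hd, show p.weights 1 = 0 from rfl, zero_mul, zero_div, sub_zero]
    refine Finset.sum_eq_zero (s := Finset.univ)
      (f := fun i => p.weights i * p.nodes i ^ n * p.matrix y x i 1) fun i _ => ?_
    by_cases hi : i = 2
    · rw [hf i (hi ▸ not_good 2 (by decide) (by decide)), zero_mul]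
    · rw [col_one y x hi, mul_zero]
  · rw [hd, show p.weights 2 = 0 from rfl, zero_mul, zero_div, sub_zero]
    refine Finset.sum_eq_zero (s := Finset.univ)
      (f := fun i => p.weights i * p.nodes i ^ n * p.matrix y x i 2) fun i _ => ?_
    by_cases hi : Good i
    · rw [hp.col_two y x hi, mul_zero]
    · rw [hf i hi, zero_mul]
  · have e : ∀ j, (p.preMethod y x).d n j * p.nodes j ^ m
        = ((fun i => p.weights i * p.nodes i ^ n) ᵥ* p.matrix y x) j * p.nodes j ^ m
          - (p.weights j * p.nodes j ^ m - p.weights j * p.nodes j ^ (n + 1 + m))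
            / ((n : ℝ) + 1) := fun j => by rw [hd]; ring
    have e2 : ∀ i, p.weights i * p.nodes i ^ n * p.nodes i ^ (m + 1)
        = p.weights i * p.nodes i ^ (n + (m + 1)) := fun i => by ring
    rw [Finset.sum_congr rfl fun j _ => e j, Finset.sum_sub_distrib, hp.sum_vecMul_pow y x hf hm,
      Finset.sum_congr rfl fun i _ => e2 i, ← Finset.sum_div, Finset.sum_sub_distrib,
      weights_quadrature (by lia), weights_quadrature (by lia), weights_quadrature (by lia)]
    have h1 : (n : ℝ) + 1 ≠ 0 := by positivity
    have h2 : (m : ℝ) + 1 ≠ 0 := by positivity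
    have h3 : (n : ℝ) + 1 + m + 1 ≠ 0 := by positivity
    push_cast
    rw [show (n : ℝ) + (m + 1) + 1 = n + 1 + m + 1 by ring]
    field_simp
    ring

theorem value_eq {n : ℕ} {k l : Fin n → LobattoField}
    (h : ∀ i, LobattoField.SameValue (k i) (l i)) :
    value k = value l := funext fun i => (h i).coe_eq

theorem value_eq_zero {n : ℕ} {k : Fin n → LobattoField}
    (h : ∀ i, LobattoField.SameValue (k i) ((0 : ℤ) : LobattoField)) : value k = 0 :=
  funext fun i => (h i).coe_eq.trans (by push_cast; rfl)

theorem Regular.d_eq_pairVec (hp : p.Regular) (y x : ℝ) {n : ℕ} (hn : n < 4) :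
    (p.preMethod y x).d n = p.pairVec (value (LobattoField.second n)) :=
  hp.eq_of_momentFree (hp.momentFree_d y x (by lia)) (momentFree_pairVec _) fun r => by
    rw [hp.d_natAdd, value_eq_zero (LobattoField.nodeSum_eq_zero n hn), sumVec_zero, add_zero]

/-- The real vectors `d₁`, `d₁ A` and `d₁ A²` at the second stages of the pairs. -/
noncomputable def chain1 : Fin 4 → ℝ := value LobattoField.chain1

noncomputable def chain2 : Fin 4 → ℝ := value LobattoField.chain2

noncomputable def chain3 : Fin 4 → ℝ := value LobattoField.chain3

theorem shift_chain1 : shift chain1 = chain2 :=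
  (value_shift _).symm.trans (value_eq LobattoField.shift_chain1)

theorem shift_chain2 : shift chain2 = chain3 :=
  (value_shift _).symm.trans (value_eq LobattoField.shift_chain2)

theorem shiftSum_chain1 : shiftSum chain1 = 0 :=
  (value_shiftSum _).symm.trans (value_eq_zero LobattoField.shiftSum_chain1)

theorem shiftSum_chain2 : shiftSum chain2 = 0 :=
  (value_shiftSum _).symm.trans (value_eq_zero LobattoField.shiftSum_chain2)

theorem shiftSum_chain3 :
    shiftSum chain3 = (LobattoField.ratio : ℝ) • value (LobattoField.nodeSum 4) := by
  rw [chain3, ← value_shiftSum, value_eq LobattoField.shiftSum_chain3,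
    value_eq LobattoField.nodeSum_four]
  ext i
  exact LobattoField.coe_mul _ _

theorem value_add (k l : Fin 4 → LobattoField) :
    (value fun i => k i + l i) = value k + value l :=
  funext fun _ => LobattoField.coe_add _ _

theorem value_mul (k l : Fin 4 → LobattoField) :
    (value fun i => k i * l i) = value k * value l :=
  funext fun _ => LobattoField.coe_mul _ _

theorem value_smul (a : LobattoField) (k : Fin 4 → LobattoField) :
    (value fun i => a * k i) = (a : ℝ) • value k :=
  funext fun _ => LobattoField.coe_mul _ _

theorem exists_nodes_mul_chain1 :
    ∃ a b : ℝ, value LobattoField.nodes * chain1 = a • chain1 + b • chain2 := by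
  have h := value_eq LobattoField.nodes_mul_chain1
  rw [value_mul, value_add, value_smul, value_smul] at h
  exact ⟨_, _, h⟩

theorem exists_nodes_mul_chain2 :
    ∃ a : ℝ, value LobattoField.nodes * chain2 = a • chain2 + chain3 := by
  have h := value_eq LobattoField.nodes_mul_chain2
  rw [value_mul, value_add, value_smul] at h
  exact ⟨_, h⟩

theorem exists_second_two :
    ∃ a b : ℝ, value (LobattoField.second 2) = a • chain1 + b • chain2 := by
  have h := value_eq LobattoField.second_two
  rw [value_add, value_smul, value_smul] at h
  exact ⟨_, _, h⟩

theorem exists_second_three :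
    ∃ a b c : ℝ, value (LobattoField.second 3) = a • chain1 + b • chain2 + c • chain3 := by
  have h := value_eq LobattoField.second_three
  rw [value_add, value_add, value_smul, value_smul, value_smul] at h
  exact ⟨_, _, _, h⟩

theorem Regular.pairVec_vecMul (hp : p.Regular) (y x : ℝ) {k : Fin 4 → ℝ} (hk : shiftSum k = 0) :
    p.pairVec k ᵥ* p.matrix y x = p.pairVec (shift k) :=
  hp.eq_of_momentFree (hp.momentFree_vecMul y x (fun _ => pairVec_eq_zero k)
    fun m _ => sum_pairVec_pow k m) (momentFree_pairVec _) fun r => by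
      rw [hp.vecMul_pairVec, hk, sumVec_zero, add_zero]

/-- The node sums of `d₁A³` are `ratio` times those of `d₄`, so subtracting that multiple of `d₄`
leaves a vector with zero pair sums. The remainder `k` needs no further property, since level 0 of
the flag contains all pair vectors. -/
theorem Regular.pairVec_chain3_vecMul (hp : p.Regular) (y x : ℝ) :
    ∃ (a : ℝ) (k : Fin 4 → ℝ),
      p.pairVec chain3 ᵥ* p.matrix y x = a • (p.preMethod y x).d 4 + p.pairVec k := by
  refine ⟨LobattoField.ratio,
    shift chain3 + (-(LobattoField.ratio : ℝ)) • value (LobattoField.second 4),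
    hp.eq_of_momentFree (hp.momentFree_vecMul y x (fun _ => pairVec_eq_zero _)
    fun m _ => sum_pairVec_pow _ m) (((hp.momentFree_d y x le_rfl).smul _).add
    (momentFree_pairVec _)) fun r => ?_⟩
  rw [hp.vecMul_pairVec, shiftSum_chain3, Pi.add_apply, Pi.add_apply, Pi.smul_apply, hp.d_natAdd,
    pairVec_add, pairVec_smul, sumVec_smul]
  simp only [Pi.add_apply, Pi.smul_apply, smul_eq_mul]
  ring

/-- The row vectors that annihilate the weights of the trees with few vertices. -/
def annihilators (p : Params) (y x : ℝ) : ℕ → Set (Fin 15 → ℝ)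
  | 0 => {f | ∃ (a : ℝ) (k : Fin 4 → ℝ), f = a • (p.preMethod y x).d 4 + p.pairVec k}
  | 1 => {f | ∃ a b c : ℝ, f = p.pairVec (a • chain1 + b • chain2 + c • chain3)}
  | 2 => {f | ∃ a b : ℝ, f = p.pairVec (a • chain1 + b • chain2)}
  | 3 => {f | ∃ a : ℝ, f = p.pairVec (a • chain1)}
  -- The vector `d₁` sits at level 3 and no higher level is needed; the empty set makes the closure
  -- conditions there vacuous.
  | _ => ∅

theorem exists_pairVec_of_mem {y x : ℝ} {j : ℕ} {f : Fin 15 → ℝ}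
    (hf : f ∈ p.annihilators y x (j + 1)) : ∃ k, f = p.pairVec k := by
  match j, hf with
  | 0, ⟨_, _, _, h⟩ => exact ⟨_, h⟩
  | 1, ⟨_, _, h⟩ => exact ⟨_, h⟩
  | 2, ⟨_, h⟩ => exact ⟨_, h⟩

theorem annihilators_mul_nodes {y x : ℝ} {j : ℕ} {f : Fin 15 → ℝ}
    (hf : f ∈ p.annihilators y x (j + 1)) : f * p.nodes ∈ p.annihilators y x j := by
  obtain ⟨a1, b1, h1⟩ := exists_nodes_mul_chain1
  obtain ⟨a2, h2⟩ := exists_nodes_mul_chain2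
  match j, hf with
  | 0, ⟨a, b, c, h⟩ => exact ⟨0, _, by rw [h, pairVec_mul_nodes, zero_smul, zero_add]⟩
  | 1, ⟨a, b, h⟩ =>
    refine ⟨a * a1, a * b1 + b * a2, b, ?_⟩
    rw [h, pairVec_mul_nodes, mul_add, mul_smul_comm, mul_smul_comm, h1, h2]
    congr 1
    module
  | 2, ⟨a, h⟩ =>
    refine ⟨a * a1, a * b1, ?_⟩
    rw [h, pairVec_mul_nodes, mul_smul_comm, h1]
    congr 1
    module

theorem Regular.annihilators_vecMul (hp : p.Regular) {y x : ℝ} {j : ℕ} {f : Fin 15 → ℝ}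
    (hf : f ∈ p.annihilators y x (j + 1)) : f ᵥ* p.matrix y x ∈ p.annihilators y x j := by
  have h1 : p.pairVec chain1 ᵥ* p.matrix y x = p.pairVec chain2 := by
    rw [hp.pairVec_vecMul y x shiftSum_chain1, shift_chain1]
  have h2 : p.pairVec chain2 ᵥ* p.matrix y x = p.pairVec chain3 := by
    rw [hp.pairVec_vecMul y x shiftSum_chain2, shift_chain2]
  match j, hf with
  | 0, ⟨a, b, c, h⟩ =>
    obtain ⟨l, k, h3⟩ := hp.pairVec_chain3_vecMul y x
    refine ⟨c * l, a • chain2 + b • chain3 + c • k, ?_⟩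
    rw [h]
    simp only [pairVec_add, pairVec_smul, add_vecMul, smul_vecMul, h1, h2, h3]
    module
  | 1, ⟨a, b, h⟩ =>
    refine ⟨0, a, b, ?_⟩
    rw [h]
    simp only [pairVec_add, pairVec_smul, add_vecMul, smul_vecMul, h1, h2]
    module
  | 2, ⟨a, h⟩ =>
    refine ⟨0, a, ?_⟩
    rw [h]
    simp only [pairVec_add, pairVec_smul, smul_vecMul, h1]
    module

theorem Regular.d_mem_annihilators (hp : p.Regular) (y x : ℝ) (j k : ℕ) (h : j + (k + 1) = 4) :
    (p.preMethod y x).d (k + 1) ∈ p.annihilators y x j := by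
  have hk : k ≤ 3 := by lia
  obtain rfl : j = 3 - k := by lia
  interval_cases k
  · exact ⟨1, by rw [hp.d_eq_pairVec y x (by norm_num), one_smul, chain1,
      value_eq LobattoField.second_one]⟩
  · obtain ⟨a, b, h2⟩ := exists_second_two
    exact ⟨a, b, by rw [hp.d_eq_pairVec y x (by norm_num), h2]⟩
  · obtain ⟨a, b, c, h3⟩ := exists_second_three
    exact ⟨a, b, c, by rw [hp.d_eq_pairVec y x (by norm_num), h3]⟩
  · exact ⟨1, 0, by rw [one_smul, pairVec_zero, add_zero]⟩

/-- The method has order ten as soon as the vector `d₄` satisfies three equations. -/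
theorem Regular.tenCriterion (hp : p.Regular) {y x : ℝ}
    (h4 : ∑ i, (p.preMethod y x).d 4 i * p.nodes i ^ 4 = 0)
    (hcol : ((p.preMethod y x).d 4 ᵥ* p.matrix y x) 2 = 0)
    (hcube : ∑ i, ((p.preMethod y x).d 4 ᵥ* p.matrix y x) i * p.nodes i ^ 3 = 0) :
    (p.preMethod y x).TenCriterion 1 2 Good (p.annihilators y x) where
  rowSum := p.rowSum y x
  row_one i hi := hp.row_one y x hi
  row_two i h1 h2 := hp.row_two y x h1 h2
  row_three i hi := hp.row_three y x hi
  col_p i hi := col_one y x hi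
  col_q i hi := hp.col_two y x hi
  not_good_p := not_good 1 (by decide) (by decide)
  not_good_q := not_good 2 (by decide) (by decide)
  b_eq_zero i hi := weights_eq_zero hi
  quadrature m hm := weights_quadrature hm
  d_zero := by
    rw [hp.d_eq_pairVec y x (by norm_num), value_eq_zero LobattoField.second_zero, pairVec_zero]
  d_mem := hp.d_mem_annihilators y x
  zero_p := by
    rintro f ⟨a, k, rfl⟩
    exact (((hp.momentFree_d y x le_rfl).smul a).add (momentFree_pairVec k)).one
  zero_q := by
    rintro f ⟨a, k, rfl⟩
    exact (((hp.momentFree_d y x le_rfl).smul a).add (momentFree_pairVec k)).two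
  zero_pow := by
    rintro f ⟨a, k, rfl⟩ m hm
    rcases hm.lt_or_eq with hm | rfl
    · exact (((hp.momentFree_d y x le_rfl).smul a).add (momentFree_pairVec k)).moment m (by lia)
    · have := sum_pairVec_pow (p := p) k 4
      change ∑ i, (a • (p.preMethod y x).d 4 + p.pairVec k) i * p.nodes i ^ 4 = 0
      simp only [Pi.add_apply, Pi.smul_apply, smul_eq_mul, add_mul, Finset.sum_add_distrib,
        mul_assoc, ← Finset.mul_sum, h4, this]
      ring
  zero_col := by
    rintro f ⟨a, k, rfl⟩
    change ((a • (p.preMethod y x).d 4 + p.pairVec k) ᵥ* p.matrix y x) 2 = 0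
    have := (hp.momentFree_vecMul y x (fun _ => pairVec_eq_zero k)
      fun m _ => sum_pairVec_pow k m).two
    rw [add_vecMul, smul_vecMul, Pi.add_apply, Pi.smul_apply, hcol, this, smul_zero, add_zero]
  zero_cube := by
    rintro f ⟨a, k, rfl⟩
    change ∑ i, ((a • (p.preMethod y x).d 4 + p.pairVec k) ᵥ* p.matrix y x) i * p.nodes i ^ 3 = 0
    have := (hp.momentFree_vecMul y x (fun _ => pairVec_eq_zero k)
      fun m _ => sum_pairVec_pow k m).moment 3 le_rfl
    simp only [add_vecMul, smul_vecMul, Pi.add_apply, Pi.smul_apply, smul_eq_mul, add_mul,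
      Finset.sum_add_distrib, mul_assoc, ← Finset.mul_sum, hcube, this]
    ring
  succ_eq_zero j f hf i hi := by
    obtain ⟨k, rfl⟩ := exists_pairVec_of_mem hf
    exact pairVec_eq_zero k hi
  succ_pow j f hf m := by
    obtain ⟨k, rfl⟩ := exists_pairVec_of_mem hf
    exact sum_pairVec_pow k m
  succ_vecMul j f hf := hp.annihilators_vecMul hf
  succ_mul j f hf := annihilators_mul_nodes hf

end Params

end RK10

-- The equation for `a₈₇` and the choice of `c₆`.

namespace LobattoField

/-- Non-vanishing is certified by an explicit inverse, because non-zero coordinates alone would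
require linear independence of the basis. -/
theorem ne_zero_of_mul {x : LobattoField} (y : LobattoField)
    (h : SameValue (x * y) ((1 : ℤ) : LobattoField)) : (x : ℝ) ≠ 0 := by
  have e := h.coe_eq
  push_cast at e
  exact left_ne_zero_of_mul (e ▸ one_ne_zero)

theorem sum4_last_ne_zero : (sum4 4 : ℝ) ≠ 0 :=
  ne_zero_of_mul ⟨5230890, -6253030, 880650, -7613930, -38222100, -75944820, 17524080, -30166080,
    89503, by decide⟩ (by decide +kernel)

theorem minorFactor_ne_zero : (minorFactor : ℝ) ≠ 0 :=
  ne_zero_of_mul ⟨182683063886400, -30285539524800, 65895037790400, -14726061806400,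
    -245116902945600, 1013848538068800, -80457182366400, 379127336616000, 1517,
    by decide⟩ (by decide +kernel)

end LobattoField

namespace RK10

open LobattoField (minorFactor)

/-- The part of the moments of `d₄` over the stages from the seventh on that is independent of
`a₈₇`. -/
noncomputable def moment4 (m : Fin 4) : ℝ := LobattoField.moment4 m

/-- The coefficient of `a₈₇` in the sum of `d₄` over the stages with node `θ₄`. -/
noncomputable def slope4 : ℝ := LobattoField.sum4 4

theorem theta4_pos : 0 < theta4 := by
  have := LobattoField.beta_pos; rw [theta4]; linarith

theorem minors :
    moment4 3 * theta4 ^ 3 - moment4 2 * theta4 ^ 4 = minorFactor * (2 * U0) ∧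
    3 * (moment4 3 * theta4 ^ 2 - moment4 1 * theta4 ^ 4) = minorFactor * (-28 * U1) ∧
    moment4 2 * theta4 ^ 2 - moment4 1 * theta4 ^ 3 = minorFactor * U2 ∧
    3 * (moment4 3 * theta4 - moment4 0 * theta4 ^ 4) = minorFactor * (14 * V0 - 2 * U2) ∧
    moment4 2 * theta4 - moment4 0 * theta4 ^ 3 = minorFactor * (-70 * V1) ∧
    moment4 1 * theta4 - moment4 0 * theta4 ^ 2 = minorFactor * (140 * V2) := by
  have h1 := LobattoField.minor_three_two.coe_eq
  have h2 := LobattoField.minor_three_one.coe_eq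
  have h3 := LobattoField.minor_two_one.coe_eq
  have h4 := LobattoField.minor_three_zero.coe_eq
  have h5 := LobattoField.minor_two_zero.coe_eq
  have h6 := LobattoField.minor_one_zero.coe_eq
  simp only [LobattoField.minor] at h1 h2 h3 h4 h5 h6
  push_cast at h1 h2 h3 h4 h5 h6
  norm_num at h1 h2 h3 h4 h5 h6
  simp only [moment4]
  exact ⟨h1, by linear_combination h2, h3, h4, by linear_combination h5, h6⟩

namespace Params

open Matrix

variable (p : Params)

/-- The moments of `d₄` over the stages from the seventh on. -/
noncomputable def lateMoment (x : ℝ) (m : Fin 4) : ℝ :=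
  moment4 m + slope4 * x * theta4 ^ (m.val + 1)

variable {p}

/-- The pair part of `d₄` has no moments, so only the node sums contribute. The index `m` stands for
the exponent `m + 1`. -/
theorem Regular.sum_d_natAdd (hp : p.Regular) (y x : ℝ) (m : Fin 4) :
    ∑ r : Fin 9, (p.preMethod y x).d 4 (Fin.natAdd 6 r) * p.nodes (Fin.natAdd 6 r) ^ (m.val + 1)
      = lateMoment x m := by
  have h := (LobattoField.moment4_eq m).coe_eq
  push_cast at h
  have e := sum_pairVec_pow (p := p) (value (LobattoField.second 4)) (m.val + 1)
  rw [sum_fin_fifteen] at e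
  simp only [show p.pairVec (value (LobattoField.second 4)) 0 = 0 from rfl,
    show p.pairVec (value (LobattoField.second 4)) 1 = 0 from rfl,
    show p.pairVec (value (LobattoField.second 4)) 2 = 0 from rfl,
    show p.pairVec (value (LobattoField.second 4)) 3 = 0 from rfl,
    show p.pairVec (value (LobattoField.second 4)) 4 = 0 from rfl,
    show p.pairVec (value (LobattoField.second 4)) 5 = 0 from rfl, zero_mul, zero_add] at e
  simp only [hp.d_natAdd, Pi.add_apply, add_mul, Finset.sum_add_distrib]
  rw [e, zero_add, lateMoment, moment4, slope4, ← h, value_eq LobattoField.nodeSum_four,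
    sum_fin_nine]
  simp [sumVec, nodes, value]
  ring

theorem Regular.d_early (hp : p.Regular) (y x : ℝ) (m : Fin 4) (hm : m ≠ 3) :
    (p.preMethod y x).d 4 3 * p.c4 ^ (m.val + 1) + (p.preMethod y x).d 4 4 * p.c5 ^ (m.val + 1)
      + (p.preMethod y x).d 4 5 * p.c6 ^ (m.val + 1) = -lateMoment x m := by
  have hd := hp.momentFree_d y x (n := 4) le_rfl
  have h := hd.moment (m.val + 1) (by lia)
  rw [sum_fin_fifteen, hp.sum_d_natAdd, hd.one, hd.two, show p.nodes 0 = 0 from rfl,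
    zero_pow (by lia), show p.nodes 3 = p.c4 from rfl, show p.nodes 4 = p.c5 from rfl,
    show p.nodes 5 = p.c6 from rfl] at h
  linarith

/-- The lower moments of `d₄` vanish, so `c⁴` may be replaced by `t(t - c₄)(t - c₅)(t - c₆)` at the
nodes. This polynomial is zero at every early stage where `d₄` may be non-zero. -/
theorem Regular.sum_d_pow_four (hp : p.Regular) (y x : ℝ) :
    ∑ i, (p.preMethod y x).d 4 i * p.nodes i ^ 4
      = lateMoment x 3 - (p.c4 + p.c5 + p.c6) * lateMoment x 2
        + (p.c4 * p.c5 + p.c4 * p.c6 + p.c5 * p.c6) * lateMoment x 1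
        - p.c4 * p.c5 * p.c6 * lateMoment x 0 := by
  have hd := hp.momentFree_d y x (n := 4) le_rfl
  have h0 := hp.d_early y x 0 (by decide)
  have h1 := hp.d_early y x 1 (by decide)
  have h2 := hp.d_early y x 2 (by decide)
  have h3 := hp.sum_d_natAdd y x 3
  simp only [Fin.isValue, Fin.val_zero, Fin.val_one, Fin.val_two, zero_add, one_add_one_eq_two,
    show (3 : Fin 4).val + 1 = 4 from rfl, show 2 + 1 = 3 from rfl] at h0 h1 h2 h3
  rw [sum_fin_fifteen, h3, hd.one, hd.two, show p.nodes 0 = 0 from rfl,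
    show p.nodes 3 = p.c4 from rfl, show p.nodes 4 = p.c5 from rfl, show p.nodes 5 = p.c6 from rfl]
  linear_combination (p.c4 + p.c5 + p.c6) * h2
    - (p.c4 * p.c5 + p.c4 * p.c6 + p.c5 * p.c6) * h1 + p.c4 * p.c5 * p.c6 * h0

/-- In the late moments `a₈₇` enters only through the node `θ₄`, so its coefficient is the same
quartic polynomial evaluated at `θ₄`. -/
theorem Regular.eqX_eq (hp : p.Regular) (x : ℝ) :
    p.eqX x = p.eqX 0
      + slope4 * (theta4 * (theta4 - p.c4) * (theta4 - p.c5) * (theta4 - p.c6)) * x := by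
  simp only [eqX, hp.sum_d_pow_four, lateMoment]
  simp only [Fin.isValue, Fin.val_zero, Fin.val_one, Fin.val_two, zero_add, one_add_one_eq_two,
    show (3 : Fin 4).val + 1 = 4 from rfl, show 2 + 1 = 3 from rfl]
  ring

theorem Regular.eqX_ne_iff (hp : p.Regular) :
    p.eqX 0 ≠ p.eqX 1 ↔ p.c4 ≠ theta4 ∧ p.c5 ≠ theta4 ∧ p.c6 ≠ theta4 := by
  rw [hp.eqX_eq 1, mul_one, ne_comm, ne_eq, add_eq_left]
  simp only [mul_eq_zero, show slope4 ≠ 0 from LobattoField.sum4_last_ne_zero, theta4_pos.ne',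
    sub_eq_zero, false_or, not_or, ne_eq, eq_comm (a := theta4), and_assoc]

theorem Regular.eqX_a87 (hp : p.Regular) (h : p.eqX 0 ≠ p.eqX 1) : p.eqX p.a87 = 0 := by
  have h1 := hp.eqX_eq 1
  rw [mul_one] at h1
  have h2 := sub_ne_zero.mpr h
  rw [hp.eqX_eq, ← sub_eq_of_eq_add' h1, a87]
  field_simp
  ring

theorem Regular.c6_mul (hp : p.Regular) : p.c6 * p.c6den
    = U0 * (p.c4 + p.c5) + 14 * U1 * p.c4 * p.c5 + U2 * p.c4 * p.c5 * (p.c4 + p.c5) := by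
  rw [Params.c6, div_mul_cancel₀ _ hp.c6den]

/-- The equations for the moments of `d₄` at the solution of the first affine equation. -/
theorem Regular.lateMoment_a87 (hp : p.Regular) (h : p.eqX 0 ≠ p.eqX 1) :
    lateMoment p.a87 3 / 4 - (p.c4 + p.c5) * lateMoment p.a87 2 / 3
      + p.c4 * p.c5 * lateMoment p.a87 1 / 2 = 0 ∧
    lateMoment p.a87 2 - (p.c4 + p.c5) * lateMoment p.a87 1 + p.c4 * p.c5 * lateMoment p.a87 0
      ≠ 0 := by
  have hroot := hp.eqX_a87 h
  obtain ⟨h4, h5, h6⟩ := hp.eqX_ne_iff.mp h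
  rw [eqX, hp.sum_d_pow_four] at hroot
  obtain ⟨m32, m31, m21, m30, m20, m10⟩ := minors
  have hc := hp.c6_mul
  have hden := hp.c6den
  simp only [lateMoment, Fin.isValue, Fin.val_zero, Fin.val_one, Fin.val_two, zero_add,
    one_add_one_eq_two, show (3 : Fin 4).val + 1 = 4 from rfl, show 2 + 1 = 3 from rfl,
    pow_one] at hroot ⊢
  have hlead : slope4 * theta4 * (theta4 - p.c4) * (theta4 - p.c5) * (theta4 - p.c6) ≠ 0 :=
    mul_ne_zero (mul_ne_zero (mul_ne_zero (mul_ne_zero LobattoField.sum4_last_ne_zero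
      theta4_pos.ne') (sub_ne_zero.mpr h4.symm)) (sub_ne_zero.mpr h5.symm)) (sub_ne_zero.mpr h6.symm)
  have hden' : slope4 * (minorFactor * p.c6den) ≠ 0 :=
    mul_ne_zero LobattoField.sum4_last_ne_zero (mul_ne_zero LobattoField.minorFactor_ne_zero hden)
  rw [Params.c6den] at hc hden'
  generalize p.a87 = x at *
  generalize p.c6 = z at *
  generalize p.c4 = u at *
  generalize p.c5 = v at *
  generalize slope4 = q at *
  generalize (minorFactor : ℝ) = μ at *
  generalize theta4 = t at *
  -- This is a second affine equation in `a₈₇ = x`. After multiplication by the leading coefficient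
  -- of the first, `x` is eliminated; the remaining determinant is a combination of the six minors
  -- and vanishes by the formula for `c₆`.
  have key : moment4 3 / 4 + q * x * t ^ 4 / 4 - (u + v) * (moment4 2 + q * x * t ^ 3) / 3
      + u * v * (moment4 1 + q * x * t ^ 2) / 2 = 0 := by
    refine (mul_eq_zero.mp (?_ : q * t * (t - u) * (t - v) * (t - z) * _ = 0)).resolve_left hlead
    linear_combination q * (t ^ 4 / 4 - (u + v) * t ^ 3 / 3 + u * v * t ^ 2 / 2) * hroot
      - q * ((-(u + v) / 12 + z / 4) * m32 + (u * v / 4 - z * (u + v) / 4) / 3 * m31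
      + (-(u + v) * (u * v) / 6 - z * (u * v / 2 - (u + v) ^ 2 / 3)) * m21
      + z * (u * v) / 12 * m30 - z * (u + v) * (u * v) / 3 * m20 + z * (u * v) ^ 2 / 2 * m10)
      - q * μ / 6 * hc
  -- The first equation has the form `P - c₆ Q`, where `Q` is the quantity claimed to be non-zero.
  -- If `Q` vanished together with the second equation, eliminating `x` from these two would make
  -- the denominator of `c₆` zero.
  refine ⟨by linear_combination key, fun h3 => hden' ?_⟩
  linear_combination -6 * q * (t ^ 4 / 4 - (u + v) * t ^ 3 / 3 + u * v * t ^ 2 / 2) * h3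
    + 6 * q * (t ^ 3 - (u + v) * t ^ 2 + u * v * t) * key
    + 6 * q * (-1 / 4 * m32 + (u + v) / 12 * m31 + (u * v / 2 - (u + v) ^ 2 / 3) * m21
      - u * v / 12 * m30 + (u + v) * (u * v) / 3 * m20 - (u * v) ^ 2 / 2 * m10)

end Params

end RK10

-- The equation for `a₆₅`, order ten, and openness of the parameter set.

namespace RK10

namespace Params

open Matrix

variable {p : Params}

theorem Regular.d_indep (hp : p.Regular) (y x : ℝ) :
    (p.preMethod y x).d 4 = (p.preMethod 0 x).d 4 :=
  hp.eq_of_momentFree (hp.momentFree_d y x le_rfl) (hp.momentFree_d 0 x le_rfl) fun r => by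
    rw [hp.d_natAdd, hp.d_natAdd]

theorem Regular.d_vecMul_two (hp : p.Regular) (y x : ℝ) :
    ((p.preMethod y x).d 4 ᵥ* p.matrix y x) 2 = (p.preMethod 0 x).d 4 3 * p.a43
      + (p.preMethod 0 x).d 4 4 * p.a53 + (p.preMethod 0 x).d 4 5 * p.a63 y := by
  change ∑ i, (p.preMethod y x).d 4 i * p.matrix y x i 2 = _
  rw [hp.d_indep, sum_fin_fifteen, (hp.momentFree_d 0 x (n := 4) le_rfl).one,
    (hp.momentFree_d 0 x (n := 4) le_rfl).two, matrix_zero,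
    Finset.sum_eq_zero fun r _ => by rw [hp.col_two y x (Or.inr ⟨r, rfl⟩), mul_zero],
    show p.matrix y x 3 2 = p.a43 from rfl, show p.matrix y x 4 2 = p.a53 from rfl,
    show p.matrix y x 5 2 = p.a63 y from rfl]
  ring

theorem eqY_eq_vecMul (p : Params) (y : ℝ) :
    p.eqY y = ((p.preMethod y p.a87).d 4 ᵥ* p.matrix y p.a87) 2 * p.a32 := by
  change _ = (∑ i, (p.preMethod y p.a87).d 4 i * p.matrix y p.a87 i 2) * p.a32
  rw [eqY, Finset.sum_mul]
  refine Finset.sum_congr rfl fun i _ => ?_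
  rw [Finset.sum_eq_single 2 (fun j _ hj => by rw [col_one y p.a87 hj, mul_zero])
    fun h => absurd (Finset.mem_univ _) h]
  rfl

theorem Regular.eqY_eq (hp : p.Regular) (y : ℝ) :
    p.eqY y = p.eqY 0 + p.a32 * ((p.preMethod 0 p.a87).d 4 5
      * (p.c5 * (p.c5 - p.c4) / (p.c3 * (p.c4 - p.c3)))) * y := by
  have h : p.a63 y = p.a63 0 + p.c5 * (p.c5 - p.c4) / (p.c3 * (p.c4 - p.c3)) * y := by
    have hc4 := hp.c4
    rw [Params.a63, Params.a63, Params.c3]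
    field_simp
    ring
  rw [eqY_eq_vecMul, eqY_eq_vecMul, hp.d_vecMul_two, hp.d_vecMul_two, h]
  ring

/-- The coefficient of `a₆₅` is a non-zero multiple of the entry of `d₄` at stage 6. Applying `t(t -
c₄)(t - c₅)` to the moment equations shows that a zero entry would contradict
`Regular.lateMoment_a87`. -/
theorem Regular.eqY_ne (hp : p.Regular) (h : p.eqX 0 ≠ p.eqX 1) : p.eqY 0 ≠ p.eqY 1 := by
  have h0 := hp.d_early 0 p.a87 0 (by decide)
  have h1 := hp.d_early 0 p.a87 1 (by decide)
  have h2 := hp.d_early 0 p.a87 2 (by decide)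
  simp only [Fin.isValue, Fin.val_zero, Fin.val_one, Fin.val_two, zero_add, one_add_one_eq_two,
    show 2 + 1 = 3 from rfl] at h0 h1 h2
  have hd : (p.preMethod 0 p.a87).d 4 5 ≠ 0 := fun hd => (hp.lateMoment_a87 h).2 (by
    linear_combination h2 - (p.c4 + p.c5) * h1 + p.c4 * p.c5 * h0
      - p.c6 * (p.c6 - p.c4) * (p.c6 - p.c5) * hd)
  have h43 : p.c4 - p.c3 ≠ 0 := by
    rw [show p.c4 - p.c3 = 1 / 3 * p.c4 by rw [Params.c3]; ring]
    exact mul_ne_zero (by norm_num) hp.c4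
  rw [hp.eqY_eq 1, mul_one, ne_comm, ne_eq, add_eq_left]
  exact mul_ne_zero hp.a32 (mul_ne_zero hd (div_ne_zero
    (mul_ne_zero hp.c5 (sub_ne_zero.mpr hp.c45.symm)) (mul_ne_zero hp.c3 h43)))

theorem Regular.eqY_a65 (hp : p.Regular) (h : p.eqY 0 ≠ p.eqY 1) : p.eqY p.a65 = 0 := by
  have h1 := hp.eqY_eq 1
  rw [mul_one] at h1
  have h2 := sub_ne_zero.mpr h
  rw [hp.eqY_eq, ← sub_eq_of_eq_add' h1, a65]
  field_simp
  ring

/-- The lower moments of `d₄A` vanish, so `c³` may be replaced by `t(t - c₄)(t - c₅)`. On late rows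
`A` integrates this polynomial exactly; on rows 4 to 6 only column 3 survives, and its total
contribution is a multiple of `(d₄A)₃ = 0`. -/
theorem Regular.d_cube (hp : p.Regular) (y x : ℝ)
    (hcol : ((p.preMethod y x).d 4 ᵥ* p.matrix y x) 2 = 0) :
    ∑ i, ((p.preMethod y x).d 4 ᵥ* p.matrix y x) i * p.nodes i ^ 3
      = lateMoment x 3 / 4 - (p.c4 + p.c5) * lateMoment x 2 / 3
        + p.c4 * p.c5 * lateMoment x 1 / 2 := by
  have hd := hp.momentFree_d y x (n := 4) le_rfl
  have h1 := hp.d_early y x 1 (by decide)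
  have h2 := hp.d_early y x 2 (by decide)
  have h3 := hp.sum_d_natAdd y x 3
  simp only [Fin.isValue, Fin.val_one, Fin.val_two, one_add_one_eq_two,
    show (3 : Fin 4).val + 1 = 4 from rfl, show 2 + 1 = 3 from rfl] at h1 h2 h3
  rw [hp.d_vecMul_two, ← hp.d_indep y] at hcol
  have e : ∑ j, ((p.preMethod y x).d 4 ᵥ* p.matrix y x) j * p.nodes j ^ 3
      = ∑ i, (p.preMethod y x).d 4 i * ∑ j, p.matrix y x i j * p.nodes j ^ 3 :=
    (dotProduct_mulVec _ (p.matrix y x) fun j => p.nodes j ^ 3).symm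
  have hlate : ∑ r : Fin 9, (p.preMethod y x).d 4 (Fin.natAdd 6 r)
      * ∑ j, p.matrix y x (Fin.natAdd 6 r) j * p.nodes j ^ 3 = lateMoment x 3 / 4 := by
    rw [← h3, Finset.sum_div]
    refine Finset.sum_congr rfl fun r _ => ?_
    rw [hp.row_three y x (Or.inr ⟨r, rfl⟩), mul_div_assoc]
  have n0 : p.nodes 0 = 0 := rfl
  have n2 : p.nodes 2 = p.c3 := rfl
  have n3 : p.nodes 3 = p.c4 := rfl
  have n4 : p.nodes 4 = p.c5 := rfl
  have n5 : p.nodes 5 = p.c6 := rfl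
  obtain ⟨-, a3, a4, a5⟩ := p.sum_early y x p.nodes
  obtain ⟨-, b3, b4, b5⟩ := p.sum_early y x fun j => p.nodes j ^ 2
  obtain ⟨-, c3, c4, c5⟩ := p.sum_early y x fun j => p.nodes j ^ 3
  rw [hp.row_one y x (by decide), n0, n2, n3] at a3
  rw [hp.row_one y x (by decide), n0, n2, n3, n4] at a4
  rw [hp.row_one y x (by decide), n0, n2, n3, n4, n5] at a5
  rw [hp.row_two y x (by decide) (by decide), n0, n2, n3] at b3
  rw [hp.row_two y x (by decide) (by decide), n0, n2, n3, n4] at b4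
  rw [hp.row_two y x (by decide) (by decide), n0, n2, n3, n4, n5] at b5
  rw [n0, n2] at c3
  rw [n0, n2, n3] at c4
  rw [n0, n2, n3, n4] at c5
  rw [e, sum_fin_fifteen, hlate, hd.one, hd.two, c3, c4, c5]
  simp only [matrix_zero, zero_mul, Finset.sum_const_zero, mul_zero]
  linear_combination (p.c4 + p.c5) / 3 * h2 - p.c4 * p.c5 / 2 * h1
    + p.c3 * (p.c3 - p.c4) * (p.c3 - p.c5) * hcol
    + (p.preMethod y x).d 4 3 * (p.c4 * p.c5 * a3 - (p.c4 + p.c5) * b3)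
    + (p.preMethod y x).d 4 4 * (p.c4 * p.c5 * a4 - (p.c4 + p.c5) * b4)
    + (p.preMethod y x).d 4 5 * (p.c4 * p.c5 * a5 - (p.c4 + p.c5) * b5)

/-- Solvability for `a₆₅` is automatic, and solvability for `a₈₇` only says that `c₄`, `c₅`, `c₆`
differ from `θ₄`. -/
theorem admissible_iff : p.Admissible ↔
    p.Regular ∧ p.c4 ≠ theta4 ∧ p.c5 ≠ theta4 ∧ p.c6 ≠ theta4 := by
  constructor
  · rintro ⟨h1, h2, h3, h4, h5, h6, h7, h8, h9, h10, h11, h12, hX, -⟩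
    have hp : p.Regular := ⟨h1, h2, h3, h4, h5, h6, h7, h8, h9, h10, h11, h12⟩
    exact ⟨hp, hp.eqX_ne_iff.mp hX⟩
  · rintro ⟨hp, h⟩
    have hX := hp.eqX_ne_iff.mpr h
    exact ⟨hp.c2, hp.b10, hp.b12, hp.b13, hp.b14, hp.c6den, hp.c4, hp.c5, hp.c6, hp.c45, hp.c46,
      hp.c56, hX, hp.eqY_ne hX⟩

theorem Admissible.hasOrder (h : p.Admissible) : p.method.HasOrder 10 := by
  obtain ⟨hp, hθ⟩ := admissible_iff.mp h
  have hX := hp.eqX_ne_iff.mpr hθ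
  have hroot := hp.eqX_a87 hX
  have hrootY := hp.eqY_a65 (hp.eqY_ne hX)
  rw [eqY_eq_vecMul] at hrootY
  have hcol := (mul_eq_zero.mp hrootY).resolve_right hp.a32
  refine (hp.tenCriterion (y := p.a65) ?_ hcol ?_).hasOrder
  · rw [hp.d_indep]; exact hroot
  · rw [hp.d_cube _ _ hcol, (hp.lateMoment_a87 hX).1]

/-- The numerator of the node `c6`. -/
noncomputable def c6num (p : Params) : ℝ :=
  U0 * (p.c4 + p.c5) + 14 * U1 * p.c4 * p.c5 + U2 * p.c4 * p.c5 * (p.c4 + p.c5)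

/-- Clearing the denominator of `c₆` leaves finitely many polynomial inequations, which define an
open set and can be tested exactly. -/
theorem admissible_iff_polynomial : p.Admissible ↔
    p.c2 ≠ 0 ∧ p.b10 ≠ 0 ∧ p.b12 ≠ 0 ∧ p.b13 ≠ 0 ∧ p.b14 ≠ 0 ∧ p.c6den ≠ 0 ∧ p.c4 ≠ 0 ∧ p.c5 ≠ 0 ∧
    p.c6num ≠ 0 ∧ p.c4 ≠ p.c5 ∧ p.c4 * p.c6den ≠ p.c6num ∧ p.c5 * p.c6den ≠ p.c6num ∧
    p.c4 ≠ theta4 ∧ p.c5 ≠ theta4 ∧ p.c6num ≠ theta4 * p.c6den := by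
  have e : p.c6 = p.c6num / p.c6den := rfl
  rw [admissible_iff]
  constructor
  · rintro ⟨⟨h1, h2, h3, h4, h5, h6, h7, h8, h9, h10, h11, h12⟩, h13, h14, h15⟩
    rw [e, div_ne_zero_iff] at h9
    rw [e, ne_eq, eq_div_iff h6] at h11 h12
    rw [e, ne_eq, div_eq_iff h6] at h15
    exact ⟨h1, h2, h3, h4, h5, h6, h7, h8, h9.1, h10, h11, h12, h13, h14, h15⟩
  · rintro ⟨h1, h2, h3, h4, h5, h6, h7, h8, h9, h10, h11, h12, h13, h14, h15⟩
    refine ⟨⟨h1, h2, h3, h4, h5, h6, h7, h8, ?_, h10, ?_, ?_⟩, h13, h14, ?_⟩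
    · rw [e]; exact div_ne_zero h9 h6
    · rwa [e, ne_eq, eq_div_iff h6]
    · rwa [e, ne_eq, eq_div_iff h6]
    · rwa [e, ne_eq, div_eq_iff h6]

theorem isOpen_admissible : IsOpen {x : Fin 7 → ℝ | (ofVec x).Admissible} := by
  simp only [admissible_iff_polynomial, c6num, c6den, ofVec]
  repeat' refine IsOpen.and ?_ ?_
  all_goals exact isOpen_ne_fun (by fun_prop) (by fun_prop)

theorem injOn_method : Set.InjOn Params.method {p | p.Admissible} := by
  intro p _ q _ h
  have hb : p.weights = q.weights := congrArg RKMethod.b h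
  have hc : p.nodes = q.nodes := congrArg RKMethod.c h
  have e1 : p.c2 = q.c2 := congrFun hc 1
  have e2 : p.c4 = q.c4 := congrFun hc 3
  have e3 : p.c5 = q.c5 := congrFun hc 4
  have e4 : p.b10 = q.b10 := congrFun hb 9
  have e5 : p.b12 = q.b12 := congrFun hb 11
  have e6 : p.b13 = q.b13 := congrFun hb 12
  have e7 : p.b14 = q.b14 := congrFun hb 13
  cases p
  cases q
  simp only at e1 e2 e3 e4 e5 e6 e7
  simp only [e1, e2, e3, e4, e5, e6, e7]

end Params

end RK10

-- Admissibility of the particular choice.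

namespace LobattoField

/-- The numerator of the sixth node for the particular choice of parameters. -/
def particularNum : LobattoField :=
  ⟨-17012, 155484, -212882, 218392, -2767912, -1259594, -200228, 646940, 35, by decide⟩

/-- The denominator of the sixth node for the particular choice of parameters. -/
def particularDen : LobattoField :=
  ⟨11304458, -44982, -910629, 1234152, -22839600, -5090897, -915822, 5457194, 35, by decide⟩

def twoFifths : LobattoField := ⟨2, 0, 0, 0, 0, 0, 0, 0, 5, by decide⟩

def fourSevenths : LobattoField := ⟨4, 0, 0, 0, 0, 0, 0, 0, 7, by decide⟩

@[norm_cast] theorem coe_twoFifths : (twoFifths : ℝ) = 2 / 5 := by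
  simp [toReal, RK10.lobattoNumber, twoFifths]

@[norm_cast] theorem coe_fourSevenths : (fourSevenths : ℝ) = 4 / 7 := by
  simp [toReal, RK10.lobattoNumber, fourSevenths]

/-- Arithmetic on coordinates never reduces fractions, so the numerator and the denominator of `c₆`
are replaced by compact forms before the inverses are tested. -/
theorem particularNum_eq : SameValue particularNum
    (U0 * (twoFifths + fourSevenths) + ((14 : ℤ) : LobattoField) * U1 * twoFifths * fourSevenths
      + U2 * twoFifths * fourSevenths * (twoFifths + fourSevenths)) := by
  decide +kernel

theorem particularDen_eq : SameValue particularDen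
    (((3 : ℤ) : LobattoField) * U0 + ((14 : ℤ) : LobattoField) * U1 * (twoFifths + fourSevenths)
      + ((2 : ℤ) : LobattoField) * U2 * (twoFifths ^ 2 + fourSevenths ^ 2)
      + ((7 : ℤ) : LobattoField) * twoFifths * fourSevenths * (V0
        + ((20 : ℤ) : LobattoField) * V1 * (twoFifths + fourSevenths)
        + ((60 : ℤ) : LobattoField) * V2 * twoFifths * fourSevenths)) := by
  decide +kernel

theorem particularNum_ne : (particularNum : ℝ) ≠ 0 :=
  ne_zero_of_mul ⟨12662453519354637929, -10678044849298496278, 8991055486996662884,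
    -9392117901981994564, -41793702904031041488, -18467974559741771568, -40394268403616185674,
    42347550475080673221, 5459584827671984403293764, by decide⟩
    (by decide +kernel)

theorem particularDen_ne : (particularDen : ℝ) ≠ 0 :=
  ne_zero_of_mul ⟨-65617502886880484522160003, -9447883023492676500171938,
    13883423847989512381312328, -2329188326538607559901736, -7307359784384583172026540,
    -119752363559538255221236820, -16166342900552205500753502, 10722670336482566204501129,
    7521548144597004120447458162642, by decide⟩
    (by decide +kernel)

theorem particular_c4_ne : ((twoFifths * particularDen - particularNum : LobattoField) : ℝ) ≠ 0 :=
  ne_zero_of_mul ⟨34500823866327428684130, 9819637375515267466355, -3585208416623682688455,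
    4060824478232382869435, 20910848996417084779725, 83091277914715799819475,
    -425903084160599126655, 15824070262216928561010, 2638157729139180090953994192, by decide⟩
    (by decide +kernel)

theorem particular_c5_ne :
    ((fourSevenths * particularDen - particularNum : LobattoField) : ℝ) ≠ 0 :=
  ne_zero_of_mul ⟨52816985944840335287797916601, 15069847037874872199034420370,
    94586494643763297089761308, 6827168390091602553535192196, 44990024843354408502590854536,
    129887792104996667039645736312, 5821818787287003570612485838, 27287420087602446787482656469,
    2777666794956850302700623117508884, by decide⟩
    (by decide +kernel)

theorem particular_c6_ne : ((theta4 * particularDen - particularNum : LobattoField) : ℝ) ≠ 0 :=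
  ne_zero_of_mul ⟨1056185904794356161, 175149028607671566, -155075232639004146, 110891237117240538,
    669185697290475750, 1335915039227421891, 27078009939020586, 537349586985184008,
    23921896623234551890406, by decide⟩
    (by decide +kernel)

theorem theta4_sub_twoFifths_ne : ((theta4 - twoFifths : LobattoField) : ℝ) ≠ 0 :=
  ne_zero_of_mul ⟨-385, 0, -125, 0, 0, 1925, 0, 625, 74, by decide⟩ (by decide +kernel)

theorem theta4_sub_fourSevenths_ne : ((theta4 - fourSevenths : LobattoField) : ℝ) ≠ 0 :=
  ne_zero_of_mul ⟨161, 0, 49, 0, 0, 1127, 0, 343, 62, by decide⟩ (by decide +kernel)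

end LobattoField

namespace RK10

open LobattoField in
theorem particular_admissible : particular.Admissible := by
  have hnum : particular.c6num = particularNum := by
    rw [particularNum_eq.coe_eq]
    push_cast
    rfl
  have hden : particular.c6den = particularDen := by
    rw [particularDen_eq.coe_eq]
    push_cast
    rfl
  have h4 := particular_c4_ne
  have h5 := particular_c5_ne
  have h6 := particular_c6_ne
  have h7 := theta4_sub_twoFifths_ne
  have h8 := theta4_sub_fourSevenths_ne
  push_cast at h4 h5 h6 h7 h8
  rw [Params.admissible_iff_polynomial, hnum, hden]
  refine ⟨by norm_num [particular], mul_ne_zero (by norm_num) w2_pos.ne',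
    mul_ne_zero (by norm_num) w3_pos.ne', w4_pos.ne', w5_pos.ne', particularDen_ne,
    by norm_num [particular], by norm_num [particular], particularNum_ne,
    by norm_num [particular], sub_ne_zero.mp h4, sub_ne_zero.mp h5, (sub_ne_zero.mp h7).symm,
    (sub_ne_zero.mp h8).symm, (sub_ne_zero.mp h6).symm⟩

end RK10

theorem mainTheorem1 :
    -- there are 1205 rooted trees with at most 10 vertices
    Nat.card {t : ButcherTree // t.order ≤ 10} = 1205 ∧
    -- the family has seven free parameters: they range over an open subset of seven-dimensional
    -- space, and different parameters give different methods
    IsOpen {x : Fin 7 → ℝ | (RK10.Params.ofVec x).Admissible} ∧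
    Set.InjOn RK10.Params.method {p | p.Admissible} ∧
    -- every member is an explicit method of order 10 with the stated nodes and weights
    (∀ p : RK10.Params, p.Admissible →
      p.method.IsExplicit ∧ p.method.RowSum ∧ p.method.HasOrder 10 ∧
      p.method.c = ![0, p.c2, 2 / 3 * p.c4, p.c4, p.c5, p.c6, RK10.theta4, RK10.theta5,
        RK10.theta2, RK10.theta2, RK10.theta3, RK10.theta3, RK10.theta4, RK10.theta5, 1] ∧
      p.method.b = ![RK10.w1, 0, 0, 0, 0, 0, RK10.w4 - p.b13, RK10.w5 - p.b14, RK10.w2 - p.b10,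
        p.b10, RK10.w3 - p.b12, p.b12, p.b13, p.b14, RK10.w6] ∧
      p.method.A 4 1 = 0 ∧ p.method.A 5 1 = 0) ∧
    -- the particular choice of parameters gives a member of the family
    RK10.particular.Admissible :=
  ⟨ButcherTree.card_order_le_ten, RK10.Params.isOpen_admissible, RK10.Params.injOn_method,
    fun p h => ⟨fun _ _ hij => p.matrix_eq_zero _ _ hij, p.rowSum _ _, h.hasOrder, rfl, rfl, rfl,
      rfl⟩, RK10.particular_admissible⟩
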